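/- Conventions. Fix a small category $\mathrm{Sch}$ of schemes, full in the category of all schemes, that contains (up to isomorphism) all open subschemes of its objects; "scheme" means an object of $\mathrm{Sch}$. For a scheme $X$ the big Zariski site is the category $\mathrm{Sch}/X$, where a covering of $Y$ is a jointly surjective family of open immersions into $Y$, with the sheaf of rings $\mathcal O(Y)=\mathcal O_Y(Y)$. For a sieve $H$ on $X$ let $\mathcal C_H$ be the full subcategory of $\mathrm{Sch}/X$ on the $Y\to X$ that lie in $H$. A standard vector bundle on $X$ is a pair $(H,E)$: $H$ is a sieve on $X$ containing a Zariski covering of $X$, and $E$ is a presheaf of $\mathcal O$-modules on $\mathcal C_H$ such that for every $Y\to X$ in $\mathcal C_H$ there is an $n$ with $E(Y)=\mathcal O_Y(Y)^n$ and such that the map $\mathcal O^n\to E|_{Y}$ of presheaves on $\mathrm{Sch}/Y$ given by the standard basis of $E(Y)$ is an isomorphism. Let $\xi_HE$ be the sheaf of $\mathcal O$-modules on $\mathrm{Sch}/X$ associated to $E$ (it restricts to $E$ on $\mathcal C_H$). A morphism $(H,E)\to(K,F)$ is a morphism $\xi_HE\to\xi_KF$ of sheaves of $\mathcal O$-modules.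 This defines the category $\mathbb V(X)$ of standard vector bundles on $X$. Let $\Phi(H,E)$ be the restriction of $\xi_HE$ to the open subsets of $X$, an $\mathcal O_X$-module. A sequence in $\mathbb V(X)$ is called short exact if its image under $\Phi$ is a short exact sequence of $\mathcal O_X$-modules. Let $\mathrm{VB}(X)$ be the category of locally free $\mathcal O_X$-modules of finite rank, with the sequences that are short exact as sequences of $\mathcal O_X$-modules. A functor is exact if it is additive and preserves short exact sequences. For $f:Y\to X$ the pullback is $f^*(H,E)=(f^*H,f^*E)$ with $f^*H=\{Z\to Y \mid (Z\to Y\to X)\in H\}$ and $(f^*E)(Z\to Y)=E(Z\to Y\to X)$; on morphisms it is restriction along $\mathrm{Sch}/Y\to\mathrm{Sch}/X$, using $(\xi_HE)|_{\mathrm{Sch}/Y}=\xi_{f^*H}f^*E$. The tensor product $(H,E)\otimes(K,F)$ is the standard vector bundle on $H\cap K$ with value $\mathcal O_Y(Y)^{rs}$ at $Y$ if $E(Y)=\mathcal O_Y(Y)^r$ and $F(Y)=\mathcal O_Y(Y)^s$, and with restriction maps those of $E(Y)\otimes F(Y)$ under the identification $(a_1,\dots,a_r)\otimes(b_1,\dots,b_s)\mapsto(a_1b_1,\dots,a_1b_s,\dots,a_rb_1,\dots,a_rb_s)$;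 on morphisms, $\gamma\otimes\delta$ is the sheafification of the presheaf tensor product of $\gamma$ and $\delta$, under the canonical isomorphism of $\xi_{H\cap K}(E\otimes F)$ with the sheaf tensor product of $\xi_HE$ and $\xi_KF$. The zero bundle $0$ is the standard vector bundle of rank $0$ on the maximal sieve of $X$; its restriction to a sieve $H$ containing a covering is denoted $0_H$. Theorem. 1. For every scheme $X$, the category $\mathbb V(X)$ is small and, with the above short exact sequences, it is an exact category in the sense of Quillen. 2. For every scheme $X$, $\Phi$ takes values in $\mathrm{VB}(X)$, and $\Phi:\mathbb V(X)\to\mathrm{VB}(X)$ is an equivalence of categories with a quasi-inverse $\Psi:\mathrm{VB}(X)\to\mathbb V(X)$ such that both $\Phi$ and $\Psi$ are exact functors. 3. For every morphism $f:Y\to X$, $f^*:\mathbb V(X)\to\mathbb V(Y)$ is an exact functor, and for every further morphism $g:Z\to Y$ the functors $(fg)^*$ and $g^*f^*$ from $\mathbb V(X)$ to $\mathbb V(Z)$ are equal (not merely naturally isomorphic). 4. The tensor product $\otimes:\mathbb V(X)\times\mathbb V(X)\to\mathbb V(X)$ is biexact: for every $E\in\mathbb V(X)$ with sieve $H$ one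 has $0\otimes E=E\otimes 0=0_H$ (equality of standard vector bundles), where $0$ and $0_H$ are zero objects of $\mathbb V(X)$, and the functors $-\otimes E$ and $E\otimes -$ are exact. -/

import Mathlib

open CategoryTheory Limits Opposite AlgebraicGeometry

universe u

namespace StandardVB

/-- A small category of schemes containing, up to isomorphism, all open subschemes of all of its
objects: a family of schemes indexed by a type `ι : Type u`. All morphisms of schemes between the
members of the family are allowed, see `SmallSchemes.Cat`. -/
structure SmallSchemes where
  /-- The index type. -/
  ι : Type u
  /-- The schemes in the family. -/
  scheme : ι → Scheme.{u}
  exists_open : ∀ (i : ι) (U : (scheme i).Opens), ∃ j, Nonempty (scheme j ≅ (U : Scheme.{u}))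

namespace SmallSchemes

/-- The full subcategory of schemes on the members of the family. Its objects are elements of the
small type `𝒮.ι`, and the scheme that belongs to `X : 𝒮.Cat` is `𝒮.scheme X`. -/
abbrev Cat (𝒮 : SmallSchemes.{u}) : Type u := InducedCategory Scheme.{u} 𝒮.scheme

variable (𝒮 : SmallSchemes.{u})

/-- An object of the category that represents the open subscheme `U` of `X`. -/
noncomputable def openObj (X : 𝒮.Cat) (U : (𝒮.scheme X).Opens) : 𝒮.Cat :=
  (𝒮.exists_open X U).choose

/-- The isomorphism of `openObj X U` with `U`. -/
noncomputable def openIso (X : 𝒮.Cat) (U : (𝒮.scheme X).Opens) :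
    𝒮.scheme (𝒮.openObj X U) ≅ (U : Scheme.{u}) :=
  (𝒮.exists_open X U).choose_spec.some

/-- The open immersion of `openObj X U` into `X`. -/
noncomputable def openHom (X : 𝒮.Cat) (U : (𝒮.scheme X).Opens) : 𝒮.openObj X U ⟶ X :=
  InducedCategory.homMk ((𝒮.openIso X U).hom ≫ U.ι)

instance (X : 𝒮.Cat) (U : (𝒮.scheme X).Opens) : IsOpenImmersion (𝒮.openHom X U).hom :=
  inferInstanceAs (IsOpenImmersion ((𝒮.openIso X U).hom ≫ U.ι))

lemma openHom_range (X : 𝒮.Cat) (U : (𝒮.scheme X).Opens) :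
    (𝒮.openHom X U).hom.opensRange = U := by
  change ((𝒮.openIso X U).hom ≫ U.ι).opensRange = U
  rw [Scheme.Hom.opensRange_comp_of_isIso]
  simp

lemma openHom_mem (X : 𝒮.Cat) (U : (𝒮.scheme X).Opens) (a : 𝒮.scheme (𝒮.openObj X U)) :
    (𝒮.openHom X U).hom a ∈ U := by
  have : (𝒮.openHom X U).hom a ∈ (𝒮.openHom X U).hom.opensRange := ⟨a, rfl⟩
  rwa [openHom_range] at this

/-- Lifting along an open immersion. -/
noncomputable def lift {U X V : 𝒮.Cat} (j : U ⟶ X) [IsOpenImmersion j.hom] (f : V ⟶ X)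
    (h : ∀ v : 𝒮.scheme V, f.hom v ∈ Set.range j.hom) : V ⟶ U :=
  InducedCategory.homMk (IsOpenImmersion.lift j.hom f.hom (by rintro _ ⟨a, rfl⟩; exact h a))

lemma lift_fac {U X V : 𝒮.Cat} (j : U ⟶ X) [IsOpenImmersion j.hom] (f : V ⟶ X)
    (h : ∀ v : 𝒮.scheme V, f.hom v ∈ Set.range j.hom) : 𝒮.lift j f h ≫ j = f := by
  ext1
  exact IsOpenImmersion.lift_fac _ _ _

/-- The Zariski topology: a sieve covers `X` if it contains a family of open immersions that is
jointly surjective. -/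
def zariski : GrothendieckTopology 𝒮.Cat where
  sieves X := {S | ∀ x : 𝒮.scheme X, ∃ (U : 𝒮.Cat) (j : U ⟶ X),
    S j ∧ IsOpenImmersion j.hom ∧ x ∈ Set.range j.hom}
  top_mem' X x := ⟨X, 𝟙 X, trivial, inferInstanceAs (IsOpenImmersion (𝟙 (𝒮.scheme X))), x, rfl⟩
  pullback_stable' {X Y S} f hS y := by
    obtain ⟨U, j, hj, hj', hx⟩ := hS (f.hom y)
    refine ⟨_, 𝒮.openHom Y (f.hom ⁻¹ᵁ j.hom.opensRange), ?_, inferInstance, ?_⟩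
    · have := 𝒮.lift_fac j (𝒮.openHom Y (f.hom ⁻¹ᵁ j.hom.opensRange) ≫ f) (fun v => by
        simpa using 𝒮.openHom_mem Y (f.hom ⁻¹ᵁ j.hom.opensRange) v)
      rw [Sieve.pullback_apply, ← this]
      exact S.downward_closed hj _
    · change y ∈ (𝒮.openHom Y (f.hom ⁻¹ᵁ j.hom.opensRange)).hom.opensRange
      rw [openHom_range]
      exact hx
  transitive' {X S} hS R hR x := by
    obtain ⟨U, j, hj, hj', a, rfl⟩ := hS x
    obtain ⟨V, k, hk, hk', b, rfl⟩ := hR hj a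
    exact ⟨V, k ≫ j, hk, inferInstanceAs (IsOpenImmersion (k.hom ≫ j.hom)), b, by simp⟩

lemma mem_zariski {X : 𝒮.Cat} {S : Sieve X} : S ∈ 𝒮.zariski X ↔
    ∀ x : 𝒮.scheme X, ∃ (U : 𝒮.Cat) (j : U ⟶ X),
      S j ∧ IsOpenImmersion j.hom ∧ x ∈ Set.range j.hom := Iff.rfl

/-- The presheaf `Y ↦ 𝒪_Y(Y)` of global functions. -/
def O : 𝒮.Catᵒᵖ ⥤ CommRingCat.{u} := (inducedFunctor 𝒮.scheme).op ⋙ Scheme.Γ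


lemma O_map_comp {Y Z W : 𝒮.Cat} (h : W ⟶ Z) (g : Z ⟶ Y) (a : 𝒮.O.obj (op Y)) :
    𝒮.O.map (h ≫ g).op a = 𝒮.O.map h.op (𝒮.O.map g.op a) := by
  rw [op_comp, Functor.map_comp]; rfl

lemma O_map_eq {V Y : 𝒮.Cat} (j : V ⟶ Y) (a : 𝒮.O.obj (op Y)) :
    𝒮.O.map j.op a = j.hom.appLE ⊤ ⊤ (le_refl (j.hom ⁻¹ᵁ ⊤)) a := by
  have := Scheme.Hom.appLE_eq_app (f := j.hom) (U := ⊤)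
  exact congr($(this.symm) a)

lemma appLE_injective {V Y : Scheme.{u}} (j : V ⟶ Y) [IsOpenImmersion j] (U : Y.Opens)
    (hU : j ''ᵁ ⊤ = U) (e) : Function.Injective (j.appLE U ⊤ e) := by
  subst hU
  rw [← Scheme.Hom.appIso_hom']
  exact (j.appIso ⊤).commRingCatIsoToRingEquiv.injective

lemma O_sep {Y : 𝒮.Cat} {S : Sieve Y} (hS : S ∈ 𝒮.zariski Y) (a b : 𝒮.O.obj (op Y))
    (h : ∀ (V : 𝒮.Cat) (j : V ⟶ Y), S j → 𝒮.O.map j.op a = 𝒮.O.map j.op b) : a = b := by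
  choose V j hj hj' hx using hS
  refine TopCat.Sheaf.eq_of_locally_eq' (𝒮.scheme Y).sheaf (fun x => (j x).hom ''ᵁ ⊤) ⊤
    (fun x => homOfLE le_top) ?_ _ _ ?_
  · intro x _
    simp only [TopologicalSpace.Opens.mem_iSup]
    obtain ⟨a, ha⟩ := hx x
    exact ⟨x, a, trivial, ha⟩
  · intro x
    have := h _ (j x) (hj x)
    rw [O_map_eq, O_map_eq] at this
    apply appLE_injective (j x).hom ((j x).hom ''ᵁ ⊤) rfl ((Scheme.Hom.preimage_image_eq _ _).ge)
    rw [← Scheme.Hom.map_appLE (f := (j x).hom) (e := (Scheme.Hom.preimage_image_eq _ _).ge)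
      (i := (homOfLE le_top).op)] at this
    exact this

lemma O_glue {Y : 𝒮.Cat} {S : Sieve Y} (hS : S ∈ 𝒮.zariski Y)
    (s : ∀ (V : 𝒮.Cat) (j : V ⟶ Y), S j → 𝒮.O.obj (op V))
    (h : ∀ (V : 𝒮.Cat) (j : V ⟶ Y) (hj : S j) (W : 𝒮.Cat) (g : W ⟶ V),
      𝒮.O.map g.op (s V j hj) = s W (g ≫ j) (S.downward_closed hj g)) :
    ∃ a : 𝒮.O.obj (op Y), ∀ (V : 𝒮.Cat) (j : V ⟶ Y) (hj : S j), 𝒮.O.map j.op a = s V j hj := by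
  have hS' := hS
  choose V j hj hj' hx using hS'
  have key : ∀ (x : 𝒮.scheme Y) (W : 𝒮.Cat) (w : W ⟶ Y) (hSw : S w)
      (e : ⊤ ≤ w.hom ⁻¹ᵁ ((j x).hom ''ᵁ ⊤)),
      w.hom.appLE ((j x).hom ''ᵁ ⊤) ⊤ e (((j x).hom.appIso ⊤).inv (s _ (j x) (hj x))) =
        s W w hSw := by
    intro x W w hSw e
    obtain ⟨g, rfl⟩ : ∃ g : W ⟶ V x, g ≫ j x = w :=
      ⟨𝒮.lift (j x) w (fun v => by
        obtain ⟨a, -, ha⟩ := e (show v ∈ (⊤ : (𝒮.scheme W).Opens) from trivial)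
        exact ⟨a, ha⟩), 𝒮.lift_fac _ _ _⟩
    rw [← h _ _ (hj x), O_map_eq]
    have h1 := Scheme.Hom.appLE_comp_appLE g.hom (j x).hom ((j x).hom ''ᵁ ⊤) ⊤ ⊤
      ((Scheme.Hom.preimage_image_eq _ _).ge) le_top
    have h2 := Scheme.Hom.appIso_hom' (j x).hom (U := ⊤)
    rw [← h2] at h1
    have h3 := congr($h1 (((j x).hom.appIso ⊤).inv (s _ (j x) (hj x))))
    refine h3.symm.trans ?_
    simp only [CommRingCat.comp_apply]
    congr 1
    exact congr($(((j x).hom.appIso ⊤).inv_hom_id) (s _ (j x) (hj x)))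
  obtain ⟨a, ha, -⟩ := TopCat.Sheaf.existsUnique_gluing' (𝒮.scheme Y).sheaf
    (fun x => (j x).hom ''ᵁ ⊤) ⊤
    (fun x => homOfLE le_top) (by
      intro x _
      simp only [TopologicalSpace.Opens.mem_iSup]
      obtain ⟨a, ha⟩ := hx x
      exact ⟨x, a, trivial, ha⟩) (fun x => ((j x).hom.appIso ⊤).inv (s _ (j x) (hj x))) (by
      intro x y
      have hm : 𝒮.openHom Y ((j x).hom ''ᵁ ⊤ ⊓ (j y).hom ''ᵁ ⊤) =
          𝒮.lift (j x) (𝒮.openHom Y ((j x).hom ''ᵁ ⊤ ⊓ (j y).hom ''ᵁ ⊤)) (fun v => by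
          obtain ⟨⟨a, -, ha⟩, -⟩ := 𝒮.openHom_mem Y ((j x).hom ''ᵁ ⊤ ⊓ (j y).hom ''ᵁ ⊤) v
          exact ⟨a, ha⟩) ≫ j x := (𝒮.lift_fac _ _ _).symm
      have hSw : S (𝒮.openHom Y ((j x).hom ''ᵁ ⊤ ⊓ (j y).hom ''ᵁ ⊤)) := by
        rw [hm]; exact S.downward_closed (hj x) _
      have hle : ⊤ ≤ (𝒮.openHom Y ((j x).hom ''ᵁ ⊤ ⊓ (j y).hom ''ᵁ ⊤)).hom ⁻¹ᵁ
        ((j x).hom ''ᵁ ⊤ ⊓ (j y).hom ''ᵁ ⊤) := fun v _ => 𝒮.openHom_mem Y _ v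
      apply appLE_injective (𝒮.openHom Y ((j x).hom ''ᵁ ⊤ ⊓ (j y).hom ''ᵁ ⊤)).hom
        ((j x).hom ''ᵁ ⊤ ⊓ (j y).hom ''ᵁ ⊤)
        (by rw [Scheme.Hom.image_top_eq_opensRange, openHom_range]) hle
      have hX := key x _ _ hSw (hle.trans (fun v hv => hv.1))
      have hY := key y _ _ hSw (hle.trans (fun v hv => hv.2))
      rw [← Scheme.Hom.map_appLE (e := hle) (i := (TopologicalSpace.Opens.infLELeft _ _).op)] at hX
      rw [← Scheme.Hom.map_appLE (e := hle) (i := (TopologicalSpace.Opens.infLERight _ _).op)] at hY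
      exact hX.trans hY.symm)
  refine ⟨a, fun W k hk => ?_⟩
  let T : Sieve W :=
    { arrows := fun Z t => ∃ x, ⊤ ≤ (t ≫ k).hom ⁻¹ᵁ ((j x).hom ''ᵁ ⊤)
      downward_closed := by
        rintro Z Z' t ⟨x, hx⟩ g
        refine ⟨x, fun v _ => ?_⟩
        have := hx (show g.hom v ∈ _ from trivial)
        simpa using this }
  have hT : T ∈ 𝒮.zariski W := by
    intro w
    refine ⟨_, 𝒮.openHom W (k.hom ⁻¹ᵁ ((j (k.hom w)).hom ''ᵁ ⊤)), ⟨k.hom w, fun v _ => ?_⟩,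
      inferInstance, ?_⟩
    · simpa using 𝒮.openHom_mem W (k.hom ⁻¹ᵁ ((j (k.hom w)).hom ''ᵁ ⊤)) v
    · change w ∈ (𝒮.openHom W (k.hom ⁻¹ᵁ ((j (k.hom w)).hom ''ᵁ ⊤))).hom.opensRange
      rw [openHom_range]
      obtain ⟨a, ha⟩ := hx (k.hom w)
      exact ⟨a, trivial, ha⟩
  refine 𝒮.O_sep hT _ _ ?_
  rintro Z t ⟨x, e⟩
  rw [h _ _ hk _ t, ← key x Z (t ≫ k) (S.downward_closed hk t) e, ← ha x]
  refine (𝒮.O_map_comp t k a).symm.trans ((𝒮.O_map_eq (t ≫ k) a).trans ?_)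
  exact congr($((Scheme.Hom.map_appLE (t ≫ k).hom e (homOfLE le_top).op).symm) a)

lemma isSheaf_O : Presheaf.IsSheaf 𝒮.zariski 𝒮.O := by
  rw [Presheaf.isSheaf_iff_isSheaf_forget _ _ (forget CommRingCat),
    isSheaf_iff_isSheaf_of_type]
  intro Y S hS s hs
  obtain ⟨a, ha⟩ := 𝒮.O_glue hS s (fun V j hj W g => by
    have := hs (𝟙 W) g (S.downward_closed hj g) hj (by simp)
    simp at this
    exact this.symm)
  exact ⟨a, ha, fun b hb => 𝒮.O_sep hS _ _ (fun V j hj => (hb j hj).trans (ha V j hj).symm)⟩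

end SmallSchemes
end StandardVB

namespace StandardVB

variable {𝒮 : SmallSchemes.{u}}

/-- The big structure presheaf on schemes over `X`: its value at `Y → X` is `𝒪_Y(Y)`. -/
abbrev bigO (X : 𝒮.Cat) : (Over X)ᵒᵖ ⥤ CommRingCat.{u} := (Over.forget X).op ⋙ 𝒮.O

lemma bigO_map_comp {X : 𝒮.Cat} {Y Z W : Over X} (h : W ⟶ Z) (g : Z ⟶ Y)
    (a : (bigO X).obj (op Y)) :
    (bigO X).map (h ≫ g).op a = (bigO X).map h.op ((bigO X).map g.op a) := by
  rw [op_comp, Functor.map_comp]; rfl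

/-- The big Zariski site of `X`: schemes over `X`, with Zariski coverings. -/
abbrev bigTopology (X : 𝒮.Cat) : GrothendieckTopology (Over X) := 𝒮.zariski.over X

/-- The big structure sheaf, as a sheaf of rings. -/
noncomputable def bigRing (X : 𝒮.Cat) : Sheaf (bigTopology X) RingCat.{u} where
  obj := bigO X ⋙ forget₂ CommRingCat.{u} RingCat.{u}
  property :=
    ((sheafCompose (bigTopology X) (forget₂ CommRingCat.{u} RingCat.{u})).obj
      ((Sheaf.over ⟨𝒮.O, 𝒮.isSheaf_O⟩ X))).property

lemma bigO_sep {X : 𝒮.Cat} {Y : Over X} {S : Sieve Y} (hS : S ∈ bigTopology X Y)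
    (a b : (bigO X).obj (op Y))
    (h : ∀ (V : Over X) (j : V ⟶ Y), S j → (bigO X).map j.op a = (bigO X).map j.op b) :
    a = b := by
  refine 𝒮.O_sep ((GrothendieckTopology.mem_over_iff _ _).1 hS) a b fun V j hj => ?_
  exact h (Over.mk (j ≫ Y.hom)) (Over.homMk j) ((Sieve.overEquiv_iff _ _).1 hj)

lemma bigO_glue {X : 𝒮.Cat} {Y : Over X} {S : Sieve Y} (hS : S ∈ bigTopology X Y)
    (s : ∀ (V : Over X) (j : V ⟶ Y), S j → (bigO X).obj (op V))
    (h : ∀ (V : Over X) (j : V ⟶ Y) (hj : S j) (W : Over X) (g : W ⟶ V),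
      (bigO X).map g.op (s V j hj) = s W (g ≫ j) (S.downward_closed hj g)) :
    ∃ a : (bigO X).obj (op Y), ∀ (V : Over X) (j : V ⟶ Y) (hj : S j),
      (bigO X).map j.op a = s V j hj := by
  obtain ⟨a, ha⟩ := 𝒮.O_glue ((GrothendieckTopology.mem_over_iff _ _).1 hS)
    (fun V j hj => s (Over.mk (j ≫ Y.hom)) (Over.homMk j) ((Sieve.overEquiv_iff _ _).1 hj))
    (fun V j hj W g => by
      have h1 := h _ _ ((Sieve.overEquiv_iff _ _).1 hj) (Over.mk ((g ≫ j) ≫ Y.hom))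
        (Over.homMk g (by simp))
      refine h1.trans ?_
      congr 1)
  refine ⟨a, fun V j hj => ?_⟩
  let e : Over.mk (j.left ≫ Y.hom) ⟶ V := Over.homMk (𝟙 V.left) (by simp)
  have he : (Over.homMk j.left : Over.mk (j.left ≫ Y.hom) ⟶ Y) = e ≫ j := by
    ext1; simp [e]
  have hm : S (Over.homMk j.left : Over.mk (j.left ≫ Y.hom) ⟶ Y) := by
    rw [he]; exact S.downward_closed hj e
  have h1 := ha V.left j.left ((Sieve.overEquiv_iff _ _).2 hm)
  have h2 : (bigO X).map e.op (s V j hj) = s (Over.mk (j.left ≫ Y.hom)) (Over.homMk j.left) hm := by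
    rw [h V j hj _ e]; congr 1
  refine (h1.trans h2.symm).trans ?_
  change 𝒮.O.map (𝟙 V.left).op _ = _
  rw [op_id, CategoryTheory.Functor.map_id]
  rfl

/-- Sheaves of modules over the structure sheaf on the big Zariski site of `X`. -/
abbrev BigModules (X : 𝒮.Cat) := SheafOfModules.{u} (bigRing X)

/-- The objects of the category `𝒞_H`: schemes over `X` whose structure map belongs to the sieve. -/
abbrev SieveObj {X : 𝒮.Cat} (H : Sieve X) : Type u := {Y : Over X // H Y.hom}

/-- A standard vector bundle on `X`: a pair `(H, E)` where `H` is a sieve on `X` that contains a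
Zariski covering of `X`, and `E` is a presheaf of `𝒪`-modules on `𝒞_H` with
`E(Y) = 𝒪_Y(Y) ^ n` for every `Y` in `𝒞_H` (with `n` depending on `Y`), such that for every `Y` the map
`𝒪_Y ^ n → E|_Y` of presheaves on the big Zariski site of `Y` that is given by the standard basis of
`E(Y)` is an isomorphism. -/
structure StdVB (X : 𝒮.Cat) : Type u where
  /-- The sieve `H`. -/
  sieve : Sieve X
  covers : sieve ∈ 𝒮.zariski X
  /-- The number `n` with `E(Y) = 𝒪_Y(Y) ^ n`. -/
  rank : SieveObj sieve → ℕ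
  /-- The restriction maps `E(Y) → E(Z)`, linear over `𝒪_Y(Y) → 𝒪_Z(Z)`. -/
  map : ∀ {Y Z : SieveObj sieve} (g : Z.1 ⟶ Y.1),
    (Fin (rank Y) → (bigO X).obj (op Y.1)) →ₛₗ[((bigO X).map g.op).hom]
      (Fin (rank Z) → (bigO X).obj (op Z.1))
  map_id : ∀ (Y : SieveObj sieve) (s : Fin (rank Y) → (bigO X).obj (op Y.1)),
    map (𝟙 Y.1) s = s
  map_comp : ∀ {Y Z W : SieveObj sieve} (g : Z.1 ⟶ Y.1) (h : W.1 ⟶ Z.1)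
    (s : Fin (rank Y) → (bigO X).obj (op Y.1)),
    map (h ≫ g) s = map h (map g s)
  /-- The map `𝒪_Y ^ n → E|_Y` induced by the standard basis of `E(Y)` is bijective on every
  `g : Z → Y`. -/
  bijective : ∀ {Y Z : SieveObj sieve} (g : Z.1 ⟶ Y.1),
    Function.Bijective fun c : Fin (rank Y) → (bigO X).obj (op Z.1) =>
      ∑ i, c i • map g (Pi.single i 1)

namespace StdVB

variable {X : 𝒮.Cat} (E F : StdVB X)

lemma sieve_comp (H : Sieve X) {Y Z : Over X} (hY : H Y.hom) (g : Z ⟶ Y) : H Z.hom := by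
  rw [← Over.w g]; exact H.downward_closed hY _

/-- The sections over `U` of the sheaf `ξ_H E` associated to `E`. Since `E` is a sheaf on `𝒞_H`
(`map_sep` and `map_glue` below), such a section is a compatible family of elements of `E(V)`, where
`V → U` ranges over all morphisms from objects of `𝒞_H`. On `𝒞_H` this gives back `E`, see
`evalEquiv`. -/
def families (U : Over X) : AddSubgroup
    (∀ (V : SieveObj E.sieve) (_ : V.1 ⟶ U), Fin (E.rank V) → (bigO X).obj (op V.1)) where
  carrier := {s | ∀ (V W : SieveObj E.sieve) (v : V.1 ⟶ U) (t : W.1 ⟶ V.1),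
    E.map t (s V v) = s W (t ≫ v)}
  zero_mem' := fun V W v t => map_zero _
  add_mem' := fun {a b} ha hb V W v t => by
    simp only [Pi.add_apply]
    rw [← ha V W v t, ← hb V W v t, ← map_add]
  neg_mem' := fun {a} ha V W v t => by
    simp only [Pi.neg_apply]
    rw [← ha V W v t, ← map_neg]

variable {E} in
@[ext] lemma families_ext {U : Over X} {s t : E.families U}
    (h : ∀ V v, s.1 V v = t.1 V v) : s = t :=
  Subtype.ext (funext fun V => funext fun v => h V v)

instance (U : Over X) : Module ((bigO X).obj (op U)) (E.families U) where
  smul r s := ⟨fun V v => (bigO X).map v.op r • s.1 V v, fun V W v t => by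
    refine (LinearMap.map_smulₛₗ _ _ _).trans ?_
    beta_reduce
    rw [s.2 V W v t, bigO_map_comp]⟩
  one_smul s := families_ext fun V v =>
    show (bigO X).map v.op 1 • s.1 V v = _ by rw [map_one, one_smul]
  mul_smul a b s := families_ext fun V v =>
    show (bigO X).map v.op (a * b) • s.1 V v = _ by rw [map_mul, mul_smul]; rfl
  smul_zero a := families_ext fun V v =>
    show (bigO X).map v.op a • (0 : Fin (E.rank V) → (bigO X).obj (op V.1)) = 0 from smul_zero _
  smul_add a s t := families_ext fun V v =>
    show (bigO X).map v.op a • (s.1 V v + t.1 V v) = _ from smul_add _ _ _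
  add_smul a b s := families_ext fun V v =>
    show (bigO X).map v.op (a + b) • s.1 V v = _ by rw [map_add, add_smul]; rfl
  zero_smul s := families_ext fun V v =>
    show (bigO X).map v.op 0 • s.1 V v = _ by rw [map_zero, zero_smul]; rfl

lemma smul_val {U : Over X} (r : (bigO X).obj (op U)) (s : E.families U) (V v) :
    (r • s).1 V v = (bigO X).map v.op r • s.1 V v := rfl

/-- The restriction maps of `ξ_H E`. -/
def familiesMap {U U' : Over X} (g : U' ⟶ U) : E.families U →+ E.families U' where
  toFun s := ⟨fun V v => s.1 V (v ≫ g), fun V W v t => by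
    beta_reduce
    rw [s.2 V W (v ≫ g) t, Category.assoc]⟩
  map_zero' := rfl
  map_add' _ _ := rfl

lemma familiesMap_smul {U U' : Over X} (g : U' ⟶ U) (r : (bigO X).obj (op U))
    (s : E.families U) :
    E.familiesMap g (r • s) = (bigO X).map g.op r • E.familiesMap g s :=
  families_ext fun V v => by
    rw [smul_val]
    change (bigO X).map (v ≫ g).op r • s.1 V (v ≫ g) = _
    rw [bigO_map_comp]; rfl

/-- The presheaf of abelian groups underlying `ξ_H E`. -/
def familiesAb : (Over X)ᵒᵖ ⥤ Ab.{u} where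
  obj U := AddCommGrpCat.of (E.families U.unop)
  map g := AddCommGrpCat.ofHom (E.familiesMap g.unop)
  map_id U := by
    ext s : 2
    exact families_ext fun V v => congrArg (fun w => s.1 V w) (Category.comp_id v)
  map_comp g h := by
    ext s : 2
    exact families_ext fun V v => congrArg (fun w => s.1 V w) (Category.assoc _ _ _).symm

instance (U : (Over X)ᵒᵖ) : Module ((bigRing X).obj.obj U) (E.familiesAb.obj U) :=
    inferInstanceAs (Module ((bigO X).obj (op U.unop)) (E.families U.unop))

/-- The presheaf of modules underlying `ξ_H E`. -/
noncomputable def xiPre : PresheafOfModules.{u} (bigRing X).obj :=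
  PresheafOfModules.ofPresheaf E.familiesAb (fun _ _ g r s => E.familiesMap_smul g.unop r s)


lemma map_eq_sum {Y Z : SieveObj E.sieve} (g : Z.1 ⟶ Y.1)
    (c : Fin (E.rank Y) → (bigO X).obj (op Y.1)) :
    E.map g c = ∑ i, (bigO X).map g.op (c i) • E.map g (Pi.single i 1) := by
  conv_lhs => rw [pi_eq_sum_univ' c]
  rw [map_sum]
  refine Finset.sum_congr rfl fun i _ => ?_
  rw [LinearMap.map_smulₛₗ]

/-- The object of the sieve given by a morphism into an object of the sieve -/
def objOver (P : SieveObj E.sieve) {W : Over X} (t : W ⟶ P.1) : SieveObj E.sieve :=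
  ⟨W, sieve_comp _ P.2 t⟩

lemma map_sep (P : SieveObj E.sieve) {T : Sieve P.1} (hT : T ∈ bigTopology X P.1)
    (a b : Fin (E.rank P) → (bigO X).obj (op P.1))
    (h : ∀ (W : SieveObj E.sieve) (t : W.1 ⟶ P.1), T t → E.map t a = E.map t b) : a = b := by
  funext i
  refine bigO_sep hT _ _ fun W t ht => ?_
  have h1 := h (E.objOver P t) t ht
  have h2 := (E.map_eq_sum (Z := E.objOver P t) t a).symm.trans (h1.trans (E.map_eq_sum _ b))
  exact congrFun ((E.bijective (Y := P) (Z := E.objOver P t) t).1 h2) i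

lemma map_glue (P : SieveObj E.sieve) {T : Sieve P.1} (hT : T ∈ bigTopology X P.1)
    (c : ∀ (W : SieveObj E.sieve) (t : W.1 ⟶ P.1), T t →
      (Fin (E.rank W) → (bigO X).obj (op W.1)))
    (hc : ∀ (V W : SieveObj E.sieve) (t : V.1 ⟶ P.1) (ht : T t) (g : W.1 ⟶ V.1),
      E.map g (c V t ht) = c W (g ≫ t) (T.downward_closed ht g)) :
    ∃ a : Fin (E.rank P) → (bigO X).obj (op P.1),
      ∀ (W : SieveObj E.sieve) (t : W.1 ⟶ P.1) (ht : T t), E.map t a = c W t ht := by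
  choose d hd using fun (W : SieveObj E.sieve) (t : W.1 ⟶ P.1) (ht : T t) =>
    (E.bijective t).2 (c W t ht)
  have key : ∀ (V W : SieveObj E.sieve) (t : V.1 ⟶ P.1) (ht : T t) (g : W.1 ⟶ V.1) (i),
      (bigO X).map g.op (d V t ht i) = d W (g ≫ t) (T.downward_closed ht g) i := by
    intro V W t ht g i
    refine congrFun ((E.bijective (g ≫ t)).1 (a₁ := fun i => (bigO X).map g.op (d V t ht i)) ?_) i
    refine Eq.trans ?_ (hd W (g ≫ t) (T.downward_closed ht g)).symm
    rw [← hc V W t ht g, ← hd V t ht]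
    simp only [map_sum, LinearMap.map_smulₛₗ, E.map_comp]
  choose a ha using fun i => bigO_glue hT
    (fun V t ht => d (E.objOver P t) t ht i) (fun V t ht W g => key (E.objOver P t) (E.objOver P (g ≫ t)) t ht g i)
  refine ⟨a, fun W t ht => ?_⟩
  rw [E.map_eq_sum, ← hd W t ht]
  simp only [ha _ _ _ ht]
  rfl

lemma isSheaf_familiesAb : Presheaf.IsSheaf (bigTopology X) E.familiesAb := by
  rw [Presheaf.isSheaf_iff_isSheaf_forget _ _ (forget Ab), isSheaf_iff_isSheaf_of_type]
  intro U S hS s hs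
  have hs' : ∀ {Y : Over X} (f : Y ⟶ U) (hf : S f) {Z : Over X} (g : Z ⟶ Y) (V) (v : V.1 ⟶ Z),
      (s f hf).1 V (v ≫ g) = (s (g ≫ f) (S.downward_closed hf g)).1 V v := by
    intro Y f hf Z g V v
    have := hs g (𝟙 Z) hf (S.downward_closed hf g) (by simp)
    have := congr(($this).1 V v)
    refine this.trans ?_
    exact congrArg (fun w => (s _ (S.downward_closed hf g)).1 V w) (Category.comp_id v)
  have hT : ∀ (P : SieveObj E.sieve) (p : P.1 ⟶ U), S.pullback p ∈ bigTopology X P.1 :=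
    fun P p => (bigTopology X).pullback_stable p hS
  choose a ha using fun (P : SieveObj E.sieve) (p : P.1 ⟶ U) => E.map_glue P (hT P p)
    (fun W t ht => (s (t ≫ p) ht).1 W (𝟙 W.1)) (fun V W t ht g => by
      rw [(s (t ≫ p) ht).2 V W (𝟙 _) g]
      have := hs' (t ≫ p) ht g W (𝟙 _)
      simp only [Category.id_comp, Category.comp_id] at this ⊢
      exact this)
  refine ⟨⟨a, fun V W v t => ?_⟩, fun Y f hf => ?_, fun b hb => ?_⟩
  · refine E.map_sep W (hT W (t ≫ v)) _ _ fun R r hr => ?_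
    rw [ha W (t ≫ v) R r hr, ← E.map_comp]
    rw [ha V v R (r ≫ t) (by simpa using hr)]
    have : ∀ (p q : R.1 ⟶ U) (_ : p = q) (hp : S p) (hq : S q),
        (s p hp).1 R (𝟙 R.1) = (s q hq).1 R (𝟙 R.1) := by
      rintro p _ rfl _ _; rfl
    exact this _ _ (Category.assoc r t v) _ _
  · refine families_ext fun V v => ?_
    change a V (v ≫ f) = _
    have h1 := ha V (v ≫ f) V (𝟙 _) (by simpa using S.downward_closed hf v)
    rw [E.map_id] at h1
    rw [h1]
    have := hs' f hf v V (𝟙 _)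
    simp only [Category.id_comp] at this ⊢
    exact this.symm
  · refine families_ext fun V v => ?_
    change b.1 V v = a V v
    refine E.map_sep V (hT V v) _ _ fun R r hr => ?_
    rw [ha V v R r hr, b.2 V R v r]
    have := congr(($(hb (r ≫ v) hr)).1 R (𝟙 _))
    refine Eq.trans ?_ this
    exact congrArg (fun w => b.1 R w) (Category.id_comp _).symm

/-- The sheaf `ξ_H E` of modules on the big Zariski site associated to `E`. -/
noncomputable def xi : BigModules X where
  val := E.xiPre
  isSheaf := E.isSheaf_familiesAb


/-- Morphisms of standard vector bundles `(H, E) → (K, F)` are the morphisms of sheaves of modules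
`ξ_H E → ξ_K F`. -/
noncomputable instance : Category.{u} (StdVB X) :=
  inferInstanceAs (Category.{u} (InducedCategory (BigModules X) xi))

variable (X) in
/-- The functor `(H, E) ↦ ξ_H E`. -/
noncomputable def xiFunctor : StdVB X ⥤ BigModules X := inducedFunctor xi

noncomputable instance : Preadditive (StdVB X) :=
  inferInstanceAs (Preadditive (InducedCategory (BigModules X) xi))

/-- An object of the pulled back sieve `f^* H` seen as an object of `H`. -/
def pushObj {Y : 𝒮.Cat} (f : Y ⟶ X) (H : Sieve X) (V : SieveObj (H.pullback f)) : SieveObj H :=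
  ⟨(Over.map f).obj V.1, V.2⟩

/-- Pullback on objects: `f^* (H, E) = (f^* H, f^* E)` with `(f^* E)(V → Y) = E(V → Y → X)`. -/
def pullObj {Y : 𝒮.Cat} (f : Y ⟶ X) (E : StdVB X) : StdVB Y where
  sieve := E.sieve.pullback f
  covers := 𝒮.zariski.pullback_stable f E.covers
  rank V := E.rank (pushObj f E.sieve V)
  map {V W} g := E.map (Y := pushObj f E.sieve V) (Z := pushObj f E.sieve W) ((Over.map f).map g)
  map_id V s := (congrArg (fun g => E.map (Y := pushObj f E.sieve V) (Z := pushObj f E.sieve V) g s)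
    ((Over.map f).map_id V.1)).trans (E.map_id (pushObj f E.sieve V) s)
  map_comp {V W R} g h s :=
    (congrArg (fun g => E.map (Y := pushObj f E.sieve V) (Z := pushObj f E.sieve R) g s)
    ((Over.map f).map_comp h g)).trans (E.map_comp (Y := pushObj f E.sieve V)
      (Z := pushObj f E.sieve W) (W := pushObj f E.sieve R) _ _ s)
  bijective {V W} g := E.bijective (Y := pushObj f E.sieve V) (Z := pushObj f E.sieve W)
    ((Over.map f).map g)

/-- The big structure sheaf of `Y` is the restriction of that of `X`. -/
noncomputable def resRing {Y : 𝒮.Cat} (f : Y ⟶ X) : bigRing Y ⟶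
    ((Over.map f).sheafPushforwardContinuous RingCat.{u} (bigTopology Y) (bigTopology X)).obj
      (bigRing X) where
  hom := { app := fun _ => 𝟙 _ }

/-- Restriction of sheaves of modules from the big Zariski site of `X` to that of `Y`, along
`(V → Y) ↦ (V → Y → X)`. -/
noncomputable def res {Y : 𝒮.Cat} (f : Y ⟶ X) : BigModules X ⥤ BigModules Y :=
  SheafOfModules.pushforward (resRing f)

/-- An object over `f_! U` comes from an object over `U`. -/
def factor {Y : 𝒮.Cat} (f : Y ⟶ X) {U : Over Y} {V : Over X} (v : V ⟶ (Over.map f).obj U) :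
    Over Y := Over.mk (v.left ≫ U.hom)

/-- The map from `factor f v` to `U`. -/
def factorHom {Y : 𝒮.Cat} (f : Y ⟶ X) {U : Over Y} {V : Over X} (v : V ⟶ (Over.map f).obj U) :
    factor f v ⟶ U := Over.homMk v.left

/-- The isomorphism of `V` with `factor f v`, as a map. -/
def factorIn {Y : 𝒮.Cat} (f : Y ⟶ X) {U : Over Y} {V : Over X} (v : V ⟶ (Over.map f).obj U) :
    V ⟶ (Over.map f).obj (factor f v) :=
  Over.homMk (𝟙 V.left) (by simpa [factor] using Over.w v)

/-- `factor f v` as an object of the pulled back sieve. -/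
def factorObj {Y : 𝒮.Cat} (f : Y ⟶ X) {H : Sieve X} {U : Over Y} (V : SieveObj H)
    (v : V.1 ⟶ (Over.map f).obj U) : SieveObj (H.pullback f) :=
  ⟨factor f v, by
    have h : (factor f v).hom ≫ f = V.1.hom := by simpa [factor] using Over.w v
    rw [Sieve.pullback_apply, h]
    exact V.2⟩

/-- The sections of `ξ E` over `f_! U` are those of `ξ (f^* E)` over `U`. -/
def pullFamilies {Y : 𝒮.Cat} (f : Y ⟶ X) (E : StdVB X) (U : Over Y) :
    E.families ((Over.map f).obj U) ≃+ (pullObj f E).families U where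
  toFun s := ⟨fun V v => s.1 (pushObj f E.sieve V) ((Over.map f).map v), fun V W v t => by
    refine (s.2 (pushObj f E.sieve V) (pushObj f E.sieve W) _ ((Over.map f).map t)).trans ?_
    exact congrArg (fun w => s.1 (pushObj f E.sieve W) w) ((Over.map f).map_comp t v).symm⟩
  invFun s := ⟨fun V v => E.map (Y := pushObj f E.sieve (factorObj f V v)) (factorIn f v)
      (s.1 (factorObj f V v) (factorHom f v)), fun V W v t => by
    let r : factor f (t ≫ v) ⟶ factor f v := Over.homMk t.left (by simp [factor])
    have h1 := s.2 (factorObj f V v) (factorObj f W (t ≫ v)) (factorHom f v) r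
    have h2 : r ≫ factorHom f v = factorHom f (t ≫ v) := by ext1; rfl
    refine Eq.trans ?_ (congrArg _ (h1.trans (congrArg (fun w => s.1 _ w) h2)))
    refine (E.map_comp (Y := pushObj f E.sieve (factorObj f V v)) (Z := V) (W := W)
      (factorIn f v) t _).symm.trans ?_
    refine Eq.trans ?_ (E.map_comp (Y := pushObj f E.sieve (factorObj f V v))
      (Z := pushObj f E.sieve (factorObj f W (t ≫ v))) ((Over.map f).map r) (factorIn f (t ≫ v)) _)
    congr 2⟩
  left_inv s := families_ext fun V v => by
    refine (s.2 (pushObj f E.sieve (factorObj f V v)) V _ (factorIn f v)).trans ?_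
    refine congrArg (fun w => s.1 V w) ?_
    ext1
    exact Category.id_comp v.left
  right_inv s := families_ext fun V v => by
    let V' : SieveObj E.sieve := pushObj f E.sieve V
    let v' : V'.1 ⟶ (Over.map f).obj U := (Over.map f).map v
    let r : V.1 ⟶ factor f v' := Over.homMk (𝟙 _) (Category.id_comp _ |>.trans (Over.w v))
    have h1 := s.2 (factorObj f V' v') V (factorHom f v') r
    have h2 : r ≫ factorHom f v' = v := by ext1; exact Category.id_comp v.left
    have h3 : factorIn f v' = (Over.map f).map r := by ext1; rfl
    refine Eq.trans ?_ (h1.trans (congrArg (fun w => s.1 V w) h2))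
    exact congrArg (fun w => E.map (Y := pushObj f E.sieve (factorObj f V' v')) w
      (s.1 (factorObj f V' v') (factorHom f v'))) h3
  map_add' s t := rfl

lemma pullFamilies_smul {Y : 𝒮.Cat} (f : Y ⟶ X) (E : StdVB X) (U : Over Y)
    (r : (bigO Y).obj (op U)) (s : E.families ((Over.map f).obj U)) :
    pullFamilies f E U ((show (bigO X).obj (op ((Over.map f).obj U)) from r) • s) =
      r • pullFamilies f E U s := rfl

instance {Y : 𝒮.Cat} (f : Y ⟶ X) (E : StdVB X) (U : (Over Y)ᵒᵖ) :
    Module ((bigRing Y).obj.obj U) (E.families ((Over.map f).obj U.unop)) :=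
  inferInstanceAs (Module ((bigO X).obj (op ((Over.map f).obj U.unop))) _)

/-- The identification `(ξ_H E)|_Y = ξ (f^* E)`. -/
noncomputable def pullIso {Y : 𝒮.Cat} (f : Y ⟶ X) (E : StdVB X) :
    (res f).obj E.xi ≅ (pullObj f E).xi :=
  (SheafOfModules.fullyFaithfulForget _).preimageIso <|
    PresheafOfModules.isoMk (fun U => show ModuleCat.of ((bigRing Y).obj.obj U)
        (E.families ((Over.map f).obj U.unop)) ≅
        ModuleCat.of ((bigRing Y).obj.obj U) ((pullObj f E).familiesAb.obj U) from
      LinearEquiv.toModuleIso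
      { toFun := pullFamilies f E U.unop
        invFun := (pullFamilies f E U.unop).symm
        left_inv := (pullFamilies f E U.unop).left_inv
        right_inv := (pullFamilies f E U.unop).right_inv
        map_add' := (pullFamilies f E U.unop).map_add
        map_smul' := fun r s => pullFamilies_smul f E U.unop r s }) (fun U V g => by
        ext s
        refine families_ext fun W w => ?_
        refine congrArg (fun w => s.1 (pushObj f E.sieve W) w) ((Over.map f).map_comp w g.unop).symm)

/-- A functor to sheaves of modules, all of whose values are identified with sheafifications of
standard vector bundles, defines a functor to standard vector bundles. -/
noncomputable def liftFunctor {C : Type*} [Category* C] (F : C ⥤ BigModules X) (G : C → StdVB X)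
    (a : ∀ c, F.obj c ≅ (G c).xi) : C ⥤ StdVB X where
  obj := G
  map {c d} g := InducedCategory.homMk ((a c).inv ≫ F.map g ≫ (a d).hom)
  map_id c := by
    refine InducedCategory.hom_ext ?_
    change (a c).inv ≫ F.map (𝟙 c) ≫ (a c).hom = 𝟙 _
    rw [CategoryTheory.Functor.map_id, Category.id_comp, Iso.inv_hom_id]
  map_comp {c d e} g h := by
    refine InducedCategory.hom_ext ?_
    change (a c).inv ≫ F.map (g ≫ h) ≫ (a e).hom =
      ((a c).inv ≫ F.map g ≫ (a d).hom) ≫ (a d).inv ≫ F.map h ≫ (a e).hom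
    simp only [Functor.map_comp, Category.assoc, Iso.hom_inv_id_assoc]

/-- The pullback functor `f^*` of standard vector bundles: on objects `pullObj`, and on morphisms the
restriction of morphisms of sheaves along `(V → Y) ↦ (V → Y → X)`. -/
noncomputable def inverseImage {Y : 𝒮.Cat} (f : Y ⟶ X) : StdVB X ⥤ StdVB Y :=
  liftFunctor (xiFunctor X ⋙ res f) (pullObj f) (pullIso f)

instance (X : 𝒮.Cat) (U : (𝒮.scheme X).Opens) : Mono (𝒮.openHom X U) :=
  (inducedFunctor 𝒮.scheme).mono_of_mono_map (inferInstanceAs (Mono (𝒮.openHom X U).hom))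

lemma exists_openHom {V : 𝒮.Cat} (f : V ⟶ X) (U : (𝒮.scheme X).Opens)
    (h : ∀ v : 𝒮.scheme V, f.hom v ∈ U) :
    ∀ v : 𝒮.scheme V, f.hom v ∈ Set.range (𝒮.openHom X U).hom := fun v => by
  change f.hom v ∈ (𝒮.openHom X U).hom.opensRange
  rw [𝒮.openHom_range]
  exact h v

lemma exists_mem_openHom (U : (𝒮.scheme X).Opens) (x : 𝒮.scheme X) (h : x ∈ U) :
    ∃ z, (𝒮.openHom X U).hom z = x := by
  rw [← 𝒮.openHom_range X U] at h
  exact h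

lemma over_openHom_ext {U : (𝒮.scheme X).Opens} {V : Over X} (f g : V ⟶ Over.mk (𝒮.openHom X U)) :
    f = g := by
  ext1
  rw [← cancel_mono (𝒮.openHom X U)]
  exact (Over.w f).trans (Over.w g).symm

/-- The inclusion of a smaller open subscheme. -/
noncomputable def openMap {U V : (𝒮.scheme X).Opens} (h : U ≤ V) :
    𝒮.openObj X U ⟶ 𝒮.openObj X V :=
  𝒮.lift (𝒮.openHom X V) (𝒮.openHom X U)
    (exists_openHom _ _ fun v => h (𝒮.openHom_mem X U v))

lemma openMap_fac {U V : (𝒮.scheme X).Opens} (h : U ≤ V) :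
    openMap h ≫ 𝒮.openHom X V = 𝒮.openHom X U := 𝒮.lift_fac _ _ _

instance {U V : (𝒮.scheme X).Opens} (h : U ≤ V) : IsOpenImmersion (openMap h).hom := by
  have h' : (openMap h).hom ≫ (𝒮.openHom X V).hom = (𝒮.openHom X U).hom :=
    congrArg InducedCategory.Hom.hom (openMap_fac h)
  have : IsOpenImmersion ((openMap h).hom ≫ (𝒮.openHom X V).hom) := by
    rw [h']; infer_instance
  exact IsOpenImmersion.of_comp _ (𝒮.openHom X V).hom

/-- The open subsets of `X` as objects over `X`: the inclusion of the small Zariski site into the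
big one. -/
noncomputable def openOver (X : 𝒮.Cat) : (𝒮.scheme X).Opens ⥤ Over X where
  obj U := Over.mk (𝒮.openHom X U)
  map i := Over.homMk (openMap (leOfHom i)) (openMap_fac (leOfHom i))
  map_id _ := over_openHom_ext _ _
  map_comp _ _ := over_openHom_ext _ _

/-- An object over `X` whose image lies in `U` maps to `U`. -/
noncomputable def toOpenOver {V : Over X} (U : (𝒮.scheme X).Opens)
    (h : ∀ v : 𝒮.scheme V.left, V.hom.hom v ∈ U) : V ⟶ (openOver X).obj U :=
  show V ⟶ Over.mk (𝒮.openHom X U) from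
    Over.homMk (𝒮.lift (𝒮.openHom X U) V.hom (exists_openHom _ _ h)) (𝒮.lift_fac _ _ _)

instance (X : 𝒮.Cat) :
    (openOver X).IsContinuous (Opens.grothendieckTopology (𝒮.scheme X)) (bigTopology X) := by
  refine Functor.isContinuous_of_coverPreserving ⟨?_⟩ ⟨?_⟩
  · intro G Z T x hx Y₁ Y₂ V f₁ f₂ g₁ g₂ hg₁ hg₂ e
    have h₁ : ∀ v : 𝒮.scheme V.left, V.hom.hom v ∈ Y₁ := fun v => by
      rw [← Over.w f₁]
      exact 𝒮.openHom_mem X Y₁ _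
    have h₂ : ∀ v : 𝒮.scheme V.left, V.hom.hom v ∈ Y₂ := fun v => by
      rw [← Over.w f₂]
      exact 𝒮.openHom_mem X Y₂ _
    let t : V ⟶ (openOver X).obj (Y₁ ⊓ Y₂) := toOpenOver _ fun v => ⟨h₁ v, h₂ v⟩
    have e₁ : f₁ = t ≫ (openOver X).map (homOfLE inf_le_left) := over_openHom_ext _ _
    have e₂ : f₂ = t ≫ (openOver X).map (homOfLE inf_le_right) := over_openHom_ext _ _
    have := hx (homOfLE inf_le_left) (homOfLE inf_le_right) hg₁ hg₂ rfl
    have h3 := congrArg (G.obj.map t.op) this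
    rw [e₁, e₂, op_comp, op_comp, Functor.map_comp, Functor.map_comp]
    exact h3
  · intro U S hS
    rw [GrothendieckTopology.mem_over_iff]
    intro y
    obtain ⟨V, i, hi, hy⟩ := hS _ (𝒮.openHom_mem X U y)
    refine ⟨𝒮.openObj X V, openMap (leOfHom i), (Sieve.overEquiv_iff _ _).2 ?_,
      inferInstanceAs (IsOpenImmersion (openMap (leOfHom i)).hom), ?_⟩
    · exact ⟨V, i, Over.homMk (𝟙 _) (by simp [openOver, openMap_fac]), hi, by
        ext1; exact (Category.id_comp _).symm⟩
    · obtain ⟨z, hz⟩ := exists_mem_openHom V _ hy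
      refine ⟨z, (𝒮.openHom X U).hom.isOpenEmbedding.injective ?_⟩
      rw [← hz, ← openMap_fac (leOfHom i)]
      rfl

/-- The isomorphism `Γ(X, U) ≅ O(U)`, as a map. -/
noncomputable def openRes (U : (𝒮.scheme X).Opens) :
    (𝒮.scheme X).presheaf.obj (op U) ⟶ 𝒮.O.obj (op (𝒮.openObj X U)) :=
  (𝒮.openHom X U).hom.appLE U ⊤ fun v _ => 𝒮.openHom_mem X U v

lemma appLE_congr_hom {A B : Scheme.{u}} {f g : A ⟶ B} (h : f = g) (U : B.Opens) (V : A.Opens)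
    (e e') : f.appLE U V e = g.appLE U V e' := by subst h; rfl

lemma openRes_naturality {U V : (𝒮.scheme X).Opens} (h : V ≤ U) :
    (𝒮.scheme X).presheaf.map (homOfLE h).op ≫ openRes V =
      openRes U ≫ 𝒮.O.map (openMap h).op := by
  have h1 : (openMap h).hom ≫ (𝒮.openHom X U).hom = (𝒮.openHom X V).hom :=
    congrArg InducedCategory.Hom.hom (openMap_fac _)
  have h2 : 𝒮.O.map (openMap h).op = (openMap h).hom.appLE ⊤ ⊤ le_top :=
    (Scheme.Hom.appLE_eq_app (f := (openMap h).hom) (U := ⊤)).symm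
  rw [h2]
  refine (Scheme.Hom.map_appLE _ _ (homOfLE h).op).trans ?_
  refine Eq.trans ?_ (Scheme.Hom.appLE_comp_appLE _ _ _ _ _ _ _).symm
  exact appLE_congr_hom h1.symm _ _ _ _

/-- `O_X` on the small Zariski site is the restriction of the big structure sheaf. -/
noncomputable def smallRing (X : 𝒮.Cat) : (𝒮.scheme X).ringCatSheaf ⟶
    ((openOver X).sheafPushforwardContinuous RingCat.{u}
      (Opens.grothendieckTopology (𝒮.scheme X)) (bigTopology X)).obj (bigRing X) where
  hom :=
    { app := fun U => (forget₂ CommRingCat RingCat).map (openRes U.unop)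
      naturality := fun _ _ i =>
        congrArg (fun f => (forget₂ CommRingCat RingCat).map f)
          (openRes_naturality (leOfHom i.unop)) }

/-- Restriction of a sheaf of modules to the small Zariski site. -/
noncomputable def toSmall (X : 𝒮.Cat) : BigModules X ⥤ (𝒮.scheme X).Modules :=
  SheafOfModules.pushforward (smallRing X)

/-- The functor `Φ`: the restriction of `ξ_H E` to the small Zariski site of `X`. -/
noncomputable def toModules (X : 𝒮.Cat) : StdVB X ⥤ (𝒮.scheme X).Modules :=
  xiFunctor X ⋙ toSmall X

instance (X : 𝒮.Cat) : (toSmall X).Additive where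
  map_add := by intros; rfl
instance (X : 𝒮.Cat) : (xiFunctor X).Additive := inferInstanceAs (inducedFunctor _).Additive
instance (X : 𝒮.Cat) : (toModules X).Additive := inferInstanceAs (xiFunctor X ⋙ toSmall X).Additive

/-- On an object of the sieve, `ξ E` and `E` agree. -/
def evalEquiv (P : SieveObj E.sieve) :
    E.families P.1 ≃ₗ[(bigO X).obj (op P.1)] (Fin (E.rank P) → (bigO X).obj (op P.1)) where
  toFun s := s.1 P (𝟙 P.1)
  invFun c := ⟨fun V v => E.map v c, fun V W v t => (E.map_comp v t c).symm⟩
  left_inv s := families_ext fun V v => by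
    change E.map v (s.1 P (𝟙 P.1)) = _
    rw [s.2 P V (𝟙 P.1) v, Category.comp_id]
  right_inv c := E.map_id P c
  map_add' s t := rfl
  map_smul' r s := by
    rw [smul_val, op_id, CategoryTheory.Functor.map_id]
    rfl

/-- The Kronecker product of vectors,
`(a₁, …, a_r) ⊗ (b₁, …, b_s) ↦ (a₁ b₁, …, a₁ b_s, …, a_r b₁, …, a_r b_s)`. -/
def kron {R : Type*} [CommRing R] {r s : ℕ} :
    (Fin r → R) →ₗ[R] (Fin s → R) →ₗ[R] (Fin (r * s) → R) :=
  LinearMap.mk₂ R (fun a b k => a (finProdFinEquiv.symm k).1 * b (finProdFinEquiv.symm k).2)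
    (fun _ _ _ => funext fun _ => add_mul _ _ _)
    (fun _ _ _ => funext fun _ => mul_assoc _ _ _)
    (fun _ _ _ => funext fun _ => mul_add _ _ _)
    (fun _ _ _ => funext fun _ => mul_left_comm _ _ _)

lemma kron_apply {R : Type*} [CommRing R] {r s : ℕ} (a : Fin r → R) (b : Fin s → R) (k) :
    kron a b k = a (finProdFinEquiv.symm k).1 * b (finProdFinEquiv.symm k).2 := rfl

lemma kron_single {R : Type*} [CommRing R] {r s : ℕ} (i : Fin r) (j : Fin s) :
    kron (Pi.single i (1 : R)) (Pi.single j (1 : R)) = Pi.single (finProdFinEquiv (i, j)) 1 := by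
  funext k
  obtain ⟨⟨i', j'⟩, rfl⟩ := finProdFinEquiv.surjective k
  rw [kron_apply]
  simp only [Equiv.symm_apply_apply, Pi.single_apply, EmbeddingLike.apply_eq_iff_eq,
    Prod.mk.injEq]
  split_ifs <;> simp_all

/-- An object of `H ∩ K` as an object of `H`. -/
def infLeft {H K : Sieve X} (V : SieveObj (H ⊓ K)) : SieveObj H := ⟨V.1, V.2.1⟩

/-- An object of `H ∩ K` as an object of `K`. -/
def infRight {H K : Sieve X} (V : SieveObj (H ⊓ K)) : SieveObj K := ⟨V.1, V.2.2⟩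

/-- The tensor product of two semilinear maps between standard free modules, under the
identification `kron` of the tensor product with a standard free module; it is given by the Kronecker
product of the matrices. -/
noncomputable def tensorMap {R S : Type*} [CommRing R] [CommRing S] (φ : R →+* S) {m n m' n' : ℕ}
    (f : (Fin m → R) →ₛₗ[φ] (Fin m' → S)) (g : (Fin n → R) →ₛₗ[φ] (Fin n' → S)) :
    (Fin (m * n) → R) →ₛₗ[φ] (Fin (m' * n') → S) where
  toFun c := ∑ i, ∑ j, φ (c (finProdFinEquiv (i, j))) •
    kron (f (Pi.single i 1)) (g (Pi.single j 1))
  map_add' a b := by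
    simp [add_smul, Finset.sum_add_distrib]
  map_smul' r a := by
    simp [mul_smul, Finset.smul_sum]

section
variable {R S : Type*} [CommRing R] [CommRing S] (φ : R →+* S) {m n m' n' : ℕ}
    (f : (Fin m → R) →ₛₗ[φ] (Fin m' → S)) (g : (Fin n → R) →ₛₗ[φ] (Fin n' → S))

lemma semilinear_eq_sum (c : Fin m → R) : f c = ∑ i, φ (c i) • f (Pi.single i 1) := by
  conv_lhs => rw [pi_eq_sum_univ' c]
  rw [map_sum]
  exact Finset.sum_congr rfl fun i _ => LinearMap.map_smulₛₗ _ _ _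

lemma tensorMap_kron (a : Fin m → R) (b : Fin n → R) :
    tensorMap φ f g (kron a b) = kron (f a) (g b) := by
  rw [semilinear_eq_sum φ f a, semilinear_eq_sum φ g b]
  simp only [tensorMap, LinearMap.coe_mk, AddHom.coe_mk, map_sum, LinearMap.sum_apply, map_smul,
    LinearMap.smul_apply, smul_smul, kron_apply, Equiv.symm_apply_apply, map_mul, Finset.smul_sum]
  rw [Finset.sum_comm]
  refine Finset.sum_congr rfl fun j _ => Finset.sum_congr rfl fun i _ => ?_
  rw [mul_comm (φ (a i))]

lemma ext_kron {f g : (Fin (m * n) → R) →ₛₗ[φ] (Fin (m' * n') → S)}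
    (h : ∀ a b, f (kron a b) = g (kron a b)) : f = g := by
  refine LinearMap.ext fun c => ?_
  rw [semilinear_eq_sum φ f, semilinear_eq_sum φ g]
  refine Finset.sum_congr rfl fun k _ => ?_
  obtain ⟨⟨i, j⟩, rfl⟩ := finProdFinEquiv.surjective k
  rw [← kron_single, h]

lemma tensorMap_single (k : Fin (m * n)) :
    tensorMap φ f g (Pi.single k 1) =
      kron (f (Pi.single (finProdFinEquiv.symm k).1 1)) (g (Pi.single (finProdFinEquiv.symm k).2 1)) := by
  obtain ⟨⟨i, j⟩, rfl⟩ := finProdFinEquiv.surjective k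
  rw [← kron_single, tensorMap_kron, Equiv.symm_apply_apply]

lemma tensorMap_id {φ : R →+* R} {f : (Fin m → R) →ₛₗ[φ] (Fin m → R)}
    {g : (Fin n → R) →ₛₗ[φ] (Fin n → R)} (hφ : φ = RingHom.id R) (hf : ∀ s, f s = s)
    (hg : ∀ s, g s = s) (s : Fin (m * n) → R) : tensorMap φ f g s = s := by
  subst hφ
  refine LinearMap.congr_fun (g := LinearMap.id) (ext_kron (RingHom.id R) fun a b => ?_) s
  rw [tensorMap_kron, hf, hg]
  rfl

lemma tensorMap_comp {T : Type*} [CommRing T] {m'' n'' : ℕ} {ψ : S →+* T} {χ : R →+* T}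
    {f' : (Fin m' → S) →ₛₗ[ψ] (Fin m'' → T)} {g' : (Fin n' → S) →ₛₗ[ψ] (Fin n'' → T)}
    {f'' : (Fin m → R) →ₛₗ[χ] (Fin m'' → T)} {g'' : (Fin n → R) →ₛₗ[χ] (Fin n'' → T)}
    (hχ : χ = ψ.comp φ) (hf : ∀ s, f'' s = f' (f s)) (hg : ∀ s, g'' s = g' (g s))
    (s : Fin (m * n) → R) :
    tensorMap χ f'' g'' s = tensorMap ψ f' g' (tensorMap φ f g s) := by
  subst hχ
  have : RingHomCompTriple φ ψ (ψ.comp φ) := ⟨rfl⟩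
  refine LinearMap.congr_fun (g := (tensorMap ψ f' g').comp (tensorMap φ f g))
    (ext_kron (ψ.comp φ) fun a b => ?_) s
  rw [tensorMap_kron, hf, hg, LinearMap.comp_apply, tensorMap_kron, tensorMap_kron]

/-- The linear map defined by a tuple of vectors. -/
def combine (b : Fin m → Fin m' → S) : (Fin m → S) →ₗ[S] (Fin m' → S) where
  toFun c := ∑ i, c i • b i
  map_add' c d := by simp [add_smul, Finset.sum_add_distrib]
  map_smul' r c := by simp [mul_smul, Finset.smul_sum]

lemma combine_single (b : Fin m → Fin m' → S) (i : Fin m) : combine b (Pi.single i 1) = b i := by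
  simp [combine, Pi.single_apply]

lemma bijective_kron (b : Fin m → Fin m' → S) (b' : Fin n → Fin n' → S)
    (hb : Function.Bijective fun c : Fin m → S => ∑ i, c i • b i)
    (hb' : Function.Bijective fun c : Fin n → S => ∑ i, c i • b' i) :
    Function.Bijective fun c : Fin (m * n) → S =>
      ∑ k, c k • kron (b (finProdFinEquiv.symm k).1) (b' (finProdFinEquiv.symm k).2) := by
  let e := LinearEquiv.ofBijective (combine b) hb
  let e' := LinearEquiv.ofBijective (combine b') hb'
  have h1 : (tensorMap (RingHom.id S) (e.symm : (Fin m' → S) →ₗ[S] (Fin m → S))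
      (e'.symm : (Fin n' → S) →ₗ[S] (Fin n → S))).comp
      (tensorMap (RingHom.id S) (e : (Fin m → S) →ₗ[S] (Fin m' → S)) (e' : (Fin n → S) →ₗ[S] (Fin n' → S))) = LinearMap.id := by
    refine ext_kron (RingHom.id S) fun u v => ?_
    simp [tensorMap_kron]
  have h2 : (tensorMap (RingHom.id S) (e : (Fin m → S) →ₗ[S] (Fin m' → S)) (e' : (Fin n → S) →ₗ[S] (Fin n' → S))).comp
      (tensorMap (RingHom.id S) (e.symm : (Fin m' → S) →ₗ[S] (Fin m → S))
      (e'.symm : (Fin n' → S) →ₗ[S] (Fin n → S))) = LinearMap.id := by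
    refine ext_kron (RingHom.id S) fun u v => ?_
    simp [tensorMap_kron]
  have h3 : (fun c : Fin (m * n) → S =>
      ∑ k, c k • kron (b (finProdFinEquiv.symm k).1) (b' (finProdFinEquiv.symm k).2)) =
      tensorMap (RingHom.id S) (e : (Fin m → S) →ₗ[S] (Fin m' → S)) (e' : (Fin n → S) →ₗ[S] (Fin n' → S)) := by
    funext c
    rw [semilinear_eq_sum (RingHom.id S)]
    refine Finset.sum_congr rfl fun k _ => ?_
    rw [tensorMap_single]
    change _ = c k • kron (combine b (Pi.single (finProdFinEquiv.symm k).1 1))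
      (combine b' (Pi.single (finProdFinEquiv.symm k).2 1))
    rw [combine_single, combine_single]
  rw [h3]
  exact ⟨Function.LeftInverse.injective (g := tensorMap (RingHom.id S) (e.symm : (Fin m' → S) →ₗ[S] (Fin m → S))
    (e'.symm : (Fin n' → S) →ₗ[S] (Fin n → S))) fun x => LinearMap.congr_fun h1 x,
    Function.RightInverse.surjective (g := tensorMap (RingHom.id S) (e.symm : (Fin m' → S) →ₗ[S] (Fin m → S))
    (e'.symm : (Fin n' → S) →ₗ[S] (Fin n → S))) fun x => LinearMap.congr_fun h2 x⟩

lemma bijective_tensorMap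
    (hf : Function.Bijective fun c : Fin m → S => ∑ i, c i • f (Pi.single i 1))
    (hg : Function.Bijective fun c : Fin n → S => ∑ i, c i • g (Pi.single i 1)) :
    Function.Bijective fun c : Fin (m * n) → S => ∑ k, c k • tensorMap φ f g (Pi.single k 1) := by
  simp only [tensorMap_single]
  exact bijective_kron _ _ hf hg

end

/-- The tensor product `E ⊗ F` on the intersection of the two sieves. -/
noncomputable def tensorObj : StdVB X where
  sieve := E.sieve ⊓ F.sieve
  covers := 𝒮.zariski.intersection_covering E.covers F.covers
  rank V := E.rank (infLeft V) * F.rank (infRight V)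
  map {Y Z} g := tensorMap ((bigO X).map g.op).hom (E.map (Y := infLeft Y) (Z := infLeft Z) g)
    (F.map (Y := infRight Y) (Z := infRight Z) g)
  map_id Y s := tensorMap_id
    (by rw [op_id, CategoryTheory.Functor.map_id]; rfl)
    (E.map_id (infLeft Y)) (F.map_id (infRight Y)) s
  map_comp {Y Z W} g h s := tensorMap_comp _ _ _
    (RingHom.ext fun a => bigO_map_comp h g a)
    (E.map_comp (Y := infLeft Y) (Z := infLeft Z) (W := infLeft W) g h)
    (F.map_comp (Y := infRight Y) (Z := infRight Z) (W := infRight W) g h) s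
  bijective {Y Z} g := bijective_tensorMap _ _ _ (E.bijective (Y := infLeft Y) (Z := infLeft Z) g)
    (F.bijective (Y := infRight Y) (Z := infRight Z) g)

/-- The product of a section of `ξ E` and a section of `ξ F`. -/
noncomputable def mulFamilies (U : Over X) : E.families U →ₗ[(bigO X).obj (op U)]
    F.families U →ₗ[(bigO X).obj (op U)] (tensorObj E F).families U :=
  LinearMap.mk₂ _ (fun s t => ⟨fun V v => kron (s.1 (infLeft V) v) (t.1 (infRight V) v),
      fun V W v r => by
        refine (tensorMap_kron _ _ _ _ _).trans ?_
        exact congrArg₂ (fun a b => kron a b) (s.2 (infLeft V) (infLeft W) v r)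
          (t.2 (infRight V) (infRight W) v r)⟩)
    (fun _ _ _ => families_ext fun _ _ => LinearMap.map_add₂ kron _ _ _)
    (fun _ _ _ => families_ext fun _ _ => LinearMap.map_smul₂ kron _ _ _)
    (fun _ _ _ => families_ext fun _ _ => map_add (kron _) _ _)
    (fun _ _ _ => families_ext fun _ _ => map_smul (kron _) _ _)

/-- Presheaves of modules on the big Zariski site. -/
abbrev PreMod (X : 𝒮.Cat) := PresheafOfModules.{u} (bigO X ⋙ forget₂ CommRingCat.{u} RingCat.{u})

/-- The underlying presheaf of modules of `ξ E`. -/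
noncomputable abbrev xiVal : PreMod X := E.xiPre

open MonoidalCategory

/-- The pairing from the presheaf tensor product of `ξ E` and `ξ F` to `ξ (E ⊗ F)`. -/
noncomputable def tensorPairing : E.xiVal ⊗ F.xiVal ⟶ (tensorObj E F).xiVal where
  app U := ModuleCat.MonoidalCategory.tensorLift (R := (bigO X).obj (op U.unop))
    (M₁ := ModuleCat.of ((bigO X).obj (op U.unop)) (E.families U.unop))
    (M₂ := ModuleCat.of ((bigO X).obj (op U.unop)) (F.families U.unop))
    (M₃ := ModuleCat.of ((bigO X).obj (op U.unop)) ((tensorObj E F).families U.unop))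
    (fun s t => mulFamilies E F U.unop s t)
    (fun _ _ _ => LinearMap.map_add₂ _ _ _ _) (fun _ _ _ => LinearMap.map_smul₂ _ _ _ _)
    (fun _ _ _ => map_add _ _ _) (fun _ _ _ => map_smul _ _ _)
  naturality _ := ModuleCat.MonoidalCategory.tensor_ext (fun _ _ => rfl)

section
variable {C : Type u} [SmallCategory C] {J : GrothendieckTopology C} (R : Sheaf J RingCat.{u})

/-- The sheaf of modules associated to a presheaf of modules. -/
noncomputable def assocSheaf : PresheafOfModules.{u} R.obj ⥤ SheafOfModules.{u} R :=
  PresheafOfModules.sheafification.{u} (𝟙 R.obj)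

/-- The morphism from the associated sheaf induced by a morphism of presheaves to a sheaf. -/
noncomputable def assocDesc {P : PresheafOfModules.{u} R.obj} {M : SheafOfModules.{u} R}
    (f : P ⟶ M.val) : (assocSheaf R).obj P ⟶ M :=
  (PresheafOfModules.sheafificationHomEquiv (𝟙 R.obj)).symm f

lemma isIso_assocDesc {P : PresheafOfModules.{u} R.obj} {M : SheafOfModules.{u} R}
    (f : P ⟶ M.val) (h : ∀ U : C, ∃ S ∈ J U, ∀ (V : C) (j : V ⟶ U), S j →
      Function.Bijective (f.app (op V))) : IsIso (assocDesc R f) := by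
  rw [← isIso_iff_of_reflects_iso _ (SheafOfModules.toSheaf.{u} R)]
  refine (congrArg IsIso
    (PresheafOfModules.toSheaf_map_sheafificationHomEquiv_symm (𝟙 R.obj) (F := M) f)).mpr ?_
  let g : P.presheaf ⟶ M.val.presheaf := (PresheafOfModules.toPresheaf R.obj).map f
  have hb : ∀ U : C, ∃ S ∈ J U, ∀ (V : C) (j : V ⟶ U), S j →
      Function.Bijective (g.app (op V)) := h
  have hg : J.W g := by
    rw [J.W_iff_isLocallyBijective]
    constructor
    · refine ⟨fun {U} x y e => ?_⟩
      obtain ⟨S, hS, hS'⟩ := hb U.unop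
      refine J.superset_covering (fun V j hj => ?_) hS
      refine (hS' V j hj).1 ?_
      have := congrArg (M.val.presheaf.map j.op) e
      exact (NatTrans.naturality_apply g j.op x).trans
        (this.trans (NatTrans.naturality_apply g j.op y).symm)
    · refine ⟨fun {U} x => ?_⟩
      obtain ⟨S, hS, hS'⟩ := hb U
      refine J.superset_covering (fun V j hj => ?_) hS
      exact (hS' V j hj).2 _
  rw [J.W_iff] at hg
  have key : ∀ {P' : Cᵒᵖ ⥤ Ab.{u}} {M' : Sheaf J Ab.{u}} (g' : P' ⟶ (sheafToPresheaf J Ab.{u}).obj M')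
      (_ : IsIso ((presheafToSheaf J Ab.{u}).map g')),
      IsIso (((sheafificationAdjunction J Ab.{u}).homEquiv P' M').symm g') := by
    intro P' M' g' _
    rw [Adjunction.homEquiv_counit]
    infer_instance
  exact key (P' := P.presheaf) (M' := (SheafOfModules.toSheaf R).obj M) g hg

end

/-- Sheafification of presheaves of modules on the big Zariski site. -/
noncomputable def sheafify (X : 𝒮.Cat) : PreMod X ⥤ BigModules X :=
  assocSheaf (bigRing X)

/-- The map from the sheaf tensor product of `ξ E` and `ξ F` to `ξ (E ⊗ F)`; it is an isomorphism. -/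
noncomputable def tensorComparison : (sheafify X).obj (E.xiVal ⊗ F.xiVal) ⟶ (tensorObj E F).xi :=
  assocDesc (bigRing X) (tensorPairing E F)

lemma bijective_lift_kron {R : Type*} [CommRing R] (r s : ℕ) :
    Function.Bijective (TensorProduct.lift (kron (R := R) (r := r) (s := s))) := by
  let e := ((Pi.basisFun R (Fin r)).tensorProduct (Pi.basisFun R (Fin s))).equiv
    (Pi.basisFun R (Fin (r * s))) finProdFinEquiv
  have h : (e : _ →ₗ[R] _) = TensorProduct.lift (kron (R := R) (r := r) (s := s)) := by
    refine ((Pi.basisFun R (Fin r)).tensorProduct (Pi.basisFun R (Fin s))).ext fun ij => ?_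
    rw [LinearEquiv.coe_coe, Module.Basis.equiv_apply, Module.Basis.tensorProduct_apply']
    simp only [Pi.basisFun_apply, TensorProduct.lift.tmul]
    exact (kron_single _ _).symm
  rw [← h]
  exact e.bijective

lemma bijective_lift_mulFamilies (P : SieveObj (E.sieve ⊓ F.sieve)) :
    Function.Bijective (TensorProduct.lift (mulFamilies E F P.1)) := by
  let a : E.families P.1 ≃ₗ[(bigO X).obj (op P.1)]
      (Fin (E.rank (infLeft P)) → (bigO X).obj (op P.1)) := E.evalEquiv (infLeft P)
  let b : F.families P.1 ≃ₗ[(bigO X).obj (op P.1)]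
      (Fin (F.rank (infRight P)) → (bigO X).obj (op P.1)) := F.evalEquiv (infRight P)
  let c : (tensorObj E F).families P.1 ≃ₗ[(bigO X).obj (op P.1)]
      (Fin (E.rank (infLeft P) * F.rank (infRight P)) → (bigO X).obj (op P.1)) :=
    (tensorObj E F).evalEquiv P
  have h : ∀ x, c (TensorProduct.lift (mulFamilies E F P.1) x) =
      TensorProduct.lift kron (TensorProduct.congr a b x) := by
    intro x
    induction x using TensorProduct.induction_on with
    | zero =>
      exact ((congrArg c (LinearMap.map_zero _)).trans (map_zero c)).trans
        ((congrArg _ (map_zero (TensorProduct.congr a b))).trans (map_zero _)).symm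
    | tmul s t => rfl
    | add x y hx hy => simp only [map_add, hx, hy]
  have h2 : Function.Bijective (c ∘ (TensorProduct.lift (mulFamilies E F P.1))) := by
    rw [show (c ∘ (TensorProduct.lift (mulFamilies E F P.1))) =
      TensorProduct.lift kron ∘ TensorProduct.congr a b from funext h]
    exact (bijective_lift_kron _ _).comp (TensorProduct.congr a b).bijective
  exact (Function.Bijective.of_comp_iff' c.bijective _).1 h2

instance isIso_tensorComparison : IsIso (tensorComparison E F) := by
  refine isIso_assocDesc _ _ fun U => ?_
  refine ⟨Sieve.overEquiv U |>.symm ((tensorObj E F).sieve.pullback U.hom), ?_, ?_⟩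
  · rw [GrothendieckTopology.mem_over_iff, OrderIso.apply_symm_apply]
    exact 𝒮.zariski.pullback_stable _ (tensorObj E F).covers
  · intro V j hj
    have hV : (E.sieve ⊓ F.sieve) V.hom := by
      rw [Sieve.overEquiv_symm_iff] at hj
      rw [← Over.w j]
      exact hj
    exact bijective_lift_mulFamilies E F ⟨V, hV⟩

variable (X) in
/-- The functor that sends `(E, F)` to the sheaf tensor product of `ξ E` and `ξ F`, the
sheafification of `U ↦ ξ E (U) ⊗ ξ F (U)`. -/
noncomputable def sheafTensor : StdVB X × StdVB X ⥤ BigModules X :=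
  Functor.prod (xiFunctor X ⋙ SheafOfModules.forget _) (xiFunctor X ⋙ SheafOfModules.forget _) ⋙
    MonoidalCategory.tensor (PreMod X) ⋙ sheafify X

/-- The isomorphism `ζ⁻¹` from the sheaf tensor product of `ξ E` and `ξ F` to `ξ (E ⊗ F)`. -/
noncomputable def sheafTensorIso (A : StdVB X × StdVB X) :
    (sheafTensor X).obj A ≅ (tensorObj A.1 A.2).xi :=
  @asIso _ _ _ _ (tensorComparison A.1 A.2) (isIso_tensorComparison A.1 A.2)

variable (X) in
/-- The tensor product of standard vector bundles, as a functor in two variables. On morphisms,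
`γ ⊗ δ` is the sheafification of the presheaf tensor product of `γ` and `δ`, conjugated by the
isomorphisms `ξ (E ⊗ F) ≅ ξ E ⊗ ξ F`. -/
noncomputable def tensor : StdVB X × StdVB X ⥤ StdVB X :=
  liftFunctor (sheafTensor X) (fun A => tensorObj A.1 A.2) sheafTensorIso

variable (X) in
/-- The zero bundle: the trivial standard vector bundle of rank `0`, on the maximal sieve. -/
def zeroBundle : StdVB X where
  sieve := ⊤
  covers := 𝒮.zariski.top_mem X
  rank _ := 0
  map _ := 0
  map_id _ _ := Subsingleton.elim _ _
  map_comp _ _ _ := Subsingleton.elim _ _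
  bijective _ := ⟨fun _ _ _ => Subsingleton.elim _ _, fun _ => ⟨0, Subsingleton.elim _ _⟩⟩

/-- An object of a smaller sieve as an object of a bigger one. -/
def subObj {H K : Sieve X} (h : K ≤ H) (V : SieveObj K) : SieveObj H := ⟨V.1, h _ V.2⟩

/-- The restriction of a standard vector bundle to a smaller covering sieve. -/
def restrict (K : Sieve X) (hK : K ∈ 𝒮.zariski X) (h : K ≤ E.sieve) : StdVB X where
  sieve := K
  covers := hK
  rank V := E.rank (subObj h V)
  map {V W} g := E.map (Y := subObj h V) (Z := subObj h W) g
  map_id V := E.map_id (subObj h V)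
  map_comp {V W R} := E.map_comp (Y := subObj h V) (Z := subObj h W) (W := subObj h R)
  bijective {V W} := E.bijective (Y := subObj h V) (Z := subObj h W)

end StdVB

/-! ### Vector bundles -/

/-- An `𝒪_S`-module `M` is locally free of finite rank: every point has an open neighbourhood `U` with
sections `e₁, …, e_n` of `M` over `U` for which the map `𝒪_U ^ n → M|_U` is an isomorphism, that is,
bijective on sections over every open `V ⊆ U`. -/
def IsVectorBundle {S : Scheme.{u}} (M : S.Modules) : Prop :=
  ∀ x : S, ∃ U : S.Opens, x ∈ U ∧ ∃ (n : ℕ) (e : Fin n → Γ(M, U)),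
    ∀ (V : S.Opens) (h : V ≤ U), Function.Bijective fun c : Fin n → Γ(S, V) =>
      ∑ i, c i • M.presheaf.map (homOfLE h).op (e i)

/-- The category of locally free `𝒪_S`-modules of finite rank. -/
abbrev VB (S : Scheme.{u}) := ObjectProperty.FullSubcategory (C := S.Modules) IsVectorBundle

section Exact

variable {C : Type*} [Category* C] [Preadditive C] {D : Type*} [Category* D] [Preadditive D]

/-- An admissible monomorphism: the first map of a short exact sequence. -/
def IsInflation (conf : ShortComplex C → Prop) {A B : C} (i : A ⟶ B) : Prop :=
  ∃ (Z : C) (p : B ⟶ Z) (w : i ≫ p = 0), conf (ShortComplex.mk i p w)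

/-- An admissible epimorphism: the second map of a short exact sequence. -/
def IsDeflation (conf : ShortComplex C → Prop) {B Z : C} (p : B ⟶ Z) : Prop :=
  ∃ (A : C) (i : A ⟶ B) (w : i ≫ p = 0), conf (ShortComplex.mk i p w)

/-- The additive category `C`, with the given class of short exact sequences, is an exact category in
the sense of Quillen. -/
structure IsExactCategory (conf : ShortComplex C → Prop) : Prop where
  biproducts : HasFiniteBiproducts C
  of_iso : ∀ {S T : ShortComplex C}, (S ≅ T) → conf S → conf T
  kernel : ∀ S : ShortComplex C, conf S → Nonempty (IsLimit (KernelFork.ofι S.f S.zero))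
  cokernel : ∀ S : ShortComplex C, conf S → Nonempty (IsColimit (CokernelCofork.ofπ S.g S.zero))
  inflation_id : ∀ A : C, IsInflation conf (𝟙 A)
  deflation_id : ∀ A : C, IsDeflation conf (𝟙 A)
  inflation_comp : ∀ {A B Z : C} (f : A ⟶ B) (g : B ⟶ Z),
    IsInflation conf f → IsInflation conf g → IsInflation conf (f ≫ g)
  deflation_comp : ∀ {A B Z : C} (f : A ⟶ B) (g : B ⟶ Z),
    IsDeflation conf f → IsDeflation conf g → IsDeflation conf (f ≫ g)
  inflation_pushout : ∀ {A B A' : C} (i : A ⟶ B) (f : A ⟶ A'), IsInflation conf i →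
    ∃ (B' : C) (i' : A' ⟶ B') (f' : B ⟶ B'), IsPushout i f f' i' ∧ IsInflation conf i'
  deflation_pullback : ∀ {B Z Z' : C} (p : B ⟶ Z) (f : Z' ⟶ Z), IsDeflation conf p →
    ∃ (B' : C) (p' : B' ⟶ Z') (f' : B' ⟶ B), IsPullback f' p' p f ∧ IsDeflation conf p'

/-- Exact functors: additive functors that send short exact sequences to short exact sequences. -/
structure IsExactFunctor (confC : ShortComplex C → Prop) (confD : ShortComplex D → Prop)
    (F : C ⥤ D) : Prop where
  additive : F.Additive
  map : ∀ S : ShortComplex C, confC S →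
    ∃ w : F.map S.f ≫ F.map S.g = 0, confD (ShortComplex.mk (F.map S.f) (F.map S.g) w)

end Exact

variable (X : 𝒮.Cat)

/-- A sequence of locally free modules of finite rank is short exact if it is so as a sequence of
`𝒪_S`-modules. -/
def vbExact (S : Scheme.{u}) (T : ShortComplex (VB S)) : Prop :=
  (T.map (ObjectProperty.ι (C := S.Modules) IsVectorBundle)).ShortExact

/-- A sequence of standard vector bundles is short exact if its image under `Φ` is a short exact
sequence of `𝒪_X`-modules. -/
def stdExact (T : ShortComplex (StdVB X)) : Prop :=
  (T.map (StdVB.toModules X)).ShortExact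

end StandardVB


open StandardVB StandardVB.StdVB

/-!
A standard vector bundle is a vector bundle together with a choice of trivializations that makes
pullback strictly functorial. Everything about the categories `StdVB X` is reduced to two facts.

* `Φ = toModules X` is fully faithful, and its essential image consists of the locally free modules
  of finite rank. Full faithfulness: over a scheme `R` that maps to an open subset `W` of `X` in the
  sieve of `E`, the sections of `ξ E` over `R` are the base change of the sections over `W`
  (`IsFreeBaseChange`), so that a morphism `Φ E ⟶ Φ F` has a unique linear extension to the sections
  over `R` (`exists_extension`); these extensions glue because `ξ F` is a sheaf
  (`exists_hom_of_cover`). Essential image: given a vector bundle `M`, choose a frame of `M` for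
  each scheme over `X` that maps to the domain of a frame. The pullback of `M` is then described by
  coordinates, and changing frames along a morphism gives the restriction maps of a standard vector
  bundle `ofModule` whose image under `Φ` is isomorphic to `M` (`transition_pullCoord`,
  `frameMap_coordAt`, `isIso_ofModuleHom`).

* A sequence in `StdVB X` is short exact if and only if, locally on `X`, it splits on sections
  (`isLocallySplit_of_stdExact`, `IsLocallySplit.stdExact`), because locally the last term is free.
  A splitting over an object in all the sieves involved restricts along every morphism
  (`IsSplitAt.of_hom`), again because sections are obtained by base change.

The first fact gives the exact structure: a full subcategory of an abelian category that contains
zero and is closed under extensions is exact (`isExactCategory_of_fullyFaithful`), and an extension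
of locally free modules of finite rank is locally free of finite rank
(`isVectorBundle_of_shortExact`). It also gives the equivalence with `VB X`. The second fact gives
exactness of pullback (`isExactFunctor_inverseImage`) and of the tensor product
(`isExactFunctor_tensorRight`, `isExactFunctor_tensorLeft`), as splittings can be pulled back and
tensored. For the tensor product one uses that `γ ⊗ δ` sends the product of two sections `s` and `t`
to the product of `γ s` and `δ t` (`act_tensor_mul`), and that such products generate the sections
of `ξ (E ⊗ F)` over objects of both sieves (`linear_ext_mul`).

The strict equality `(g ≫ f)^* = g^* f^*` on objects holds since both sides have the same sieve,
ranks and restriction maps (`ext_of_cast`); the equalities of indexing objects are not definitional,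
so for morphisms one computes the transport along the equality of objects on sections
(`act_eqToHom_pull`).
-/

namespace StandardVB

/-! ### Exact structures from fully faithful functors to abelian categories -/

section ExactStructures

section Abelian

variable {A : Type*} [Category* A] [Abelian A]

lemma shortExact_of_cokernel {X Y Z : A} {f : X ⟶ Y} {g : Y ⟶ Z} (w : f ≫ g = 0) [Mono f] [Epi g]
    (h : ∀ {W : A} (k : Y ⟶ W), f ≫ k = 0 → ∃ l, g ≫ l = k) :
    (ShortComplex.mk f g w).ShortExact where
  exact := ShortComplex.exact_of_g_is_cokernel _
    (CokernelCofork.IsColimit.ofπ' _ _ fun k hk => ⟨(h k hk).choose, (h k hk).choose_spec⟩)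

lemma shortExact_of_kernel {X Y Z : A} {f : X ⟶ Y} {g : Y ⟶ Z} (w : f ≫ g = 0) [Mono f] [Epi g]
    (h : ∀ {W : A} (k : W ⟶ Y), k ≫ g = 0 → ∃ l, l ≫ f = k) :
    (ShortComplex.mk f g w).ShortExact where
  exact := ShortComplex.exact_of_f_is_kernel _
    (KernelFork.IsLimit.ofι' _ _ fun k hk => ⟨(h k hk).choose, (h k hk).choose_spec⟩)

lemma shortExact_congr {X Y Z X' Y' Z' : A} {f : X ⟶ Y} {g : Y ⟶ Z} {w : f ≫ g = 0}
    (h : (ShortComplex.mk f g w).ShortExact) (eX : X ≅ X') (eY : Y ≅ Y') (eZ : Z ≅ Z')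
    {f' : X' ⟶ Y'} {g' : Y' ⟶ Z'} (w' : f' ≫ g' = 0) (hf : eX.hom ≫ f' = f ≫ eY.hom)
    (hg : eY.hom ≫ g' = g ≫ eZ.hom) : (ShortComplex.mk f' g' w').ShortExact :=
  ShortComplex.shortExact_of_iso (ShortComplex.isoMk eX eY eZ hf hg) h

variable {X Y Z : A} {f : X ⟶ Y} {g : Y ⟶ Z} {w : f ≫ g = 0}
  (hS : (ShortComplex.mk f g w).ShortExact)
include hS

/-- The pushout of a short exact sequence along a morphism out of its first term. -/
lemma shortExact_pushout {B : A} (h : X ⟶ B) :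
    (ShortComplex.mk (pushout.inr f h) (pushout.desc g (0 : B ⟶ Z) (by simp [w]))
      (pushout.inr_desc _ _ _)).ShortExact := by
  have : Mono f := hS.mono_f
  have : Epi g := hS.epi_g
  have h0 : f ≫ g = h ≫ 0 := by simp [w]
  have : Epi (pushout.inl f h ≫ pushout.desc g 0 h0) := by
    rw [pushout.inl_desc]; infer_instance
  have : Epi (pushout.desc g 0 h0) := epi_of_epi (pushout.inl f h) _
  refine shortExact_of_cokernel _ fun k hk => ?_
  have h1 : f ≫ pushout.inl f h ≫ k = 0 := by
    rw [← Category.assoc, pushout.condition, Category.assoc, hk, comp_zero]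
  obtain ⟨l, hl : g ≫ l = _⟩ := CokernelCofork.IsColimit.desc' hS.gIsCokernel _ h1
  exact ⟨l, pushout.hom_ext ((pushout.inl_desc_assoc _ _ h0 _).trans hl)
    ((pushout.inr_desc_assoc _ _ h0 _).trans (zero_comp.trans hk.symm))⟩

/-- The pullback of a short exact sequence along a morphism into its last term. -/
lemma shortExact_pullback {B : A} (h : B ⟶ Z) :
    (ShortComplex.mk (pullback.lift f (0 : X ⟶ B) (by simp [w])) (pullback.snd g h)
      (pullback.lift_snd _ _ _)).ShortExact := by
  have : Mono f := hS.mono_f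
  have : Epi g := hS.epi_g
  have h0 : f ≫ g = 0 ≫ h := by simp [w]
  have : Mono (pullback.lift f 0 h0 ≫ pullback.fst g h) := by
    rw [pullback.lift_fst]; infer_instance
  have : Mono (pullback.lift f 0 h0) := mono_of_mono _ (pullback.fst g h)
  refine shortExact_of_kernel _ fun k hk => ?_
  have h1 : (k ≫ pullback.fst g h) ≫ g = 0 := by
    rw [Category.assoc, pullback.condition, ← Category.assoc, hk, zero_comp]
  obtain ⟨l, hl : l ≫ f = _⟩ := KernelFork.IsLimit.lift' hS.fIsKernel _ h1
  exact ⟨l, pullback.hom_ext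
    ((Category.assoc _ _ _).trans ((l ≫= pullback.lift_fst _ _ h0).trans hl))
    ((Category.assoc _ _ _).trans ((l ≫= pullback.lift_snd _ _ h0).trans
      (comp_zero.trans hk.symm)))⟩

/-- The cokernel of a composition of monomorphisms is the pushout of the second one along the
cokernel of the first one. -/
lemma shortExact_comp_pushout {B : A} (i : Y ⟶ B) [Mono i] :
    (ShortComplex.mk (f ≫ i) (pushout.inl i g) (by
      rw [Category.assoc, pushout.condition, reassoc_of% w, zero_comp])).ShortExact := by
  have : Mono f := hS.mono_f
  have : Epi g := hS.epi_g
  refine shortExact_of_cokernel _ fun k hk => ?_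
  have h1 : f ≫ i ≫ k = 0 := by rw [← Category.assoc]; exact hk
  obtain ⟨l, hl : g ≫ l = _⟩ := CokernelCofork.IsColimit.desc' hS.gIsCokernel _ h1
  exact ⟨pushout.desc k l hl.symm, pushout.inl_desc _ _ _⟩

/-- The kernel of a composition of epimorphisms is the pullback of the first one along the
kernel of the second one. -/
lemma shortExact_comp_pullback {B : A} (p : B ⟶ Y) [Epi p] :
    (ShortComplex.mk (pullback.fst p f) (p ≫ g) (by
      rw [pullback.condition_assoc, w, comp_zero])).ShortExact := by
  have : Mono f := hS.mono_f
  have : Epi g := hS.epi_g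
  refine shortExact_of_kernel _ fun k hk => ?_
  have h1 : (k ≫ p) ≫ g = 0 := by rw [Category.assoc]; exact hk
  obtain ⟨l, hl : l ≫ f = _⟩ := KernelFork.IsLimit.lift' hS.fIsKernel _ h1
  exact ⟨pullback.lift k l hl.symm, pullback.lift_fst _ _ _⟩

end Abelian

section Functor

variable {C : Type*} [Category* C] [Preadditive C] {A : Type*} [Category* A] [Abelian A]
  (F : C ⥤ A) [F.Additive]

/-- An inflation, with the short exact sequence written on the images of the two maps, so that it
can be compared with sequences in `A` that are not images of sequences in `C`. -/
lemma isInflation_iff_exists {X Y : C} (i : X ⟶ Y) :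
    IsInflation (fun T : ShortComplex C => (T.map F).ShortExact) i ↔
      ∃ (Z : C) (p : Y ⟶ Z) (_ : i ≫ p = 0) (w : F.map i ≫ F.map p = 0),
        (ShortComplex.mk (F.map i) (F.map p) w).ShortExact :=
  ⟨fun ⟨Z, p, w, h⟩ => ⟨Z, p, w, _, h⟩, fun ⟨Z, p, w, _, h⟩ => ⟨Z, p, w, h⟩⟩

/-- A deflation, with the short exact sequence written on the images of the two maps. -/
lemma isDeflation_iff_exists {X Y : C} (p : X ⟶ Y) :
    IsDeflation (fun T : ShortComplex C => (T.map F).ShortExact) p ↔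
      ∃ (Z : C) (i : Z ⟶ X) (_ : i ≫ p = 0) (w : F.map i ≫ F.map p = 0),
        (ShortComplex.mk (F.map i) (F.map p) w).ShortExact :=
  ⟨fun ⟨Z, p, w, h⟩ => ⟨Z, p, w, _, h⟩, fun ⟨Z, p, w, _, h⟩ => ⟨Z, p, w, h⟩⟩

variable [F.Full] [F.Faithful]

/-- A binary biproduct of `F A` and `F B` in the essential image of a fully faithful additive
functor `F` comes from a binary biproduct of `A` and `B`. -/
lemma hasBinaryBiproduct_of_mem_essImage {X Y : C} (h : F.essImage (F.obj X ⊞ F.obj Y)) :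
    HasBinaryBiproduct X Y := by
  obtain ⟨Z, ⟨e⟩⟩ := h
  refine hasBinaryBiproduct_of_total
    { pt := Z
      fst := F.preimage (e.hom ≫ biprod.fst)
      snd := F.preimage (e.hom ≫ biprod.snd)
      inl := F.preimage (biprod.inl ≫ e.inv)
      inr := F.preimage (biprod.inr ≫ e.inv)
      inl_fst := F.map_injective (by simp)
      inl_snd := F.map_injective (by simp)
      inr_fst := F.map_injective (by simp)
      inr_snd := F.map_injective (by simp) } (F.map_injective ?_)
  simp only [Functor.map_add, Functor.map_comp, Functor.map_preimage, Category.assoc]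
  rw [← Preadditive.comp_add, ← Category.assoc biprod.fst, ← Category.assoc biprod.snd,
    ← Preadditive.add_comp, biprod.total]
  simp

/-- If the image of `i` is the first map of a short exact sequence whose last term is in the
essential image of `F`, then `i` is an inflation. -/
lemma isInflation_of_shortExact {X Y : C} (i : X ⟶ Y) {Z : A} {p : F.obj Y ⟶ Z}
    {w : F.map i ≫ p = 0} (h : (ShortComplex.mk (F.map i) p w).ShortExact) (hZ : F.essImage Z) :
    IsInflation (fun T : ShortComplex C => (T.map F).ShortExact) i := by
  obtain ⟨Z, ⟨e⟩⟩ := hZ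
  exact (isInflation_iff_exists F i).2 ⟨Z, F.preimage (p ≫ e.inv),
    F.map_injective (by simp [reassoc_of% w]), by simp [reassoc_of% w],
    shortExact_congr h (Iso.refl _) (Iso.refl _) e.symm _ (by simp) (by simp)⟩

/-- If the image of `p` is the last map of a short exact sequence whose first term is in the
essential image of `F`, then `p` is a deflation. -/
lemma isDeflation_of_shortExact {X Y : C} (p : X ⟶ Y) {Z : A} {i : Z ⟶ F.obj X}
    {w : i ≫ F.map p = 0} (h : (ShortComplex.mk i (F.map p) w).ShortExact) (hZ : F.essImage Z) :
    IsDeflation (fun T : ShortComplex C => (T.map F).ShortExact) p := by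
  obtain ⟨Z, ⟨e⟩⟩ := hZ
  exact (isDeflation_iff_exists F p).2 ⟨Z, F.preimage (e.hom ≫ i),
    F.map_injective (by simp [w]), by simp [w],
    shortExact_congr h e.symm (Iso.refl _) (Iso.refl _) _ (by simp) (by simp)⟩

/-- A preadditive category with a fully faithful additive functor to an abelian category whose
essential image contains zero and is closed under extensions is an exact category, the short exact
sequences being those with short exact image. -/
theorem isExactCategory_of_fullyFaithful {Z : C} (hZ : IsZero Z)
    (hext : ∀ {X Y Z : A} (f : X ⟶ Y) (g : Y ⟶ Z) (w : f ≫ g = 0),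
      (ShortComplex.mk f g w).ShortExact → F.essImage X → F.essImage Z → F.essImage Y) :
    IsExactCategory (fun T : ShortComplex C => (T.map F).ShortExact) where
  biproducts := by
    have : HasZeroObject C := ⟨Z, hZ⟩
    have : HasBinaryBiproducts C := ⟨fun X Y => hasBinaryBiproduct_of_mem_essImage F <|
      hext (biprod.inl : F.obj X ⟶ F.obj X ⊞ F.obj Y) biprod.snd (by simp)
        (ShortComplex.Splitting.shortExact
          { r := biprod.fst, s := biprod.inr, id := by simp [biprod.total] })
        (F.obj_mem_essImage _) (F.obj_mem_essImage _)⟩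
    have := hasFiniteProducts_of_has_binary_and_terminal (C := C)
    exact HasFiniteBiproducts.of_hasFiniteProducts
  of_iso e h := ShortComplex.shortExact_of_iso (F.mapShortComplex.mapIso e) h
  kernel S h := ⟨isLimitOfReflects F ((isLimitMapConeForkEquiv' F S.zero).symm h.fIsKernel)⟩
  cokernel S h :=
    ⟨isColimitOfReflects F ((isColimitMapCoconeCoforkEquiv' F S.zero).symm h.gIsCokernel)⟩
  inflation_id X := isInflation_of_shortExact F _ (p := (0 : F.obj X ⟶ F.obj Z)) (w := comp_zero)
    (ShortComplex.Splitting.shortExact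
      { r := 𝟙 _, s := 0, s_g := (F.map_isZero hZ).eq_of_src _ _ })
    (F.obj_mem_essImage _)
  deflation_id X := isDeflation_of_shortExact F _ (i := (0 : F.obj Z ⟶ F.obj X)) (w := zero_comp)
    (ShortComplex.Splitting.shortExact
      { r := 0, s := 𝟙 _, f_r := (F.map_isZero hZ).eq_of_src _ _ })
    (F.obj_mem_essImage _)
  inflation_comp {X Y Z} f g hf hg := by
    obtain ⟨_, p, w, w₁, h⟩ := (isInflation_iff_exists F f).1 hf
    obtain ⟨_, q, w', w₁', h'⟩ := (isInflation_iff_exists F g).1 hg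
    have : Mono (F.map g) := h'.mono_f
    have h1 := shortExact_comp_pushout h (F.map g)
    refine isInflation_of_shortExact F (f ≫ g)
      (shortExact_congr h1 (Iso.refl _) (Iso.refl _) (Iso.refl _) (f' := F.map (f ≫ g))
        (g' := pushout.inl (F.map g) (F.map p)) ?_ (by simp) (by simp)) ?_
    · rw [F.map_comp, Category.assoc, pushout.condition, reassoc_of% w₁, zero_comp]
    -- The cokernel of `f ≫ g` is an extension of the cokernel of `g` by the cokernel of `f`.
    · exact hext _ _ _ (shortExact_pushout h' (F.map p)) (F.obj_mem_essImage _)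
        (F.obj_mem_essImage _)
  deflation_comp {X Y Z} f g hf hg := by
    obtain ⟨_, i, w, w₁, h⟩ := (isDeflation_iff_exists F f).1 hf
    obtain ⟨_, j, w', w₁', h'⟩ := (isDeflation_iff_exists F g).1 hg
    have : Epi (F.map f) := h.epi_g
    have h1 := shortExact_comp_pullback h' (F.map f)
    refine isDeflation_of_shortExact F (f ≫ g)
      (shortExact_congr h1 (Iso.refl _) (Iso.refl _) (Iso.refl _) (g' := F.map (f ≫ g))
        (f' := pullback.fst (F.map f) (F.map j)) ?_ (by simp) (by simp)) ?_
    · rw [F.map_comp, pullback.condition_assoc, w₁', comp_zero]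
    -- The kernel of `f ≫ g` is an extension of the kernel of `g` by the kernel of `f`.
    · exact hext _ _ _ (shortExact_pullback h (F.map j)) (F.obj_mem_essImage _)
        (F.obj_mem_essImage _)
  inflation_pushout {X Y X'} i f hi := by
    obtain ⟨_, p, w, w₁, h⟩ := (isInflation_iff_exists F i).1 hi
    -- The pushout in `A` is an extension of objects of the essential image of `F`, so it comes from
    -- an object of `C`.
    have h1 := shortExact_pushout h (F.map f)
    obtain ⟨Y', ⟨e⟩⟩ := hext _ _ _ h1 (F.obj_mem_essImage _) (F.obj_mem_essImage _)
    let i' : X' ⟶ Y' := F.preimage (pushout.inr (F.map i) (F.map f) ≫ e.inv)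
    let f' : Y ⟶ Y' := F.preimage (pushout.inl (F.map i) (F.map f) ≫ e.inv)
    have h2 : F.map i' ≫ e.hom = pushout.inr _ _ := by simp [i']
    refine ⟨Y', i', f', IsPushout.of_map_of_faithful F ?_, ?_⟩
    · exact IsPushout.of_iso (IsPushout.of_hasPushout (F.map i) (F.map f)) (Iso.refl _)
        (Iso.refl _) (Iso.refl _) e.symm (by simp) (by simp) (by simp [f']) (by simp [i'])
    · refine isInflation_of_shortExact F i'
        (shortExact_congr h1 (Iso.refl _) e.symm (Iso.refl _) (f' := F.map i')
          (g' := e.hom ≫ pushout.desc (F.map p) 0 (by simp [w₁])) ?_ (by simp [i']) (by simp))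
          (F.obj_mem_essImage _)
      rw [reassoc_of% h2]
      exact pushout.inr_desc _ _ _
  deflation_pullback {Y Z Z'} p f hp := by
    obtain ⟨_, i, w, w₁, h⟩ := (isDeflation_iff_exists F p).1 hp
    have h1 := shortExact_pullback h (F.map f)
    obtain ⟨Y', ⟨e⟩⟩ := hext _ _ _ h1 (F.obj_mem_essImage _) (F.obj_mem_essImage _)
    let p' : Y' ⟶ Z' := F.preimage (e.hom ≫ pullback.snd (F.map p) (F.map f))
    let f' : Y' ⟶ Y := F.preimage (e.hom ≫ pullback.fst (F.map p) (F.map f))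
    have h2 : e.inv ≫ F.map p' = pullback.snd _ _ := by simp [p']
    refine ⟨Y', p', f', IsPullback.of_map_of_faithful F ?_, ?_⟩
    · exact IsPullback.of_iso (IsPullback.of_hasPullback (F.map p) (F.map f)) e.symm (Iso.refl _)
        (Iso.refl _) (Iso.refl _) (by simp [f']) (by simp [p']) (by simp) (by simp)
    · refine isDeflation_of_shortExact F p'
        (shortExact_congr h1 (Iso.refl _) e.symm (Iso.refl _) (g' := F.map p')
          (f' := pullback.lift (F.map i) 0 (by simp [w₁]) ≫ e.inv) ?_ (by simp) (by simp [p']))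
          (F.obj_mem_essImage _)
      rw [Category.assoc, h2]
      exact pullback.lift_snd _ _ _

end Functor

end ExactStructures

end StandardVB

namespace StandardVB

/-! ### Short exact sequences of sheaves of modules -/

section
variable {C : Type u} [SmallCategory C] {J : GrothendieckTopology C} {R : Sheaf J RingCat.{u}}

/-- An epimorphism of sheaves of modules is locally surjective: a section of the target vanishes in
the sheafification of the presheaf cokernel, hence locally in the presheaf cokernel. -/
lemma exists_locally_lift {M N : SheafOfModules.{u} R} (g : M ⟶ N) [Epi g] {U : C}
    (n : N.val.obj (op U)) : ∃ S ∈ J U, ∀ (V : C) (i : V ⟶ U), S i →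
      ∃ m : M.val.obj (op V), g.val.app (op V) m = N.val.map i.op n := by
  let q := cokernel.π g.val
  let adj := PresheafOfModules.sheafificationAdjunction (𝟙 R.obj)
  let η : cokernel g.val ⟶
      ((PresheafOfModules.sheafification (𝟙 R.obj)).obj (cokernel g.val)).val :=
    adj.unit.app (cokernel g.val)
  let k : N ⟶ (PresheafOfModules.sheafification (𝟙 R.obj)).obj (cokernel g.val) := ⟨q ≫ η⟩
  -- `k` vanishes because `g` is an epimorphism of sheaves.
  have hk : k = 0 := by
    rw [← cancel_epi g, comp_zero]
    ext1
    change g.val ≫ q ≫ η = 0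
    rw [← Category.assoc, cokernel.condition, zero_comp]
  have h1 : η.app (op U) (q.app (op U) n) = 0 :=
    congr(SheafOfModules.Hom.val $hk |>.app (op U) n)
  have hη : Presheaf.IsLocallyInjective J ((PresheafOfModules.toPresheaf _).map η) := by
    exact inferInstanceAs (Presheaf.IsLocallyInjective J (toSheafify J (cokernel g.val).presheaf))
  refine ⟨_, hη.equalizerSieve_mem (X := op U) (q.app (op U) n) 0 (h1.trans (map_zero _).symm),
    fun V i hi => ?_⟩
  have hi : (cokernel g.val).map i.op (q.app (op U) n) = 0 := hi.trans (map_zero _)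
  have h2 : q.app (op V) (N.val.map i.op n) = 0 := by
    exact congr($(q.naturality i.op) n).trans hi
  have h3 : (ShortComplex.mk (g.val.app (op V)) (q.app (op V)) (by
      exact congr(PresheafOfModules.Hom.app $(cokernel.condition g.val) (op V)))).Exact := by
    have := (ShortComplex.mk _ _ (cokernel.condition g.val)).exact_of_g_is_cokernel
      (cokernelIsCokernel g.val)
    exact this.map (PresheafOfModules.evaluation R.obj (op V))
  exact (ShortComplex.moduleCat_exact_iff _).1 h3 _ h2

end

variable {S : Scheme.{u}}

/-- The functor of sections over an open subset. -/
noncomputable abbrev sec (U : S.Opens) : S.Modules ⥤ Ab.{u} :=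
  Scheme.Modules.toPresheaf S ⋙ (evaluation _ _).obj (op U)

instance (U : S.Opens) : PreservesLimits (sec U) := by
  have : PreservesLimits ((evaluation (TopologicalSpace.Opens S)ᵒᵖ Ab.{u}).obj (op U)) :=
    ⟨fun {J} _ => inferInstance⟩
  exact comp_preservesLimits _ _

instance (U : S.Opens) : (sec U).PreservesZeroMorphisms where
  map_zero _ _ := rfl

lemma injective_app_of_mono {M N : S.Modules} (f : M ⟶ N) [Mono f] (U : S.Opens) :
    Function.Injective (f.app U) := by
  have h : Mono ((sec U).map f) := inferInstance
  exact (AddCommGrpCat.mono_iff_injective _).1 h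

lemma exists_app_eq_of_exact {M N K : S.Modules} {f : M ⟶ N} {g : N ⟶ K} {w : f ≫ g = 0}
    (h : (ShortComplex.mk f g w).ShortExact) (U : S.Opens) (n : Γ(N, U)) (hn : g.app U n = 0) :
    ∃ m, f.app U m = n := by
  have := h.mono_f
  have h3 := h.exact.map_of_mono_of_preservesKernel (sec U) this inferInstance
  exact (ShortComplex.ab_exact_iff _).1 h3 _ hn

lemma exists_lift_of_epi {M N : S.Modules} (g : M ⟶ N) [h : Epi g] {U : S.Opens} (n : Γ(N, U))
    {x : S} (hx : x ∈ U) : ∃ (V : S.Opens) (i : V ⟶ U) (_ : x ∈ V) (m : Γ(M, V)),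
      g.app V m = N.presheaf.map i.op n := by
  have : Epi (C := SheafOfModules S.ringCatSheaf) g := h
  obtain ⟨T, hT, h⟩ := exists_locally_lift (J := Opens.grothendieckTopology S) g n
  obtain ⟨V, i, hi, hx⟩ := hT x hx
  obtain ⟨m, hm⟩ := h V i hi
  exact ⟨V, i, hx, m, hm⟩

/-- A family of linear maps on sections that commutes with restriction, as a morphism of modules. -/
def homOfLinear {M N : S.Modules} (φ : ∀ U : S.Opens, Γ(M, U) →ₗ[Γ(S, U)] Γ(N, U))
    (h : ∀ {U V : S.Opens} (i : V ⟶ U) (m : Γ(M, U)),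
      φ V (M.presheaf.map i.op m) = N.presheaf.map i.op (φ U m)) : M ⟶ N where
  val :=
    { app := fun U => ModuleCat.ofHom (φ U.unop)
      naturality := fun i => by
        ext m
        exact h i.unop m }

lemma app_naturality {M N : S.Modules} (f : M ⟶ N) {U V : S.Opens} (i : V ⟶ U) (m : Γ(M, U)) :
    f.app V (M.presheaf.map i.op m) = N.presheaf.map i.op (f.app U m) :=
  PresheafOfModules.naturality_apply f.val i.op m

lemma section_ext_of_locally {M : S.Modules} {U : S.Opens} {m m' : Γ(M, U)}
    (h : ∀ x ∈ U, ∃ (V : S.Opens) (i : V ⟶ U), x ∈ V ∧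
      M.presheaf.map i.op m = M.presheaf.map i.op m') : m = m' := by
  choose V i hx h using h
  refine TopCat.Sheaf.eq_of_locally_eq' ⟨M.presheaf, M.isSheaf⟩ (fun x : U => V x.1 x.2) U
    (fun x => i x.1 x.2) (fun x hxU => ?_) _ _ (fun x => h x.1 x.2)
  simp only [TopologicalSpace.Opens.mem_iSup]
  exact ⟨⟨x, hxU⟩, hx x hxU⟩

lemma map_map (M : S.Modules) {U V W : S.Opens} (i : V ⟶ U) (j : W ⟶ V) (m : Γ(M, U)) :
    M.presheaf.map j.op (M.presheaf.map i.op m) = M.presheaf.map (j ≫ i).op m := by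
  rw [op_comp, Functor.map_comp]
  rfl

/-- A sequence of modules is short exact if it is so on all sufficiently small open subsets. -/
lemma shortExact_of_locally {M N K : S.Modules} {f : M ⟶ N} {g : N ⟶ K} (w : f ≫ g = 0)
    (h : ∀ x : S, ∃ W : S.Opens, x ∈ W ∧ ∀ V ≤ W, Function.Injective (f.app V) ∧
      (∀ n, g.app V n = 0 → ∃ m, f.app V m = n) ∧ Function.Surjective (g.app V)) :
    (ShortComplex.mk f g w).ShortExact := by
  -- Injectivity of `f` and exactness in the middle pass to arbitrary open subsets by gluing, and
  -- surjectivity of `g` on small open subsets makes it an epimorphism.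
  have hf : ∀ U, Function.Injective (f.app U) := by
    intro U m m' e
    refine section_ext_of_locally fun x hx => ?_
    obtain ⟨W, hxW, hW⟩ := h x
    refine ⟨U ⊓ W, homOfLE inf_le_left, ⟨hx, hxW⟩, (hW _ inf_le_right).1 ?_⟩
    rw [app_naturality, app_naturality, e]
  have hk : ∀ U n, g.app U n = 0 → ∃ m, f.app U m = n := by
    intro U n hn
    have key : ∀ x : U, ∃ (V : S.Opens) (i : V ⟶ U) (m : Γ(M, V)), x.1 ∈ V ∧
        f.app V m = N.presheaf.map i.op n := by
      intro x
      obtain ⟨W, hxW, hW⟩ := h x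
      obtain ⟨m, hm⟩ := (hW (U ⊓ W) inf_le_right).2.1 (N.presheaf.map (homOfLE inf_le_left).op n)
        (by rw [app_naturality, hn, map_zero])
      exact ⟨U ⊓ W, homOfLE inf_le_left, m, ⟨x.2, hxW⟩, hm⟩
    choose V i m hx hm using key
    obtain ⟨m', hm', -⟩ := TopCat.Sheaf.existsUnique_gluing' ⟨M.presheaf, M.isSheaf⟩ V U i
      (fun x hxU => by
        simp only [TopologicalSpace.Opens.mem_iSup]
        exact ⟨⟨x, hxU⟩, hx ⟨x, hxU⟩⟩) m (fun x y => by
        apply hf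
        refine (app_naturality f (TopologicalSpace.Opens.infLELeft _ _) _).trans
          (Eq.trans ?_ (app_naturality f (TopologicalSpace.Opens.infLERight _ _) _).symm)
        rw [hm, hm, map_map, map_map]
        rfl)
    refine ⟨m', section_ext_of_locally fun x hx' => ⟨V ⟨x, hx'⟩, i _, hx _, ?_⟩⟩
    rw [← app_naturality, ← hm]
    exact congrArg _ (hm' ⟨x, hx'⟩)
  have : Mono f := ⟨fun a b e => by
    ext U s
    exact hf U congr(Scheme.Modules.Hom.app $e U s)⟩
  have : Epi g := ⟨fun a b e => by
    ext U s
    refine section_ext_of_locally fun x hx => ?_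
    obtain ⟨W, hxW, hW⟩ := h x
    refine ⟨U ⊓ W, homOfLE inf_le_left, ⟨hx, hxW⟩, ?_⟩
    obtain ⟨n, hn⟩ := (hW (U ⊓ W) inf_le_right).2.2 (K.presheaf.map (homOfLE inf_le_left).op s)
    rw [← app_naturality, ← app_naturality, ← hn]
    exact congr(Scheme.Modules.Hom.app $e (U ⊓ W) n)⟩
  refine shortExact_of_kernel w fun {W} k hk' => ?_
  choose l hl using fun U (s : Γ(W, U)) => hk U (k.app U s) congr(Scheme.Modules.Hom.app $hk' U s)
  -- The lifts `l` are unique, hence linear and compatible with restriction.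
  refine ⟨homOfLinear (fun U =>
    { toFun := l U
      map_add' := fun a b => hf U ?_
      map_smul' := fun a b => hf U ?_ }) (fun {U V} i m => hf V ?_), ?_⟩
  · rw [map_add, hl, hl, hl, map_add]
  · rw [hl, RingHom.id_apply, Scheme.Modules.Hom.app_smul, Scheme.Modules.Hom.app_smul, hl]
  · change f.app V (l V _) = f.app V _
    rw [app_naturality, hl, app_naturality]
    exact congrArg _ (hl U m).symm
  · ext U s
    exact hl U s

/-- Finitely many sections of the target of an epimorphism lift on a common neighbourhood of a given
point. -/
lemma exists_lifts_of_epi {M N : S.Modules} (g : M ⟶ N) [Epi g] {U : S.Opens} {k : ℕ}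
    (n : Fin k → Γ(N, U)) {x : S} (hx : x ∈ U) : ∃ (V : S.Opens) (i : V ⟶ U) (_ : x ∈ V)
      (m : Fin k → Γ(M, V)), ∀ a, g.app V (m a) = N.presheaf.map i.op (n a) := by
  choose V i hV m hm using fun a => exists_lift_of_epi g (n a) hx
  let W : S.Opens := U ⊓ ⨅ a, V a
  have hW : ∀ a, W ≤ V a := fun a => inf_le_right.trans (iInf_le _ a)
  refine ⟨W, homOfLE inf_le_left, ⟨hx, ?_⟩, fun a => M.presheaf.map (homOfLE (hW a)).op (m a),
    fun a => ?_⟩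
  · rw [TopologicalSpace.Opens.coe_iInf]
    exact Set.mem_iInter.2 hV
  · rw [app_naturality, hm, map_map]
    rfl

/-- The middle term of a short exact sequence of modules is free, with basis formed by the images of
a basis of the first term and by lifts of a basis of the last term. -/
lemma bijective_addCases {R M N K : Type*} [CommRing R] [AddCommGroup M] [AddCommGroup N]
    [AddCommGroup K] [Module R M] [Module R N] [Module R K] (f : M →ₗ[R] N) (g : N →ₗ[R] K)
    (hf : Function.Injective f) (hfg : ∀ m, g (f m) = 0) (hg : ∀ n, g n = 0 → ∃ m, f m = n)
    {a b : ℕ} (e : Fin a → M) (e' : Fin b → N)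
    (he : Function.Bijective fun c : Fin a → R => ∑ i, c i • e i)
    (he' : Function.Bijective fun c : Fin b → R => ∑ i, c i • g (e' i)) :
    Function.Bijective fun c : Fin (a + b) → R =>
      ∑ i, c i • (Fin.addCases (fun i => f (e i)) e' i : N) := by
  have h : ∀ c : Fin (a + b) → R, ∑ i, c i • (Fin.addCases (fun i => f (e i)) e' i : N) =
      f (∑ i, c (Fin.castAdd b i) • e i) + ∑ i, c (Fin.natAdd a i) • e' i := by
    intro c
    rw [Fin.sum_univ_add]
    simp
  have h' : ∀ c : Fin (a + b) → R, g (∑ i, c i • (Fin.addCases (fun i => f (e i)) e' i : N)) =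
      ∑ i, c (Fin.natAdd a i) • g (e' i) := by
    intro c
    rw [h, map_add, hfg, zero_add, map_sum]
    simp
  constructor
  · intro c d hcd
    dsimp only at hcd
    have h1 : (fun i => c (Fin.natAdd a i)) = fun i => d (Fin.natAdd a i) := he'.1 (by
      dsimp only
      rw [← h', ← h', hcd])
    have h2 : (fun i => c (Fin.castAdd b i)) = fun i => d (Fin.castAdd b i) := he.1 (hf (by
      rw [h, h] at hcd
      simp only [congrFun h1] at hcd
      exact add_right_cancel hcd))
    funext i
    exact Fin.addCases (congrFun h2) (congrFun h1) i
  · intro n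
    obtain ⟨d, hd⟩ := he'.2 (g n)
    obtain ⟨m, hm⟩ := hg (n - ∑ i, d i • e' i) (by
      rw [map_sub, map_sum, ← hd]
      simp)
    obtain ⟨c, rfl⟩ := he.2 m
    refine ⟨Fin.addCases c d, ?_⟩
    dsimp only
    rw [h]
    simp only [Fin.addCases_left, Fin.addCases_right]
    rw [hm, sub_add_cancel]

/-- An extension of vector bundles is a vector bundle. -/
lemma isVectorBundle_of_shortExact {M N K : S.Modules} {f : M ⟶ N} {g : N ⟶ K} {w : f ≫ g = 0}
    (h : (ShortComplex.mk f g w).ShortExact) (hM : IsVectorBundle M) (hK : IsVectorBundle K) :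
    IsVectorBundle N := by
  intro x
  have : Mono f := h.mono_f
  have : Epi g := h.epi_g
  obtain ⟨U, hxU, a, e, he⟩ := hM x
  obtain ⟨U', hxU', b, e', he'⟩ := hK x
  obtain ⟨V, i, hxV, l, hl⟩ := exists_lifts_of_epi g e' hxU'
  refine ⟨U ⊓ V, ⟨hxU, hxV⟩, a + b, Fin.addCases
    (fun k => f.app _ (M.presheaf.map (homOfLE inf_le_left).op (e k)))
    (fun k => N.presheaf.map (homOfLE inf_le_right).op (l k)), fun W hW => ?_⟩
  let fl : Γ(M, W) →ₗ[Γ(S, W)] Γ(N, W) :=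
    { toFun := f.app W, map_add' := map_add _, map_smul' := f.app_smul }
  let gl : Γ(N, W) →ₗ[Γ(S, W)] Γ(K, W) :=
    { toFun := g.app W, map_add' := map_add _, map_smul' := g.app_smul }
  have := bijective_addCases fl gl (injective_app_of_mono f W)
    (fun m => congr(Scheme.Modules.Hom.app $w W m)) (exists_app_eq_of_exact h W)
    (fun k => M.presheaf.map (homOfLE (hW.trans inf_le_left)).op (e k))
    (fun k => N.presheaf.map (homOfLE (hW.trans inf_le_right)).op (l k))
    (he W (hW.trans inf_le_left)) (by
      convert! he' W ((hW.trans inf_le_right).trans (leOfHom i)) using 5 with c k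
      change g.app W _ = _
      rw [app_naturality, hl, map_map]
      rfl)
  convert! this using 5 with c k
  refine Fin.addCases (fun k => ?_) (fun k => ?_) k
  · rw [Fin.addCases_left]
    refine (congrArg (N.presheaf.map (homOfLE hW).op)
      (Fin.addCases_left (motive := fun _ => Γ(N, U ⊓ V)) k)).trans ?_
    rw [← app_naturality, map_map]
    rfl
  · rw [Fin.addCases_right]
    refine (congrArg (N.presheaf.map (homOfLE hW).op)
      (Fin.addCases_right (motive := fun _ => Γ(N, U ⊓ V)) k)).trans ?_
    rw [map_map]
    rfl

end StandardVB

namespace StandardVB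

/-! ### Sections of standard vector bundles -/

section BaseChange

variable {R S : Type*} [CommRing R] [CommRing S] {φ : R →+* S} {M N K : Type*}
  [AddCommGroup M] [Module R M] [AddCommGroup N] [Module S N] [AddCommGroup K] [Module S K]

/-- A semilinear map `M → N` over `R → S` that sends some finite basis of `M` over `R` to a basis of
`N` over `S`. -/
def IsFreeBaseChange (ρ : M →ₛₗ[φ] N) : Prop :=
  ∃ (n : ℕ) (b : Fin n → M), (Function.Bijective fun c : Fin n → R => ∑ i, c i • b i) ∧
    Function.Bijective fun c : Fin n → S => ∑ i, c i • ρ (b i)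

lemma IsFreeBaseChange.ext {ρ : M →ₛₗ[φ] N} (h : IsFreeBaseChange ρ) {f g : N →ₗ[S] K}
    (hfg : ∀ m, f (ρ m) = g (ρ m)) : f = g := by
  obtain ⟨n, b, -, hb⟩ := h
  refine LinearMap.ext fun x => ?_
  obtain ⟨c, rfl⟩ := hb.2 x
  simp only [map_sum, map_smul, hfg]

/-- The linear map from `S ^ n` defined by `n` vectors. -/
def sumSmul {n : ℕ} (b : Fin n → N) : (Fin n → S) →ₗ[S] N where
  toFun c := ∑ i, c i • b i
  map_add' c d := by simp [add_smul, Finset.sum_add_distrib]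
  map_smul' r c := by simp [mul_smul, Finset.smul_sum]

lemma IsFreeBaseChange.exists_extension {ρ : M →ₛₗ[φ] N} (h : IsFreeBaseChange ρ)
    (ψ : M →ₛₗ[φ] K) : ∃ f : N →ₗ[S] K, ∀ m, f (ρ m) = ψ m := by
  obtain ⟨n, b, hb, hb'⟩ := h
  let e := LinearEquiv.ofBijective (sumSmul fun i => ρ (b i)) hb'
  refine ⟨(sumSmul fun i => ψ (b i)).comp e.symm.toLinearMap, fun m => ?_⟩
  obtain ⟨c, rfl⟩ := hb.2 m
  have h1 : ρ (∑ i, c i • b i) = e fun i => φ (c i) := by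
    simp only [map_sum, map_smulₛₗ]
    rfl
  rw [h1]
  simp only [map_sum, map_smulₛₗ, LinearMap.comp_apply, LinearEquiv.coe_coe,
    LinearEquiv.symm_apply_apply]
  rfl

end BaseChange

variable {𝒮 : SmallSchemes.{u}}

namespace StdVB

variable {X : 𝒮.Cat} {E F G : StdVB X}

instance : (xiFunctor X).Faithful := inferInstanceAs (inducedFunctor xi).Faithful

/-- The effect of a morphism of standard vector bundles on sections. -/
noncomputable def act (γ : E ⟶ F) (U : Over X) :
    E.families U →ₗ[(bigO X).obj (op U)] F.families U where
  toFun := (((xiFunctor X).map γ).val.app (op U)).hom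
  map_add' := map_add _
  map_smul' := (((xiFunctor X).map γ).val.app (op U)).hom.map_smul

lemma act_familiesMap (γ : E ⟶ F) {U V : Over X} (g : V ⟶ U) (s : E.families U) :
    act γ V (E.familiesMap g s) = F.familiesMap g (act γ U s) :=
  PresheafOfModules.naturality_apply ((xiFunctor X).map γ).val g.op s

@[simp] lemma act_comp (γ : E ⟶ F) (δ : F ⟶ G) (U : Over X) (s : E.families U) :
    act (γ ≫ δ) U s = act δ U (act γ U s) := rfl

@[simp] lemma act_add (γ δ : E ⟶ F) (U : Over X) (s : E.families U) :
    act (γ + δ) U s = act γ U s + act δ U s := rfl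

lemma hom_ext_act {γ δ : E ⟶ F} (h : ∀ U s, act γ U s = act δ U s) : γ = δ := by
  refine (xiFunctor X).map_injective ?_
  ext U s
  exact h U.unop s

/-- The morphism of standard vector bundles defined by linear maps on sections that commute with
restriction. -/
noncomputable def homOfAct (φ : ∀ U : Over X, E.families U →ₗ[(bigO X).obj (op U)] F.families U)
    (h : ∀ {U V : Over X} (g : V ⟶ U) (s : E.families U),
      φ V (E.familiesMap g s) = F.familiesMap g (φ U s)) : E ⟶ F :=
  InducedCategory.homMk
    ⟨{ app := fun U => ModuleCat.ofHom (R := (bigRing X).obj.obj U) (φ U.unop)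
       naturality := fun g => by
        ext s
        exact h g.unop s }⟩

lemma toModules_map_app (γ : E ⟶ F) (U : (𝒮.scheme X).Opens)
    (s : E.families ((openOver X).obj U)) :
    ((toModules X).map γ).app U s = act γ ((openOver X).obj U) s := rfl

variable (E)

/-- The restriction map of `ξ E` as a semilinear map. -/
def resLin {U V : Over X} (g : V ⟶ U) :
    E.families U →ₛₗ[((bigO X).map g.op).hom] E.families V where
  toFun := E.familiesMap g
  map_add' := map_add _
  map_smul' := E.familiesMap_smul g

@[simp] lemma resLin_apply {U V : Over X} (g : V ⟶ U) (s : E.families U) :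
    E.resLin g s = E.familiesMap g s := rfl

lemma familiesMap_comp {U V W : Over X} (g : V ⟶ U) (h : W ⟶ V) (s : E.families U) :
    E.familiesMap h (E.familiesMap g s) = E.familiesMap (h ≫ g) s :=
  congr($((E.familiesAb.map_comp g.op h.op).symm) s)

lemma familiesMap_id {U : Over X} (s : E.families U) : E.familiesMap (𝟙 U) s = s :=
  congr($(E.familiesAb.map_id (op U)) s)

/-- The standard basis of the sections of `ξ E` over an object of the sieve. -/
noncomputable def stdBasis (P : SieveObj E.sieve) (i : Fin (E.rank P)) : E.families P.1 :=
  (E.evalEquiv P).symm (Pi.single i 1)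

lemma bijective_stdBasis_of_mem (P Q : SieveObj E.sieve) (g : Q.1 ⟶ P.1) :
    Function.Bijective fun c : Fin (E.rank P) → (bigO X).obj (op Q.1) =>
      ∑ i, c i • E.familiesMap g (E.stdBasis P i) := by
  refine (Function.Bijective.of_comp_iff' (E.evalEquiv Q).bijective _).1 ?_
  refine (congrArg Function.Bijective (funext fun c => ?_)).mpr (E.bijective (Y := P) (Z := Q) g)
  change E.evalEquiv Q _ = _
  refine (map_sum (E.evalEquiv Q) _ _).trans (Finset.sum_congr rfl fun i _ => ?_)
  refine (map_smul (E.evalEquiv Q) _ _).trans (congrArg (c i • ·) ?_)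
  change E.map (Y := P) (Z := Q) (𝟙 Q.1 ≫ g) (Pi.single i 1) = _
  rw [Category.id_comp]

lemma bijective_stdBasis (P : SieveObj E.sieve) {Z : Over X} (g : Z ⟶ P.1) :
    Function.Bijective fun c : Fin (E.rank P) → (bigO X).obj (op Z) =>
      ∑ i, c i • E.familiesMap g (E.stdBasis P i) :=
  E.bijective_stdBasis_of_mem P (E.objOver P g) g

lemma isFreeBaseChange_resLin (P : SieveObj E.sieve) {Z : Over X} (g : Z ⟶ P.1) :
    IsFreeBaseChange (E.resLin g) := by
  refine ⟨_, E.stdBasis P, ?_, E.bijective_stdBasis P g⟩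
  simpa only [familiesMap_id] using E.bijective_stdBasis P (𝟙 P.1)

/-- Restricting along a morphism between objects of the sieve. -/
lemma isFreeBaseChange_of_mem {U V : Over X} (hU : E.sieve U.hom) (g : V ⟶ U) :
    IsFreeBaseChange (E.resLin g) :=
  E.isFreeBaseChange_resLin ⟨U, hU⟩ g

variable {E}

lemma families_ext_of_cover {U : Over X} {T : Sieve U} (hT : T ∈ bigTopology X U)
    {s t : E.families U} (h : ∀ (V : Over X) (j : V ⟶ U), T j →
      E.familiesMap j s = E.familiesMap j t) : s = t :=
  E.isSheaf_familiesAb.isSeparated U T hT s t fun V j hj => h V j hj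

/-- Every point has an open neighbourhood that belongs to a given covering sieve. -/
lemma exists_open_mem {H : Sieve X} (hH : H ∈ 𝒮.zariski X) (x : 𝒮.scheme X) :
    ∃ U : (𝒮.scheme X).Opens, x ∈ U ∧ H ((openOver X).obj U).hom := by
  obtain ⟨V, j, hj, hj', hx⟩ := hH x
  refine ⟨j.hom.opensRange, hx, ?_⟩
  change H (𝒮.openHom X _)
  rw [← 𝒮.lift_fac j (𝒮.openHom X j.hom.opensRange) fun v => 𝒮.openHom_mem X _ v]
  exact H.downward_closed hj _

lemma sieve_openOver_of_le {H : Sieve X} {U V : (𝒮.scheme X).Opens} (h : V ≤ U)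
    (hU : H ((openOver X).obj U).hom) : H ((openOver X).obj V).hom :=
  sieve_comp H hU ((openOver X).map (homOfLE h))

/-! ### Locally split sequences -/

/-- A sequence of standard vector bundles splits over `V`: the sequence of sections over `V` has a
retraction and a section. -/
def IsSplitAt (T : ShortComplex (StdVB X)) (V : Over X) : Prop :=
  ∃ (r : T.X₂.families V →ₗ[(bigO X).obj (op V)] T.X₁.families V)
    (s : T.X₃.families V →ₗ[(bigO X).obj (op V)] T.X₂.families V),
    (∀ a, r (act T.f V a) = a) ∧ (∀ c, act T.g V (s c) = c) ∧
      ∀ b, act T.f V (r b) + s (act T.g V b) = b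

/-- All terms of the sequence are defined over `V`. -/
def InSieves (T : ShortComplex (StdVB X)) (V : Over X) : Prop :=
  T.X₁.sieve V.hom ∧ T.X₂.sieve V.hom ∧ T.X₃.sieve V.hom

lemma InSieves.of_hom {T : ShortComplex (StdVB X)} {U V : Over X} (h : InSieves T U) (g : V ⟶ U) :
    InSieves T V :=
  ⟨sieve_comp _ h.1 g, sieve_comp _ h.2.1 g, sieve_comp _ h.2.2 g⟩

/-- Splittings over an object of the sieves restrict to all objects over it, because the modules of
sections are free and their bases restrict to bases. -/
lemma IsSplitAt.of_hom {T : ShortComplex (StdVB X)} {U V : Over X} (h : IsSplitAt T U)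
    (hU : InSieves T U) (g : V ⟶ U) : IsSplitAt T V := by
  obtain ⟨r, s, h1, h2, h3⟩ := h
  have b1 := T.X₁.isFreeBaseChange_of_mem hU.1 g
  have b2 := T.X₂.isFreeBaseChange_of_mem hU.2.1 g
  have b3 := T.X₃.isFreeBaseChange_of_mem hU.2.2 g
  obtain ⟨r', hr'⟩ := b2.exists_extension ((T.X₁.resLin g).comp r)
  obtain ⟨s', hs'⟩ := b3.exists_extension ((T.X₂.resLin g).comp s)
  simp only [resLin_apply, LinearMap.comp_apply] at hr' hs'
  refine ⟨r', s', ?_, ?_, ?_⟩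
  · refine LinearMap.congr_fun (f := r' ∘ₗ act T.f V) (g := LinearMap.id) (b1.ext fun m => ?_)
    change r' (act T.f V (T.X₁.familiesMap g m)) = T.X₁.familiesMap g m
    rw [act_familiesMap, hr', h1]
  · refine LinearMap.congr_fun (f := act T.g V ∘ₗ s') (g := LinearMap.id) (b3.ext fun m => ?_)
    change act T.g V (s' (T.X₃.familiesMap g m)) = T.X₃.familiesMap g m
    rw [hs', act_familiesMap, h2]
  · refine LinearMap.congr_fun (f := act T.f V ∘ₗ r' + s' ∘ₗ act T.g V) (g := LinearMap.id)
      (b2.ext fun m => ?_)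
    change act T.f V (r' (T.X₂.familiesMap g m)) + s' (act T.g V (T.X₂.familiesMap g m)) =
      T.X₂.familiesMap g m
    rw [act_familiesMap, hr', hs', act_familiesMap, ← map_add, h3]

/-- Every point has an open neighbourhood over which the sequence is defined and splits. -/
def IsLocallySplit (T : ShortComplex (StdVB X)) : Prop :=
  ∀ x : 𝒮.scheme X, ∃ U : (𝒮.scheme X).Opens, x ∈ U ∧ InSieves T ((openOver X).obj U) ∧
    IsSplitAt T ((openOver X).obj U)

lemma IsLocallySplit.stdExact {T : ShortComplex (StdVB X)} (h : IsLocallySplit T) :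
    stdExact X T := by
  refine shortExact_of_locally _ fun x => ?_
  obtain ⟨W, hx, hW, hW'⟩ := h x
  refine ⟨W, hx, fun V hV => ?_⟩
  obtain ⟨r, s, h1, h2, h3⟩ := hW'.of_hom hW ((openOver X).map (homOfLE hV))
  refine ⟨fun a b e => ?_, fun n hn => ⟨r n, ?_⟩, fun c => ⟨s c, h2 c⟩⟩
  · rw [← h1 a, ← h1 b]
    exact congrArg r e
  · have h4 : ∀ n, act T.g ((openOver X).obj V) n = 0 → act T.f ((openOver X).obj V) (r n) = n :=
      fun n hn => by have h5 := h3 n; rwa [hn, map_zero, add_zero] at h5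
    exact h4 n hn

lemma isLocallySplit_of_stdExact {T : ShortComplex (StdVB X)} (h : stdExact X T) :
    IsLocallySplit T := by
  intro x
  obtain ⟨U₁, hx₁, h₁⟩ := exists_open_mem T.X₁.covers x
  obtain ⟨U₂, hx₂, h₂⟩ := exists_open_mem T.X₂.covers x
  obtain ⟨U₃, hx₃, h₃⟩ := exists_open_mem T.X₃.covers x
  let U := U₁ ⊓ U₂ ⊓ U₃
  have hU : InSieves T ((openOver X).obj U) :=
    ⟨sieve_openOver_of_le (inf_le_left.trans inf_le_left) h₁,
      sieve_openOver_of_le (inf_le_left.trans inf_le_right) h₂,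
      sieve_openOver_of_le inf_le_right h₃⟩
  have hf : Mono ((toModules X).map T.f) := h.mono_f
  have hg : Epi ((toModules X).map T.g) := h.epi_g
  let P : SieveObj T.X₃.sieve := ⟨(openOver X).obj U, hU.2.2⟩
  obtain ⟨V, i, hxV, m, hm⟩ : ∃ (V : (𝒮.scheme X).Opens) (i : V ⟶ U) (_ : x ∈ V)
      (m : Fin (T.X₃.rank P) → T.X₂.families ((openOver X).obj V)), ∀ a,
        act T.g _ (m a) = T.X₃.familiesMap ((openOver X).map i) (T.X₃.stdBasis P a) :=
    exists_lifts_of_epi ((toModules X).map T.g) (U := U) (T.X₃.stdBasis P) ⟨⟨hx₁, hx₂⟩, hx₃⟩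
  let j := (openOver X).map i
  refine ⟨V, hxV, hU.of_hom j, ?_⟩
  let e := LinearEquiv.ofBijective (sumSmul fun i => T.X₃.familiesMap j (T.X₃.stdBasis P i))
    (T.X₃.bijective_stdBasis P j)
  let s := (sumSmul m).comp e.symm.toLinearMap
  have hs : ∀ c, act T.g _ (s c) = c := by
    intro c
    obtain ⟨c, rfl⟩ := e.surjective c
    simp only [s, LinearMap.comp_apply, LinearEquiv.coe_coe, LinearEquiv.symm_apply_apply]
    change act T.g _ (∑ i, c i • m i) = ∑ i, c i • T.X₃.familiesMap j (T.X₃.stdBasis P i)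
    rw [map_sum]
    refine Finset.sum_congr rfl fun k _ => ?_
    rw [map_smul, hm]
  have hinj : Function.Injective (act T.f ((openOver X).obj V)) :=
    injective_app_of_mono ((toModules X).map T.f) V
  have hex : ∀ b, act T.g ((openOver X).obj V) b = 0 → ∃ a, act T.f ((openOver X).obj V) a = b :=
    exists_app_eq_of_exact h V
  have hfg : ∀ a, act T.g ((openOver X).obj V) (act T.f ((openOver X).obj V) a) = 0 := fun a => by
    rw [← act_comp, T.zero]; rfl
  choose r hr using fun b => hex (b - s (act T.g _ b)) (by rw [map_sub, hs, sub_self])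
  refine ⟨{ toFun := r, map_add' := fun a b => hinj ?_, map_smul' := fun c b => hinj ?_ }, s,
    fun a => hinj ?_, hs, fun b => ?_⟩
  · rw [hr, map_add (act T.f _) (r a), hr, hr, map_add, map_add]; abel
  · rw [hr, RingHom.id_apply, map_smul (act T.f _) c (r b), hr, map_smul, map_smul, smul_sub]
  · refine (hr _).trans ?_
    rw [hfg, map_zero, sub_zero]
  · refine (congrArg (· + _) (hr b)).trans ?_
    exact sub_add_cancel _ _

end StdVB

end StandardVB

namespace StandardVB

variable {𝒮 : SmallSchemes.{u}}

namespace StdVB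

variable {X Y Z : 𝒮.Cat}

/-! ### Pullback of standard vector bundles -/

/-- Additive functors that preserve local splittings are exact. -/
lemma isExactFunctor_of_isLocallySplit (F : StdVB X ⥤ StdVB Y) [F.Additive]
    (h : ∀ S : ShortComplex (StdVB X), IsLocallySplit S → IsLocallySplit (S.map F)) :
    IsExactFunctor (stdExact X) (stdExact Y) F where
  additive := inferInstance
  map S hS := ⟨(S.map F).zero, (h S (isLocallySplit_of_stdExact hS)).stdExact⟩

/-- On sections, the pullback of a morphism is the morphism itself. -/
lemma act_inverseImage (f : Y ⟶ X) {E F : StdVB X} (γ : E ⟶ F) (U : Over Y)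
    (s : E.families ((Over.map f).obj U)) :
    act ((inverseImage f).map γ) U (pullFamilies f E U s) =
      pullFamilies f F U (act γ ((Over.map f).obj U) s) :=
  congrArg (fun t => pullFamilies f F U (act γ ((Over.map f).obj U) t))
    ((pullFamilies f E U).symm_apply_apply s)

lemma hom_ext_pull {f : Y ⟶ X} {E : StdVB X} {F : StdVB Y} {γ δ : (inverseImage f).obj E ⟶ F}
    (h : ∀ U s, act γ U (pullFamilies f E U s) = act δ U (pullFamilies f E U s)) : γ = δ :=
  hom_ext_act fun U s => by
    obtain ⟨s, rfl⟩ := (pullFamilies f E U).surjective s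
    exact h U s

instance (f : Y ⟶ X) : (inverseImage f).Additive where
  map_add := hom_ext_pull fun _ _ => rfl

/-- Transport of linear maps on sections along the identification of the sections of `f^* E`. -/
def pullLinear (f : Y ⟶ X) {E F : StdVB X} {U : Over Y}
    (r : E.families ((Over.map f).obj U) →ₗ[(bigO X).obj (op ((Over.map f).obj U))]
      F.families ((Over.map f).obj U)) :
    (pullObj f E).families U →ₗ[(bigO Y).obj (op U)] (pullObj f F).families U where
  toFun b := pullFamilies f F U (r ((pullFamilies f E U).symm b))
  map_add' a b :=
    (congrArg (fun t => pullFamilies f F U (r t)) ((pullFamilies f E U).symm.map_add a b)).trans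
      ((congrArg (pullFamilies f F U) (r.map_add _ _)).trans ((pullFamilies f F U).map_add _ _))
  map_smul' c b := by
    obtain ⟨b, rfl⟩ := (pullFamilies f E U).surjective b
    rw [← pullFamilies_smul, AddEquiv.symm_apply_apply, AddEquiv.symm_apply_apply, map_smul,
      pullFamilies_smul]
    rfl

lemma pullLinear_apply (f : Y ⟶ X) {E F : StdVB X} {U : Over Y}
    (r : E.families ((Over.map f).obj U) →ₗ[(bigO X).obj (op ((Over.map f).obj U))]
      F.families ((Over.map f).obj U)) (s : E.families ((Over.map f).obj U)) :
    pullLinear f r (pullFamilies f E U s) = pullFamilies f F U (r s) := by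
  change pullFamilies f F U (r ((pullFamilies f E U).symm _)) = _
  rw [AddEquiv.symm_apply_apply]

lemma IsSplitAt.pull {T : ShortComplex (StdVB X)} (f : Y ⟶ X) {U : Over Y}
    (h : IsSplitAt T ((Over.map f).obj U)) : IsSplitAt (T.map (inverseImage f)) U := by
  obtain ⟨r, s, h1, h2, h3⟩ := h
  refine ⟨pullLinear f r, pullLinear f s, fun a => ?_, fun c => ?_, fun b => ?_⟩
  · obtain ⟨a, rfl⟩ := (pullFamilies f T.X₁ U).surjective a
    refine (congrArg (pullLinear f r) (act_inverseImage f T.f U a)).trans ?_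
    exact (pullLinear_apply f r _).trans (congrArg _ (h1 a))
  · obtain ⟨c, rfl⟩ := (pullFamilies f T.X₃ U).surjective c
    refine (congrArg (act _ U) (pullLinear_apply f s _)).trans ?_
    exact (act_inverseImage f T.g U _).trans (congrArg _ (h2 c))
  · obtain ⟨b, rfl⟩ := (pullFamilies f T.X₂ U).surjective b
    refine (congrArg₂ (fun a b : (pullObj f T.X₂).families U => a + b)
      ((congrArg (act _ U) (pullLinear_apply f r b)).trans (act_inverseImage f T.f U _))
      ((congrArg (pullLinear f s) (act_inverseImage f T.g U b)).trans
      (pullLinear_apply f s (act T.g _ b)))).trans ?_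
    exact congrArg (pullFamilies f T.X₂ U) (h3 b)

lemma IsLocallySplit.pull {T : ShortComplex (StdVB X)} (f : Y ⟶ X) (h : IsLocallySplit T) :
    IsLocallySplit (T.map (inverseImage f)) := by
  intro y
  obtain ⟨U, hy, hU, hU'⟩ := h (f.hom y)
  let V : (𝒮.scheme Y).Opens := f.hom ⁻¹ᵁ U
  let g : (Over.map f).obj ((openOver Y).obj V) ⟶ (openOver X).obj U :=
    toOpenOver U fun v => by
      change (𝒮.openHom Y V ≫ f).hom v ∈ U
      exact 𝒮.openHom_mem Y V v
  exact ⟨V, hy, hU.of_hom g, (hU'.of_hom hU g).pull f⟩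

/-- Pullback preserves local splittings, hence is exact. -/
theorem isExactFunctor_inverseImage (f : Y ⟶ X) :
    IsExactFunctor (stdExact X) (stdExact Y) (inverseImage f) :=
  isExactFunctor_of_isLocallySplit _ fun _ h => h.pull f

/-- Two standard vector bundles are equal if they have the same sieve, the same ranks and the same
restriction maps. -/
lemma ext_of_cast {A B : StdVB X} (hs : A.sieve = B.sieve)
    (hr : ∀ (V : Over X) (hA : A.sieve V.hom) (hB : B.sieve V.hom),
      A.rank ⟨V, hA⟩ = B.rank ⟨V, hB⟩)
    (hm : ∀ {V W : Over X} (g : W ⟶ V) (hV : A.sieve V.hom) (hV' : B.sieve V.hom)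
      (hW : A.sieve W.hom) (hW' : B.sieve W.hom)
      (c : Fin (B.rank ⟨V, hV'⟩) → (bigO X).obj (op V)) (i : Fin (A.rank ⟨W, hW⟩)),
      A.map (Y := ⟨V, hV⟩) (Z := ⟨W, hW⟩) g (fun k => c (Fin.cast (hr V hV hV') k)) i =
        B.map (Y := ⟨V, hV'⟩) (Z := ⟨W, hW'⟩) g c (Fin.cast (hr W hW hW') i)) : A = B := by
  obtain ⟨H, cov, rank, map, mid, mcomp, bij⟩ := A
  obtain ⟨H', cov', rank', map', mid', mcomp', bij'⟩ := B
  dsimp only at hs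
  subst hs
  have hrank : rank = rank' := funext fun V => hr V.1 V.2 V.2
  subst hrank
  have hmap : @map = @map' := by
    funext V W g
    refine LinearMap.ext fun c => funext fun i => ?_
    exact hm g V.2 V.2 W.2 W.2 c i
  subst hmap
  rfl

/-- The action of `eqToHom` on sections only transports components along equal indices. -/
lemma act_eqToHom {A B : StdVB X} (h : A = B) (U : Over X) (s : A.families U)
    (V : SieveObj B.sieve) (v : V.1 ⟶ U) (hV : A.sieve V.1.hom)
    (hr : B.rank V = A.rank ⟨V.1, hV⟩) (i) :
    (act (eqToHom h) U s).1 V v i = s.1 ⟨V.1, hV⟩ v (Fin.cast hr i) := by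
  subst h
  rfl

/-- The components of a section depend only on the underlying objects and morphisms. The
equalities of objects that occur hold in `Over X` only propositionally, hence the heterogeneous
equality. -/
lemma families_val_congr {E : StdVB X} {U : Over X} (s : E.families U) {P P' : SieveObj E.sieve}
    (h : P = P') (p : P.1 ⟶ U) (p' : P'.1 ⟶ U) (hp : HEq p.left p'.left)
    (hr : E.rank P = E.rank P') (i : Fin (E.rank P)) :
    HEq (s.1 P p i) (s.1 P' p' (Fin.cast hr i)) := by
  subst h
  obtain rfl : p = p' := by ext1; exact eq_of_heq hp
  rfl

/-- The restriction maps depend only on the underlying objects and morphisms. -/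
lemma map_congr {E : StdVB X} {P P' Q Q' : SieveObj E.sieve} (h : P = P') (h' : Q = Q')
    (p : Q.1 ⟶ P.1) (p' : Q'.1 ⟶ P'.1) (hp : HEq p.left p'.left) (hP : E.rank P = E.rank P')
    (hQ : E.rank Q = E.rank Q') (c : Fin (E.rank P) → (bigO X).obj (op P.1))
    (c' : Fin (E.rank P') → (bigO X).obj (op P'.1)) (hc : ∀ i, HEq (c i) (c' (Fin.cast hP i)))
    (i : Fin (E.rank Q)) : HEq (E.map p c i) (E.map p' c' (Fin.cast hQ i)) := by
  subst h h'
  obtain rfl : p = p' := by ext1; exact eq_of_heq hp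
  obtain rfl : c = c' := funext fun i => eq_of_heq (hc i)
  rfl

lemma overMap_comp_obj (f : Y ⟶ X) (g : Z ⟶ Y) (V : Over Z) :
    (Over.map (g ≫ f)).obj V = (Over.map f).obj ((Over.map g).obj V) :=
  congrArg (fun h => Over.mk (Y := V.left) h) (Category.assoc V.hom g f).symm

lemma pullObj_comp (f : Y ⟶ X) (g : Z ⟶ Y) (E : StdVB X) :
    pullObj (g ≫ f) E = pullObj g (pullObj f E) := by
  have hobj : ∀ (V : Over Z) (h : (E.sieve.pullback (g ≫ f)) V.hom)
      (h' : ((E.sieve.pullback f).pullback g) V.hom),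
      pushObj (g ≫ f) E.sieve ⟨V, h⟩ = pushObj f E.sieve (pushObj g (E.sieve.pullback f) ⟨V, h'⟩) :=
    fun V h h' => Subtype.ext (overMap_comp_obj f g V)
  refine ext_of_cast (Sieve.pullback_comp E.sieve) (fun V hA hB => congrArg E.rank (hobj V hA hB))
    fun {V W} h hV hV' hW hW' c i => ?_
  have h1 := map_congr (E := E) (hobj V hV hV') (hobj W hW hW') ((Over.map (g ≫ f)).map h)
    ((Over.map f).map ((Over.map g).map h)) HEq.rfl (congrArg E.rank (hobj V hV hV'))
    (congrArg E.rank (hobj W hW hW')) (fun k => c (Fin.cast (congrArg E.rank (hobj V hV hV')) k)) c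
    (fun _ => HEq.rfl) i
  exact eq_of_heq h1

/-- The canonical map from `f_! g_! U` to `(g ≫ f)_! U`. -/
def overMapCompHom (f : Y ⟶ X) (g : Z ⟶ Y) (U : Over Z) :
    (Over.map f).obj ((Over.map g).obj U) ⟶ (Over.map (g ≫ f)).obj U :=
  Over.homMk (𝟙 U.left) (by simp)

/-- The identification of `(g ≫ f)^* E` with `g^* f^* E` on sections. -/
lemma act_eqToHom_pull (f : Y ⟶ X) (g : Z ⟶ Y) (E : StdVB X) (U : Over Z)
    (s : E.families ((Over.map (g ≫ f)).obj U)) :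
    act (eqToHom (pullObj_comp f g E)) U (pullFamilies (g ≫ f) E U s) =
      pullFamilies g _ U (pullFamilies f E _ (E.familiesMap (overMapCompHom f g U) s)) := by
  refine families_ext fun V v => funext fun i => ?_
  have hV : (E.sieve.pullback (g ≫ f)) V.1.hom := by
    rw [Sieve.pullback_comp]; exact V.2
  have hP : pushObj f E.sieve (pushObj g (E.sieve.pullback f) V) =
      pushObj (g ≫ f) E.sieve ⟨V.1, hV⟩ := Subtype.ext (overMap_comp_obj f g V.1).symm
  refine (act_eqToHom (A := pullObj (g ≫ f) E) (B := pullObj g (pullObj f E)) _ U _ V v hV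
    (show E.rank _ = E.rank _ from congrArg E.rank hP) i).trans ?_
  exact eq_of_heq (families_val_congr s hP _ _ (heq_of_eq (Category.comp_id v.left)) _ i).symm

/-- Pullback is strictly functorial: on objects both sides have the same sieve, ranks and
restriction maps, and the resulting transport agrees on sections with the canonical
identification. -/
theorem inverseImage_comp (f : Y ⟶ X) (g : Z ⟶ Y) :
    inverseImage (g ≫ f) = inverseImage f ⋙ inverseImage g := by
  refine CategoryTheory.Functor.ext (fun E => pullObj_comp f g E) fun E F γ => ?_
  have key : (inverseImage (g ≫ f)).map γ ≫ eqToHom (pullObj_comp f g F) =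
      eqToHom (pullObj_comp f g E) ≫ (inverseImage g).map ((inverseImage f).map γ) := by
    refine hom_ext_pull fun U s => ?_
    have e1 := act_inverseImage (g ≫ f) γ U s
    have e2 := act_eqToHom_pull f g F U (act γ _ s)
    have e3 := act_eqToHom_pull f g E U s
    have e4 := act_inverseImage g ((inverseImage f).map γ) U
      (pullFamilies f E _ (E.familiesMap (overMapCompHom f g U) s))
    have e5 := act_inverseImage f γ _ (E.familiesMap (overMapCompHom f g U) s)
    rw [act_familiesMap] at e5
    exact ((congrArg (act (eqToHom (pullObj_comp f g F)) U) e1).trans e2).trans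
      (((congrArg (act ((inverseImage g).map ((inverseImage f).map γ)) U) e3).trans e4).trans
        (congrArg (pullFamilies g (pullObj f F) U) e5)).symm
  have h : eqToHom (pullObj_comp f g F) ≫ eqToHom (pullObj_comp f g F).symm =
      𝟙 (pullObj (g ≫ f) F) := by simp
  exact ((Category.comp_id _).symm.trans ((congrArg ((inverseImage (g ≫ f)).map γ ≫ ·)
    h.symm).trans ((Category.assoc _ _ _).symm.trans
    (congrArg (· ≫ eqToHom (pullObj_comp f g F).symm) key)))).trans (Category.assoc _ _ _)

end StdVB

end StandardVB

namespace StandardVB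

variable {𝒮 : SmallSchemes.{u}}

namespace StdVB

variable {X : 𝒮.Cat}

/-! ### Tensor products of standard vector bundles -/

section

variable {C : Type u} [SmallCategory C] {J : GrothendieckTopology C} (R : Sheaf J RingCat.{u})
  {P Q : PresheafOfModules.{u} R.obj} {M N : SheafOfModules.{u} R}

lemma assocDesc_eq (f : P ⟶ M.val) : assocDesc R f =
    ((PresheafOfModules.sheafificationAdjunction (𝟙 R.obj)).homEquiv P M).symm f := by
  refine (Equiv.eq_symm_apply _).2 ?_
  exact (PresheafOfModules.sheafificationHomEquiv (𝟙 R.obj)).apply_symm_apply f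

/-- Naturality of `assocDesc` in the target. -/
lemma assocDesc_comp (f : P ⟶ M.val) (g : M ⟶ N) :
    assocDesc R f ≫ g = assocDesc R (f ≫ g.val) := by
  rw [assocDesc_eq, assocDesc_eq]
  exact ((PresheafOfModules.sheafificationAdjunction (𝟙 R.obj)).homEquiv_naturality_right_symm
    f g).symm

/-- Naturality of `assocDesc` in the source. -/
lemma assocSheaf_map_comp (p : Q ⟶ P) (f : P ⟶ M.val) :
    (assocSheaf R).map p ≫ assocDesc R f = assocDesc R (p ≫ f) := by
  rw [assocDesc_eq, assocDesc_eq]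
  exact ((PresheafOfModules.sheafificationAdjunction (𝟙 R.obj)).homEquiv_naturality_left_symm
    (Y := M) p f).symm

lemma assocDesc_injective {f g : P ⟶ M.val} (h : assocDesc R f = assocDesc R g) : f = g :=
  (PresheafOfModules.sheafificationHomEquiv (𝟙 R.obj)).symm.injective h

end

section

variable {E E' F F' G : StdVB X}

lemma liftFunctor_map {C : Type*} [Category* C] (F : C ⥤ BigModules X) (G : C → StdVB X)
    (a : ∀ c, F.obj c ≅ (G c).xi) {c d : C} (g : c ⟶ d) :
    (a c).hom ≫ (xiFunctor X).map ((liftFunctor F G a).map g) = F.map g ≫ (a d).hom :=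
  (a c).hom_inv_id_assoc _

variable (X) in
/-- The presheaf tensor product of `ξ E` and `ξ F`, as a functor of `(E, F)`. -/
noncomputable def preTensor : StdVB X × StdVB X ⥤ PreMod X :=
  Functor.prod (xiFunctor X ⋙ SheafOfModules.forget _) (xiFunctor X ⋙ SheafOfModules.forget _) ⋙
    MonoidalCategory.tensor (PreMod X)

/-- The pairing `tensorPairing`, with its source as a value of `preTensor`. -/
noncomputable def pairing (A : StdVB X × StdVB X) :
    (preTensor X).obj A ⟶ (tensorObj A.1 A.2).xi.val :=
  tensorPairing A.1 A.2

lemma sheafTensor_map_comp {A B : StdVB X × StdVB X} (f : A ⟶ B) :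
    (sheafTensor X).map f ≫ (sheafTensorIso B).hom =
      (assocSheaf (bigRing X)).map ((preTensor X).map f) ≫ assocDesc (bigRing X) (pairing B) :=
  rfl

lemma assocDesc_pairing_comp {A B : StdVB X × StdVB X} (f : A ⟶ B) :
    assocDesc (bigRing X) (pairing A) ≫ (xiFunctor X).map ((tensor X).map f) =
      (sheafTensor X).map f ≫ (sheafTensorIso B).hom :=
  liftFunctor_map (sheafTensor X) (fun A => tensorObj A.1 A.2) sheafTensorIso f

/-- The defining property of the tensor product of morphisms, transported along the adjunction
between sheafification and the forgetful functor. -/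
lemma pairing_naturality {A B : StdVB X × StdVB X} (f : A ⟶ B) :
    pairing A ≫ ((xiFunctor X).map ((tensor X).map f)).val = (preTensor X).map f ≫ pairing B := by
  refine assocDesc_injective (bigRing X) ?_
  refine (assocDesc_comp (bigRing X) (pairing A)
    ((xiFunctor X).map ((tensor X).map f))).symm.trans ?_
  refine Eq.trans ?_ (assocSheaf_map_comp (bigRing X) ((preTensor X).map f) (pairing B))
  exact (assocDesc_pairing_comp f).trans (sheafTensor_map_comp f)

/-- On sections, the tensor product of morphisms is the tensor product of linear maps. -/
lemma act_tensor_mul (γ : E ⟶ E') (δ : F ⟶ F') (U : Over X) (s : E.families U)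
    (t : F.families U) : act ((tensor X).map (Prod.mkHom γ δ)) U (mulFamilies E F U s t) =
      mulFamilies E' F' U (act γ U s) (act δ U t) :=
  congr((ConcreteCategory.hom ($(pairing_naturality (Prod.mkHom γ δ)).app (op U)))
    (TensorProduct.tmul ((bigO X).obj (op U)) s t))

end

end StdVB

end StandardVB

namespace StandardVB

variable {𝒮 : SmallSchemes.{u}}

namespace StdVB

variable {X : 𝒮.Cat} {E E' E'' F F' F'' G : StdVB X}

/-- The tensor product of two morphisms, with its source and target written as `tensorObj`. -/
noncomputable def tensorMor (γ : E ⟶ E') (δ : F ⟶ F') : tensorObj E F ⟶ tensorObj E' F' :=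
  (tensor X).map (Prod.mkHom γ δ)

lemma act_tensorMor (γ : E ⟶ E') (δ : F ⟶ F') (U : Over X) (s : E.families U)
    (t : F.families U) : act (tensorMor γ δ) U (mulFamilies E F U s t) =
      mulFamilies E' F' U (act γ U s) (act δ U t) :=
  act_tensor_mul γ δ U s t

/-- Linear maps on the sections of `ξ (E ⊗ F)` over an object of both sieves are determined by their
values on products. -/
lemma linear_ext_mul {V : Over X} (hE : E.sieve V.hom) (hF : F.sieve V.hom) {K : Type*}
    [AddCommGroup K] [Module ((bigO X).obj (op V)) K]
    {f g : (tensorObj E F).families V →ₗ[(bigO X).obj (op V)] K}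
    (h : ∀ s t, f (mulFamilies E F V s t) = g (mulFamilies E F V s t)) : f = g := by
  have hb := bijective_lift_mulFamilies E F ⟨V, hE, hF⟩
  have h1 : f ∘ₗ TensorProduct.lift (mulFamilies E F V) =
      g ∘ₗ TensorProduct.lift (mulFamilies E F V) := TensorProduct.ext' h
  refine LinearMap.ext fun x => ?_
  obtain ⟨y, rfl⟩ := hb.2 x
  exact LinearMap.congr_fun h1 y

/-- Every object over `X` is covered by objects of any given covering sieve. -/
lemma pullback_mem {H : Sieve X} (hH : H ∈ 𝒮.zariski X) (U : Over X) :
    (Sieve.overEquiv U).symm (H.pullback U.hom) ∈ bigTopology X U := by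
  rw [GrothendieckTopology.mem_over_iff, OrderIso.apply_symm_apply]
  exact 𝒮.zariski.pullback_stable _ hH

lemma mem_of_pullback {H : Sieve X} {U V : Over X} {j : V ⟶ U}
    (hj : (Sieve.overEquiv U).symm (H.pullback U.hom) j) : H V.hom := by
  rw [Sieve.overEquiv_symm_iff] at hj
  rw [← Over.w j]
  exact hj

/-- Morphisms are equal if they agree on sections over the objects of a covering sieve. -/
lemma hom_ext_of_cover {γ δ : E ⟶ F} {H : Sieve X} (hH : H ∈ 𝒮.zariski X)
    (h : ∀ V : Over X, H V.hom → ∀ s, act γ V s = act δ V s) : γ = δ :=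
  hom_ext_act fun U s => families_ext_of_cover (pullback_mem hH U) fun V j hj => by
    rw [← act_familiesMap, ← act_familiesMap]
    exact h V (mem_of_pullback hj) _

/-- Morphisms out of a tensor product are determined by their values on products of sections. -/
lemma hom_ext_mul {γ δ : tensorObj E F ⟶ G}
    (h : ∀ V s t, act γ V (mulFamilies E F V s t) = act δ V (mulFamilies E F V s t)) :
    γ = δ :=
  hom_ext_of_cover (tensorObj E F).covers fun V hV =>
    LinearMap.congr_fun (linear_ext_mul hV.1 hV.2 (h V))

/-- The tensor product of linear maps on sections over an object of the sieves. -/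
lemma exists_tensor_linear {V : Over X} (hE : E.sieve V.hom) (hF : F.sieve V.hom)
    (r : E.families V →ₗ[(bigO X).obj (op V)] E'.families V)
    (r' : F.families V →ₗ[(bigO X).obj (op V)] F'.families V) :
    ∃ f : (tensorObj E F).families V →ₗ[(bigO X).obj (op V)] (tensorObj E' F').families V,
      ∀ s t, f (mulFamilies E F V s t) = mulFamilies E' F' V (r s) (r' t) := by
  let e := LinearEquiv.ofBijective _ (bijective_lift_mulFamilies E F ⟨V, hE, hF⟩)
  refine ⟨TensorProduct.lift (mulFamilies E' F' V) ∘ₗ TensorProduct.map r r' ∘ₗ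
    e.symm.toLinearMap, fun s t => ?_⟩
  have h : e.symm (mulFamilies E F V s t) = TensorProduct.tmul ((bigO X).obj (op V)) s t :=
    e.symm_apply_apply (TensorProduct.tmul ((bigO X).obj (op V)) s t)
  exact congrArg (fun z => TensorProduct.lift (mulFamilies E' F' V) (TensorProduct.map r r' z)) h

lemma tensorMor_add_left (γ γ' : E ⟶ E') (δ : F ⟶ F') :
    tensorMor (γ + γ') δ = tensorMor γ δ + tensorMor γ' δ :=
  hom_ext_mul fun V s t => by
    rw [act_add, act_tensorMor, act_tensorMor, act_tensorMor, act_add, LinearMap.map_add₂]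

lemma tensorMor_add_right (γ : E ⟶ E') (δ δ' : F ⟶ F') :
    tensorMor γ (δ + δ') = tensorMor γ δ + tensorMor γ δ' :=
  hom_ext_mul fun V s t => by
    rw [act_add, act_tensorMor, act_tensorMor, act_tensorMor, act_add, map_add]

lemma tensorMor_id : tensorMor (𝟙 E) (𝟙 F) = 𝟙 (tensorObj E F) :=
  hom_ext_mul fun V s t => act_tensorMor (𝟙 E) (𝟙 F) V s t

lemma tensorMor_comp (γ : E ⟶ E') (γ' : E' ⟶ E'') (δ : F ⟶ F') (δ' : F' ⟶ F'') :
    tensorMor (γ ≫ γ') (δ ≫ δ') = tensorMor γ δ ≫ tensorMor γ' δ' :=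
  hom_ext_mul fun V s t => by
    rw [act_comp, act_tensorMor, act_tensorMor, act_tensorMor, act_comp, act_comp]

/-- The functor `- ⊗ E`. -/
noncomputable def tensorRight (E : StdVB X) : StdVB X ⥤ StdVB X where
  obj F := tensorObj F E
  map γ := tensorMor γ (𝟙 E)
  map_id _ := tensorMor_id
  map_comp γ γ' := by rw [← tensorMor_comp, Category.comp_id]

/-- The functor `E ⊗ -`. -/
noncomputable def tensorLeft (E : StdVB X) : StdVB X ⥤ StdVB X where
  obj F := tensorObj E F
  map γ := tensorMor (𝟙 E) γ
  map_id _ := tensorMor_id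
  map_comp γ γ' := by rw [← tensorMor_comp, Category.comp_id]

lemma sectL_comp_tensor (E : StdVB X) : Prod.sectL (StdVB X) E ⋙ tensor X = tensorRight E :=
  CategoryTheory.Functor.hext (fun _ => rfl) fun _ _ _ => HEq.rfl

lemma sectR_comp_tensor (E : StdVB X) : Prod.sectR E (StdVB X) ⋙ tensor X = tensorLeft E :=
  CategoryTheory.Functor.hext (fun _ => rfl) fun _ _ _ => HEq.rfl

instance (E : StdVB X) : (tensorRight E).Additive where
  map_add := tensorMor_add_left _ _ (𝟙 E)

instance (E : StdVB X) : (tensorLeft E).Additive where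
  map_add := tensorMor_add_right (𝟙 E) _ _

/-- A splitting stays one after tensoring with the identity on the right. -/
lemma IsSplitAt.tensorRight {T : ShortComplex (StdVB X)} {V : Over X} (h : IsSplitAt T V)
    (hT : InSieves T V) (hE : E.sieve V.hom) :
    IsSplitAt (T.map (tensorRight E)) V := by
  obtain ⟨r, s, h1, h2, h3⟩ := h
  obtain ⟨r', hr'⟩ := exists_tensor_linear hT.2.1 hE r LinearMap.id
  obtain ⟨s', hs'⟩ := exists_tensor_linear hT.2.2 hE s LinearMap.id
  let f := act (tensorMor T.f (𝟙 E)) V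
  let g := act (tensorMor T.g (𝟙 E)) V
  have hf : ∀ a t, f (mulFamilies T.X₁ E V a t) = mulFamilies T.X₂ E V (act T.f V a) t :=
    act_tensorMor T.f (𝟙 E) V
  have hg : ∀ a t, g (mulFamilies T.X₂ E V a t) = mulFamilies T.X₃ E V (act T.g V a) t :=
    act_tensorMor T.g (𝟙 E) V
  refine ⟨r', s', LinearMap.congr_fun (f := r' ∘ₗ f) (g := LinearMap.id)
    (linear_ext_mul hT.1 hE fun a t => ?_), LinearMap.congr_fun (f := g ∘ₗ s')
    (g := LinearMap.id) (linear_ext_mul hT.2.2 hE fun a t => ?_), LinearMap.congr_fun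
    (f := f ∘ₗ r' + s' ∘ₗ g) (g := LinearMap.id) (linear_ext_mul hT.2.1 hE fun a t => ?_)⟩
  · exact (congrArg r' (hf a t)).trans
      ((hr' _ t).trans (congrArg (mulFamilies T.X₁ E V · t) (h1 a)))
  · exact (congrArg g (hs' a t)).trans ((hg _ t).trans (congrArg (mulFamilies T.X₃ E V · t) (h2 a)))
  · refine (congrArg₂ (fun a b : (tensorObj T.X₂ E).families V => a + b)
      ((congrArg f (hr' a t)).trans (hf _ t)) ((congrArg s' (hg a t)).trans (hs' _ t))).trans ?_
    exact (LinearMap.map_add₂ (mulFamilies T.X₂ E V) _ _ t).symm.trans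
      (congrArg (mulFamilies T.X₂ E V · t) (h3 a))

/-- A splitting stays one after tensoring with the identity on the left. -/
lemma IsSplitAt.tensorLeft {T : ShortComplex (StdVB X)} {V : Over X} (h : IsSplitAt T V)
    (hT : InSieves T V) (hE : E.sieve V.hom) :
    IsSplitAt (T.map (tensorLeft E)) V := by
  obtain ⟨r, s, h1, h2, h3⟩ := h
  obtain ⟨r', hr'⟩ := exists_tensor_linear hE hT.2.1 LinearMap.id r
  obtain ⟨s', hs'⟩ := exists_tensor_linear hE hT.2.2 LinearMap.id s
  let f := act (tensorMor (𝟙 E) T.f) V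
  let g := act (tensorMor (𝟙 E) T.g) V
  have hf : ∀ t a, f (mulFamilies E T.X₁ V t a) = mulFamilies E T.X₂ V t (act T.f V a) :=
    act_tensorMor (𝟙 E) T.f V
  have hg : ∀ t a, g (mulFamilies E T.X₂ V t a) = mulFamilies E T.X₃ V t (act T.g V a) :=
    act_tensorMor (𝟙 E) T.g V
  refine ⟨r', s', LinearMap.congr_fun (f := r' ∘ₗ f) (g := LinearMap.id)
    (linear_ext_mul hE hT.1 fun t a => ?_), LinearMap.congr_fun (f := g ∘ₗ s')
    (g := LinearMap.id) (linear_ext_mul hE hT.2.2 fun t a => ?_), LinearMap.congr_fun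
    (f := f ∘ₗ r' + s' ∘ₗ g) (g := LinearMap.id) (linear_ext_mul hE hT.2.1 fun t a => ?_)⟩
  · exact (congrArg r' (hf t a)).trans ((hr' t _).trans (congrArg (mulFamilies E T.X₁ V t) (h1 a)))
  · exact (congrArg g (hs' t a)).trans ((hg t _).trans (congrArg (mulFamilies E T.X₃ V t) (h2 a)))
  · refine (congrArg₂ (fun a b : (tensorObj E T.X₂).families V => a + b)
      ((congrArg f (hr' t a)).trans (hf t _)) ((congrArg s' (hg t a)).trans (hs' t _))).trans ?_
    exact (map_add (mulFamilies E T.X₂ V t) _ _).symm.trans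
      (congrArg (mulFamilies E T.X₂ V t) (h3 a))

/-- A locally split sequence splits, locally, over objects of any given covering sieve. -/
lemma IsLocallySplit.exists_mem {T : ShortComplex (StdVB X)} (h : IsLocallySplit T) {H : Sieve X}
    (hH : H ∈ 𝒮.zariski X) (x : 𝒮.scheme X) : ∃ U : (𝒮.scheme X).Opens, x ∈ U ∧
      H ((openOver X).obj U).hom ∧ InSieves T ((openOver X).obj U) ∧
      IsSplitAt T ((openOver X).obj U) := by
  obtain ⟨U, hx, hU, hU'⟩ := h x
  obtain ⟨V, hx', hV⟩ := exists_open_mem hH x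
  let i := (openOver X).map (homOfLE (inf_le_left : U ⊓ V ≤ U))
  exact ⟨U ⊓ V, ⟨hx, hx'⟩, sieve_openOver_of_le inf_le_right hV, hU.of_hom i, hU'.of_hom hU i⟩

/-- `- ⊗ E` preserves local splittings, hence is exact. -/
theorem isExactFunctor_tensorRight (E : StdVB X) :
    IsExactFunctor (stdExact X) (stdExact X) (Prod.sectL (StdVB X) E ⋙ tensor X) := by
  rw [sectL_comp_tensor]
  exact isExactFunctor_of_isLocallySplit _ fun T hT x => by
    obtain ⟨U, hx, hE, hU, hU'⟩ := hT.exists_mem E.covers x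
    exact ⟨U, hx, ⟨⟨hU.1, hE⟩, ⟨hU.2.1, hE⟩, ⟨hU.2.2, hE⟩⟩, hU'.tensorRight hU hE⟩

/-- `E ⊗ -` preserves local splittings, hence is exact. -/
theorem isExactFunctor_tensorLeft (E : StdVB X) :
    IsExactFunctor (stdExact X) (stdExact X) (Prod.sectR E (StdVB X) ⋙ tensor X) := by
  rw [sectR_comp_tensor]
  exact isExactFunctor_of_isLocallySplit _ fun T hT x => by
    obtain ⟨U, hx, hE, hU, hU'⟩ := hT.exists_mem E.covers x
    exact ⟨U, hx, ⟨⟨hE, hU.1⟩, ⟨hE, hU.2.1⟩, ⟨hE, hU.2.2⟩⟩, hU'.tensorLeft hU hE⟩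

/-! ### The zero bundle -/

lemma isZero_of_rank_eq_zero (h : ∀ P, E.rank P = 0) : IsZero E := by
  rw [IsZero.iff_id_eq_zero]
  refine hom_ext_act fun U s => families_ext fun V v => funext fun i => ?_
  exact (Fin.cast (h V) i).elim0

lemma isZero_zeroBundle : IsZero (zeroBundle X) := isZero_of_rank_eq_zero fun _ => rfl

lemma isZero_restrict_zeroBundle (K : Sieve X) (hK : K ∈ 𝒮.zariski X) :
    IsZero ((zeroBundle X).restrict K hK le_top) := isZero_of_rank_eq_zero fun _ => rfl

/-- Both sides have rank `0` on the objects of the sieve of `E`, so there is no further condition on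
their restriction maps. -/
lemma zeroBundle_tensor (E : StdVB X) : (tensor X).obj (zeroBundle X, E) =
    (zeroBundle X).restrict E.sieve E.covers le_top :=
  ext_of_cast (top_inf_eq E.sieve) (fun _ _ _ => Nat.zero_mul _)
    fun _ _ _ _ hW' _ i => (Fin.cast (Nat.zero_mul (E.rank ⟨_, hW'⟩)) i).elim0

lemma tensor_zeroBundle (E : StdVB X) : (tensor X).obj (E, zeroBundle X) =
    (zeroBundle X).restrict E.sieve E.covers le_top :=
  ext_of_cast (inf_top_eq E.sieve) (fun _ _ _ => rfl) fun _ _ _ _ _ _ i => i.elim0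

end StdVB

end StandardVB

namespace StandardVB

variable {𝒮 : SmallSchemes.{u}}

namespace StdVB

variable {X : 𝒮.Cat} {E F : StdVB X}

/-! ### `Φ` is fully faithful -/

/-- Compatible sections of `ξ F` over the objects of a covering sieve glue. -/
lemma exists_glue {U : Over X} {T : Sieve U} (hT : T ∈ bigTopology X U)
    (s : ∀ (V : Over X) (j : V ⟶ U), T j → F.families V)
    (h : ∀ (V : Over X) (j : V ⟶ U) (hj : T j) (W : Over X) (g : W ⟶ V),
      F.familiesMap g (s V j hj) = s W (g ≫ j) (T.downward_closed hj g)) :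
    ∃ t : F.families U, ∀ (V : Over X) (j : V ⟶ U) (hj : T j), F.familiesMap j t = s V j hj := by
  have hF := F.isSheaf_familiesAb
  rw [Presheaf.isSheaf_iff_isSheaf_forget _ _ (forget Ab), isSheaf_iff_isSheaf_of_type] at hF
  obtain ⟨t, ht, -⟩ := hF T hT (fun V j hj => s V j hj) (by
    intro Y₁ Y₂ V g₁ g₂ f₁ f₂ h₁ h₂ e
    refine (h Y₁ f₁ h₁ V g₁).trans (Eq.trans ?_ (h Y₂ f₂ h₂ V g₂).symm)
    congr 1)
  exact ⟨t, fun V j hj => ht j hj⟩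

/-- Morphisms of standard vector bundles can be defined on the objects of a covering sieve. -/
lemma exists_hom_of_cover {H : Sieve X} (hH : H ∈ 𝒮.zariski X)
    (f : ∀ V : Over X, H V.hom → E.families V →ₗ[(bigO X).obj (op V)] F.families V)
    (hf : ∀ (V : Over X) (hV : H V.hom) (W : Over X) (hW : H W.hom) (g : W ⟶ V)
      (s : E.families V), f W hW (E.familiesMap g s) = F.familiesMap g (f V hV s)) :
    ∃ γ : E ⟶ F, ∀ (V : Over X) (hV : H V.hom) (s : E.families V), act γ V s = f V hV s := by
  choose t ht using fun (U : Over X) (s : E.families U) =>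
    exists_glue (F := F) (pullback_mem hH U)
      (fun V j hj => f V (mem_of_pullback hj) (E.familiesMap j s)) (fun V j hj W g => by
        rw [← hf V _ W (sieve_comp H (mem_of_pullback hj) g), familiesMap_comp])
  have hu : ∀ (U : Over X) (a b : F.families U), (∀ (V : Over X) (j : V ⟶ U), H V.hom →
      F.familiesMap j a = F.familiesMap j b) → a = b := fun U a b h =>
    families_ext_of_cover (pullback_mem hH U) fun V j hj => h V j (mem_of_pullback hj)
  have hm : ∀ {U V : Over X} (j : V ⟶ U), H V.hom →
      (Sieve.overEquiv U).symm (H.pullback U.hom) j := fun {U V} j h => by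
    rw [Sieve.overEquiv_symm_iff]
    change H (j.left ≫ U.hom)
    rwa [Over.w j]
  have ht' : ∀ {U V : Over X} (s : E.families U) (j : V ⟶ U) (h : H V.hom),
      F.familiesMap j (t U s) = f V h (E.familiesMap j s) := fun s j h => ht _ s _ j (hm j h)
  let φ : ∀ U : Over X, E.families U →ₗ[(bigO X).obj (op U)] F.families U := fun U =>
    { toFun := t U
      map_add' := fun a b => hu U _ _ fun V j hV => by
        rw [map_add, ht' _ j hV, ht' _ j hV, ht' _ j hV, map_add, map_add]
      map_smul' := fun c a => hu U _ _ fun V j hV => by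
        rw [RingHom.id_apply, familiesMap_smul, ht' _ j hV, ht' _ j hV, familiesMap_smul,
          map_smul] }
  refine ⟨homOfAct φ fun {U V} g s => hu V _ _ fun W j hW => ?_, fun V hV s => ?_⟩
  · refine (ht' _ j hW).trans (Eq.trans ?_ (F.familiesMap_comp g j _).symm)
    rw [familiesMap_comp]
    exact (ht' s (j ≫ g) hW).symm
  · refine (F.familiesMap_id _).symm.trans ((ht' s (𝟙 V) hV).trans ?_)
    rw [familiesMap_id]

/-- The schemes over `X` that map to an open subscheme in a sieve `H`. -/
def smallSieve (H : Sieve X) : Sieve X where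
  arrows _ f := ∃ W : (𝒮.scheme X).Opens, H ((openOver X).obj W).hom ∧ ∀ y, f.hom y ∈ W
  downward_closed := by
    rintro _ _ f ⟨W, hW, hf⟩ g
    exact ⟨W, hW, fun y => hf (g.hom y)⟩

lemma smallSieve_covers {H : Sieve X} (hH : H ∈ 𝒮.zariski X) : smallSieve H ∈ 𝒮.zariski X := by
  intro x
  obtain ⟨W, hx, hW⟩ := exists_open_mem hH x
  exact ⟨_, 𝒮.openHom X W, ⟨W, hW, 𝒮.openHom_mem X W⟩, inferInstance, exists_mem_openHom W x hx⟩

lemma appLE_bijective {V Y : Scheme.{u}} (j : V ⟶ Y) [IsOpenImmersion j] (U : Y.Opens)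
    (hU : j ''ᵁ ⊤ = U) (e) : Function.Bijective (j.appLE U ⊤ e) := by
  subst hU
  rw [← Scheme.Hom.appIso_hom']
  exact (j.appIso ⊤).commRingCatIsoToRingEquiv.bijective

lemma openRes_bijective (U : (𝒮.scheme X).Opens) : Function.Bijective (openRes U) :=
  appLE_bijective _ _ ((Scheme.Hom.image_top_eq_opensRange _).trans (𝒮.openHom_range X U)) _

/-- A morphism `Φ E ⟶ Φ F` on sections over an open subset. -/
noncomputable def smallAct (β : (toModules X).obj E ⟶ (toModules X).obj F)
    (W : (𝒮.scheme X).Opens) : E.families ((openOver X).obj W) →ₗ[(bigO X).obj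
      (op ((openOver X).obj W))] F.families ((openOver X).obj W) where
  toFun := β.app W
  map_add' := map_add (β.app W).hom
  map_smul' c s := by
    obtain ⟨r, rfl⟩ := (openRes_bijective W).2 c
    exact (β.val.app (op W)).hom.map_smul r s

lemma smallAct_res (β : (toModules X).obj E ⟶ (toModules X).obj F) {V W : (𝒮.scheme X).Opens}
    (i : V ⟶ W) (s : E.families ((openOver X).obj W)) :
    smallAct β V (E.familiesMap ((openOver X).map i) s) =
      F.familiesMap ((openOver X).map i) (smallAct β W s) :=
  app_naturality β i s

lemma familiesMap_toOpenOver {R : Over X} {V W : (𝒮.scheme X).Opens} (i : V ⟶ W)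
    (r : R ⟶ (openOver X).obj V) (r' : R ⟶ (openOver X).obj W)
    (s : E.families ((openOver X).obj W)) :
    E.familiesMap r (E.familiesMap ((openOver X).map i) s) = E.familiesMap r' s := by
  rw [familiesMap_comp]
  exact congrArg (fun g => E.familiesMap g s) (over_openHom_ext _ r')

/-- A morphism `β : Φ E ⟶ Φ F` has exactly one linear extension to the sections over a scheme that
maps to an open subscheme in the sieve of `E`, since the sections of `E` there are obtained by base
change. -/
lemma exists_extension (β : (toModules X).obj E ⟶ (toModules X).obj F) (R : Over X)
    (hR : smallSieve E.sieve R.hom) :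
    ∃ f : E.families R →ₗ[(bigO X).obj (op R)] F.families R,
      ∀ (W : (𝒮.scheme X).Opens) (r : R ⟶ (openOver X).obj W) (m),
        f (E.familiesMap r m) = F.familiesMap r (smallAct β W m) := by
  obtain ⟨W₀, hW₀, h₀⟩ := hR
  let r₀ : R ⟶ (openOver X).obj W₀ := toOpenOver W₀ h₀
  have b₀ := E.isFreeBaseChange_of_mem hW₀ r₀
  obtain ⟨f, hf⟩ := b₀.exists_extension ((F.resLin r₀).comp (smallAct β W₀))
  refine ⟨f, fun W r m => ?_⟩
  have h : ∀ v : 𝒮.scheme R.left, R.hom.hom v ∈ W := fun v => by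
    rw [← Over.w r]
    exact 𝒮.openHom_mem X W _
  let r₁ : R ⟶ (openOver X).obj (W ⊓ W₀) := toOpenOver _ fun v => ⟨h v, h₀ v⟩
  let i : W ⊓ W₀ ⟶ W := homOfLE inf_le_left
  let i₀ : W ⊓ W₀ ⟶ W₀ := homOfLE inf_le_right
  obtain ⟨f₁, hf₁⟩ := (E.isFreeBaseChange_of_mem (sieve_openOver_of_le inf_le_right hW₀)
    r₁).exists_extension ((F.resLin r₁).comp (smallAct β _))
  -- The maps obtained from `W₀` and from `W ⊓ W₀` agree.
  have key : f = f₁ := b₀.ext fun m => by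
    refine (hf m).trans (Eq.trans ?_ (congrArg f₁ (familiesMap_toOpenOver i₀ r₁ r₀ m)))
    refine Eq.trans ?_ (hf₁ _).symm
    change F.familiesMap r₀ (smallAct β W₀ m) = F.familiesMap r₁ (smallAct β _ _)
    rw [smallAct_res, familiesMap_toOpenOver]
  rw [key, ← familiesMap_toOpenOver i r₁ r m]
  refine (hf₁ _).trans ?_
  change F.familiesMap r₁ (smallAct β _ _) = _
  rw [smallAct_res, familiesMap_toOpenOver]

/-- Linear maps out of the sections over such a scheme are determined by their values on
restrictions of sections over open subsets of `X`. -/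
lemma linear_ext_small {R : Over X} (hR : smallSieve E.sieve R.hom)
    {f g : E.families R →ₗ[(bigO X).obj (op R)] F.families R}
    (h : ∀ (W : (𝒮.scheme X).Opens) (r : R ⟶ (openOver X).obj W) (m),
      f (E.familiesMap r m) = g (E.familiesMap r m)) : f = g := by
  obtain ⟨W, hW, h'⟩ := hR
  exact (E.isFreeBaseChange_of_mem hW (toOpenOver W h')).ext fun m => h W _ m

instance : (toModules X).Faithful where
  map_injective {E F γ δ} h := hom_ext_of_cover (smallSieve_covers E.covers) fun V hV =>
    LinearMap.congr_fun (linear_ext_small hV fun W r m => by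
      rw [act_familiesMap, act_familiesMap]
      exact congrArg (F.familiesMap r)
        ((toModules_map_app γ W m).symm.trans (congr(($h).app W m))))

/-- The linear extensions of `β` are unique, hence compatible with restriction, and glue to a
morphism of sheaves on the big site. -/
instance : (toModules X).Full where
  map_surjective {E F} β := by
    choose f hf using exists_extension β
    obtain ⟨γ, hγ⟩ := exists_hom_of_cover (smallSieve_covers E.covers) f
      (fun V hV W hW g s => by
        obtain ⟨W₀, hW₀, h₀⟩ := id hV
        let r : V ⟶ (openOver X).obj W₀ := toOpenOver W₀ h₀
        have hg : IsFreeBaseChange (E.resLin g) :=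
          E.isFreeBaseChange_of_mem (sieve_comp _ hW₀ r) g
        obtain ⟨f', hf'⟩ := hg.exists_extension ((F.resLin g).comp (f V hV))
        -- The base change of `f V hV` along `g` has the property that characterizes `f W hW`.
        have : f W hW = f' := (E.isFreeBaseChange_of_mem hW₀ (g ≫ r)).ext fun m => by
          refine (hf W hW _ _ m).trans (Eq.trans ?_
            (congrArg f' (E.familiesMap_comp r g m)))
          refine Eq.trans ?_ (hf' _).symm
          exact (F.familiesMap_comp r g _).symm.trans
            (congrArg (F.familiesMap g) (hf V hV _ r m).symm)
        rw [this]
        exact hf' s)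
    refine ⟨γ, ?_⟩
    ext W s
    refine families_ext_of_cover (pullback_mem (smallSieve_covers E.covers) _) fun V j hj => ?_
    exact (act_familiesMap γ j s).symm.trans ((hγ V _ _).trans
      (hf V (mem_of_pullback hj) W j s))

end StdVB

end StandardVB

namespace StandardVB

/-! ### Local frames of a vector bundle -/

/-- A finite frame of an `𝒪_S`-module over an open subset: sections that form a basis over every
smaller open subset. -/
structure Frame {S : Scheme.{u}} (M : S.Modules) where
  /-- The open subset. -/
  U : S.Opens
  /-- The number of sections. -/
  n : ℕ
  /-- The sections. -/
  e : Fin n → Γ(M, U)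
  bijective : ∀ (V : S.Opens) (h : V ≤ U), Function.Bijective fun c : Fin n → Γ(S, V) =>
    ∑ i, c i • M.presheaf.map (homOfLE h).op (e i)

namespace Frame

variable {S : Scheme.{u}} {M : S.Modules} (a : Frame M)

/-- The coordinates of a section with respect to a frame. -/
noncomputable def coord {V : S.Opens} (h : V ≤ a.U) : Γ(M, V) ≃ₗ[Γ(S, V)] (Fin a.n → Γ(S, V)) :=
  (LinearEquiv.ofBijective (sumSmul fun i => M.presheaf.map (homOfLE h).op (a.e i))
    (a.bijective V h)).symm

lemma sum_coord {V : S.Opens} (h : V ≤ a.U) (m : Γ(M, V)) :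
    ∑ i, a.coord h m i • M.presheaf.map (homOfLE h).op (a.e i) = m :=
  (LinearEquiv.ofBijective (sumSmul fun i => M.presheaf.map (homOfLE h).op (a.e i))
    (a.bijective V h)).apply_symm_apply m

lemma coord_eq {V : S.Opens} (h : V ≤ a.U) {m : Γ(M, V)} {c : Fin a.n → Γ(S, V)}
    (hc : ∑ i, c i • M.presheaf.map (homOfLE h).op (a.e i) = m) : a.coord h m = c :=
  (a.bijective V h).1 ((a.sum_coord h m).trans hc.symm)

lemma coord_map {V W : S.Opens} (h : V ≤ a.U) (i : W ⟶ V) (m : Γ(M, V)) :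
    a.coord ((leOfHom i).trans h) (M.presheaf.map i.op m) =
      fun k => S.presheaf.map i.op (a.coord h m k) := by
  refine a.coord_eq _ ?_
  conv_rhs => rw [← a.sum_coord h m, map_sum]
  refine Finset.sum_congr rfl fun k _ => ?_
  rw [Scheme.Modules.map_smul, map_map]
  rfl

lemma coord_basis {V : S.Opens} (h : V ≤ a.U) (i : Fin a.n) :
    a.coord h (M.presheaf.map (homOfLE h).op (a.e i)) = Pi.single i 1 := by
  refine a.coord_eq h ?_
  simp only [Pi.single_apply, ite_smul, one_smul, zero_smul, Finset.sum_ite_eq', Finset.mem_univ,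
    if_true]

end Frame

variable {𝒮 : SmallSchemes.{u}}

namespace StdVB

variable {X : 𝒮.Cat}

/-- The image of a scheme over `X` lies in an open subset of `X`. -/
def LandsIn (Y : Over X) (U : (𝒮.scheme X).Opens) : Prop :=
  ∀ y : 𝒮.scheme Y.left, Y.hom.hom y ∈ U

lemma LandsIn.of_hom {Y Z : Over X} {U : (𝒮.scheme X).Opens} (h : LandsIn Y U) (g : Z ⟶ Y) :
    LandsIn Z U := fun z => by
  rw [← Over.w g]
  exact h (g.left.hom z)

lemma LandsIn.mono {Y : Over X} {U V : (𝒮.scheme X).Opens} (h : LandsIn Y U) (hUV : U ≤ V) :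
    LandsIn Y V := fun y => hUV (h y)

lemma LandsIn.inf {Y : Over X} {U V : (𝒮.scheme X).Opens} (hU : LandsIn Y U) (hV : LandsIn Y V) :
    LandsIn Y (U ⊓ V) := fun y => ⟨hU y, hV y⟩

lemma landsIn_openOver (U : (𝒮.scheme X).Opens) : LandsIn ((openOver X).obj U) U :=
  𝒮.openHom_mem X U

lemma le_of_landsIn {U V : (𝒮.scheme X).Opens} (h : LandsIn ((openOver X).obj U) V) : U ≤ V := by
  intro x hx
  obtain ⟨z, rfl⟩ := exists_mem_openHom U x hx
  exact h z

/-- The pullback of functions on an open subset `U` of `X` to a scheme over `U`. -/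
noncomputable def pullFun {Y : Over X} {U : (𝒮.scheme X).Opens} (h : LandsIn Y U) :
    Γ(𝒮.scheme X, U) →+* (bigO X).obj (op Y) :=
  (Y.hom.hom.appLE U ⊤ fun y _ => h y).hom

lemma pullFun_map {Y : Over X} {U V : (𝒮.scheme X).Opens} (i : V ⟶ U) (hV : LandsIn Y V)
    (hU : LandsIn Y U) (r : Γ(𝒮.scheme X, U)) :
    pullFun hV ((𝒮.scheme X).presheaf.map i.op r) = pullFun hU r :=
  congr($(Scheme.Hom.map_appLE Y.hom.hom (fun y _ => hV y) i.op) r)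

lemma map_pullFun {Y Z : Over X} {U : (𝒮.scheme X).Opens} (g : Z ⟶ Y) (hY : LandsIn Y U)
    (hZ : LandsIn Z U) (r : Γ(𝒮.scheme X, U)) :
    (bigO X).map g.op (pullFun hY r) = pullFun hZ r := by
  refine (𝒮.O_map_eq g.left _).trans ?_
  have h1 : g.left.hom ≫ Y.hom.hom = Z.hom.hom := congrArg InducedCategory.Hom.hom (Over.w g)
  refine congr($(Scheme.Hom.appLE_comp_appLE g.left.hom Y.hom.hom U ⊤ ⊤ (fun y _ => hY y)
    le_top) r).trans ?_
  exact congr($(appLE_congr_hom h1 U ⊤ _ _) r)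

variable {M : (𝒮.scheme X).Modules} (a b : Frame M)

/-- The coordinates of the pullback of a section of `M` to a scheme over `X`. -/
noncomputable def pullCoord {Y : Over X} (ha : LandsIn Y a.U) {V : (𝒮.scheme X).Opens}
    (h : LandsIn Y V) : Γ(M, V) →ₛₗ[pullFun h] (Fin a.n → (bigO X).obj (op Y)) where
  -- The section is first restricted to `V ⊓ a.U`, where it has coordinates; its values on a scheme
  -- that lands in both `V` and `a.U` are not affected.
  toFun m i := pullFun (h.inf ha)
    (a.coord (inf_le_right : V ⊓ a.U ≤ a.U) (M.presheaf.map (homOfLE inf_le_left).op m) i)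
  map_add' m m' := by
    funext i
    simp only [map_add, Pi.add_apply]
  map_smul' r m := by
    funext i
    rw [Scheme.Modules.map_smul, map_smul, Pi.smul_apply, smul_eq_mul, map_mul,
      pullFun_map _ _ h]
    rfl

lemma pullCoord_apply {Y : Over X} (ha : LandsIn Y a.U) {V : (𝒮.scheme X).Opens} (h : LandsIn Y V)
    (hV : V ≤ a.U) (m : Γ(M, V)) : pullCoord a ha h m = fun i => pullFun h (a.coord hV m i) := by
  funext i
  change pullFun (h.inf ha) _ = _
  have := a.coord_map hV (homOfLE (inf_le_left : V ⊓ a.U ≤ V)) m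
  refine (congrArg (pullFun (h.inf ha)) (congrFun this i)).trans ?_
  exact pullFun_map _ _ _ _

lemma pullCoord_map {Y : Over X} (ha : LandsIn Y a.U) {V W : (𝒮.scheme X).Opens} (i : W ⟶ V)
    (hV : LandsIn Y V) (hW : LandsIn Y W) (m : Γ(M, V)) :
    pullCoord a ha hW (M.presheaf.map i.op m) = pullCoord a ha hV m := by
  funext k
  let j : W ⊓ a.U ⟶ V ⊓ a.U := homOfLE (inf_le_inf_right _ (leOfHom i))
  have := a.coord_map (inf_le_right : V ⊓ a.U ≤ a.U) j
    (M.presheaf.map (homOfLE inf_le_left).op m)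
  refine Eq.trans ?_ (pullFun_map j (hW.inf ha) (hV.inf ha) _)
  refine congrArg (pullFun (hW.inf ha)) (Eq.trans ?_ (congrFun this k))
  refine congrFun (congrArg (a.coord _) ?_) k
  rw [map_map, map_map]
  rfl

lemma map_pullCoord {Y Z : Over X} (g : Z ⟶ Y) (ha : LandsIn Y a.U) (ha' : LandsIn Z a.U)
    {V : (𝒮.scheme X).Opens} (h : LandsIn Y V) (h' : LandsIn Z V) (m : Γ(M, V)) :
    (fun i => (bigO X).map g.op (pullCoord a ha h m i)) = pullCoord a ha' h' m :=
  funext fun _ => map_pullFun g _ _ _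

lemma pullCoord_basis {Y : Over X} (ha : LandsIn Y a.U) (i : Fin a.n) :
    pullCoord a ha ha (a.e i) = Pi.single i 1 := by
  rw [pullCoord_apply a ha ha le_rfl]
  have := a.coord_basis le_rfl i
  rw [show M.presheaf.map (homOfLE (le_refl a.U)).op (a.e i) = a.e i from
    congr($(M.presheaf.map_id (op a.U)) (a.e i))] at this
  rw [this]
  funext k
  simp only [Pi.single_apply]
  split_ifs
  · exact map_one (pullFun ha)
  · exact map_zero (pullFun ha)

/-- The transition map between the coordinates of two frames, over a scheme over `X`. -/
noncomputable def transition {Y : Over X} (ha : LandsIn Y a.U) (hb : LandsIn Y b.U) :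
    (Fin a.n → (bigO X).obj (op Y)) →ₗ[(bigO X).obj (op Y)] (Fin b.n → (bigO X).obj (op Y)) :=
  sumSmul fun i => pullCoord b hb ha (a.e i)

lemma transition_single {Y : Over X} (ha : LandsIn Y a.U) (hb : LandsIn Y b.U) (i : Fin a.n) :
    transition a b ha hb (Pi.single i 1) = pullCoord b hb ha (a.e i) := by
  change ∑ k, (Pi.single i 1 : Fin a.n → (bigO X).obj (op Y)) k • pullCoord b hb ha (a.e k) = _
  simp only [Pi.single_apply, ite_smul, one_smul, zero_smul, Finset.sum_ite_eq', Finset.mem_univ,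
    if_true]

/-- The transition map carries the coordinates with respect to `a` of the pullback of any section to
its coordinates with respect to `b`. -/
lemma transition_pullCoord {Y : Over X} (ha : LandsIn Y a.U) (hb : LandsIn Y b.U)
    {V : (𝒮.scheme X).Opens} (h : LandsIn Y V) (m : Γ(M, V)) :
    transition a b ha hb (pullCoord a ha h m) = pullCoord b hb h m := by
  -- It suffices to treat a section over an open subset of the domain of the frame `a`.
  rw [← pullCoord_map a ha (homOfLE (inf_le_left : V ⊓ a.U ≤ V)) h (h.inf ha),
    ← pullCoord_map b hb (homOfLE (inf_le_left : V ⊓ a.U ≤ V)) h (h.inf ha)]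
  generalize M.presheaf.map (homOfLE (inf_le_left : V ⊓ a.U ≤ V)).op m = m'
  rw [pullCoord_apply a ha _ inf_le_right]
  conv_rhs => rw [← a.sum_coord inf_le_right m', map_sum]
  change ∑ i, pullFun (h.inf ha) (a.coord inf_le_right m' i) • pullCoord b hb ha (a.e i) = _
  refine Finset.sum_congr rfl fun i _ => ?_
  exact (congrArg (pullFun (h.inf ha) (a.coord inf_le_right m' i) • ·)
    (pullCoord_map b hb _ ha (h.inf ha) (a.e i)).symm).trans (map_smulₛₗ _ _ _).symm

lemma transition_self {Y : Over X} (ha : LandsIn Y a.U) (c) : transition a a ha ha c = c := by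
  have h : transition a a ha ha = LinearMap.id := LinearMap.pi_ext' fun i => LinearMap.ext_ring
    ((transition_single a a ha ha i).trans (pullCoord_basis a ha i))
  exact LinearMap.congr_fun h c

lemma transition_transition {Y : Over X} (ha : LandsIn Y a.U) (hb : LandsIn Y b.U) (c) :
    transition b a hb ha (transition a b ha hb c) = c := by
  have h : transition b a hb ha ∘ₗ transition a b ha hb = LinearMap.id := by
    refine LinearMap.pi_ext' fun i => LinearMap.ext_ring ?_
    refine (congrArg (transition b a hb ha) (transition_single a b ha hb i)).trans ?_
    exact (transition_pullCoord b a hb ha ha (a.e i)).trans (pullCoord_basis a ha i)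
  exact LinearMap.congr_fun h c

lemma transition_bijective {Y : Over X} (ha : LandsIn Y a.U) (hb : LandsIn Y b.U) :
    Function.Bijective (transition a b ha hb) :=
  ⟨Function.LeftInverse.injective (transition_transition a b ha hb),
    Function.RightInverse.surjective (transition_transition b a hb ha)⟩

end StdVB

end StandardVB

namespace StandardVB

variable {𝒮 : SmallSchemes.{u}}

namespace StdVB

variable {X : 𝒮.Cat}

/-! ### The standard vector bundle of a vector bundle -/

section OfModule

variable (M : (𝒮.scheme X).Modules)

/-- The schemes over `X` whose image lies in the domain of a frame of `M`. -/
def frameSieve : Sieve X where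
  arrows _ f := ∃ a : Frame M, ∀ y, f.hom y ∈ a.U
  downward_closed := by
    rintro _ _ f ⟨a, ha⟩ g
    exact ⟨a, fun y => ha (g.hom y)⟩

variable {M} in
lemma frameSieve_covers (hM : IsVectorBundle M) : frameSieve M ∈ 𝒮.zariski X := by
  intro x
  obtain ⟨U, hx, n, e, he⟩ := hM x
  exact ⟨_, 𝒮.openHom X U, ⟨⟨U, n, e, he⟩, 𝒮.openHom_mem X U⟩, inferInstance,
    exists_mem_openHom U x hx⟩

/-- A chosen frame of `M` for every object of `frameSieve M`. -/
noncomputable def frameAt (Y : SieveObj (frameSieve M)) : Frame M := Y.2.choose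

lemma landsIn_frameAt (Y : SieveObj (frameSieve M)) : LandsIn Y.1 (frameAt M Y).U :=
  Y.2.choose_spec

/-- The coordinates of the pullback of a section of `M`, in the chosen frame. -/
noncomputable abbrev coordAt (Y : SieveObj (frameSieve M)) {V : (𝒮.scheme X).Opens}
    (h : LandsIn Y.1 V) :
    Γ(M, V) →ₛₗ[pullFun h] (Fin (frameAt M Y).n → (bigO X).obj (op Y.1)) :=
  pullCoord (frameAt M Y) (landsIn_frameAt M Y) h

/-- Restriction along a morphism, in terms of coordinates in the chosen frames. -/
noncomputable def frameMap {Y Z : SieveObj (frameSieve M)} (g : Z.1 ⟶ Y.1) :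
    (Fin (frameAt M Y).n → (bigO X).obj (op Y.1)) →ₛₗ[((bigO X).map g.op).hom]
      (Fin (frameAt M Z).n → (bigO X).obj (op Z.1)) where
  toFun c := transition (frameAt M Y) (frameAt M Z) ((landsIn_frameAt M Y).of_hom g)
    (landsIn_frameAt M Z) fun i => (bigO X).map g.op (c i)
  map_add' c d := by
    rw [← map_add]
    exact congrArg _ (funext fun i => map_add _ _ _)
  map_smul' r c := by
    rw [← map_smul]
    exact congrArg _ (funext fun i => map_mul _ _ _)

/-- Restriction sends the coordinates of a section of `M` to the coordinates of the same section. -/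
lemma frameMap_coordAt {Y Z : SieveObj (frameSieve M)} (g : Z.1 ⟶ Y.1)
    {V : (𝒮.scheme X).Opens} (h : LandsIn Y.1 V) (m : Γ(M, V)) :
    frameMap M g (coordAt M Y h m) = coordAt M Z (h.of_hom g) m := by
  refine (congrArg (transition (frameAt M Y) (frameAt M Z) ((landsIn_frameAt M Y).of_hom g)
    (landsIn_frameAt M Z)) (map_pullCoord _ g (landsIn_frameAt M Y)
      ((landsIn_frameAt M Y).of_hom g) h (h.of_hom g) m)).trans ?_
  exact transition_pullCoord _ _ _ _ _ m

lemma frameMap_single {Y Z : SieveObj (frameSieve M)} (g : Z.1 ⟶ Y.1) (i) :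
    frameMap M g (Pi.single i 1) =
      coordAt M Z ((landsIn_frameAt M Y).of_hom g) ((frameAt M Y).e i) :=
  (congrArg (frameMap M g) (pullCoord_basis _ (landsIn_frameAt M Y) i).symm).trans
    (frameMap_coordAt M g _ _)

variable {M}

/-- The standard vector bundle with sections the coordinates of the sections of `M` in chosen
frames. -/
noncomputable def ofModule (hM : IsVectorBundle M) : StdVB X where
  sieve := frameSieve M
  covers := frameSieve_covers hM
  rank Y := (frameAt M Y).n
  map g := frameMap M g
  map_id Y s := by
    refine (congrArg (transition _ _ _ _) (funext fun i => ?_)).trans (transition_self _ _ s)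
    exact congr($((bigO X).map_id (op Y.1)) (s i))
  map_comp {Y Z W} g h s := by
    -- On basis vectors, which are coordinates of sections of `M`, this is `frameMap_coordAt`.
    rw [semilinear_eq_sum _ (frameMap M (h ≫ g)), semilinear_eq_sum _ (frameMap M g), map_sum]
    refine Finset.sum_congr rfl fun i _ => ?_
    rw [map_smulₛₗ, frameMap_single, frameMap_single, frameMap_coordAt]
    exact congrArg (· • _) (bigO_map_comp h g (s i))
  bijective {Y Z} g := by
    refine (congrArg Function.Bijective (funext fun c => ?_)).mpr
      (transition_bijective (frameAt M Y) (frameAt M Z) ((landsIn_frameAt M Y).of_hom g)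
        (landsIn_frameAt M Z))
    exact Finset.sum_congr rfl fun i _ => congrArg (c i • ·) (frameMap_single M g i)

/-- The section of the associated standard vector bundle defined by a section of `M`. -/
noncomputable def ofSection (hM : IsVectorBundle M) (W : (𝒮.scheme X).Opens) :
    Γ(M, W) →ₗ[Γ(𝒮.scheme X, W)] Γ((toModules X).obj (ofModule hM), W) where
  toFun m := show (ofModule hM).families ((openOver X).obj W) from
    ⟨fun V v => coordAt M V ((landsIn_openOver W).of_hom v) m,
      fun V V' v t => frameMap_coordAt M t _ m⟩
  map_add' m m' := families_ext fun V v => map_add _ _ _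
  map_smul' r m := families_ext fun V v => by
    refine (map_smulₛₗ (coordAt M V ((landsIn_openOver W).of_hom v)) r m).trans ?_
    exact congrArg (· • coordAt M V ((landsIn_openOver W).of_hom v) m)
      (map_pullFun v (landsIn_openOver W) ((landsIn_openOver W).of_hom v) r).symm

/-- The comparison of `M` with the restriction of the associated standard vector bundle. -/
noncomputable def ofModuleHom (hM : IsVectorBundle M) : M ⟶ (toModules X).obj (ofModule hM) :=
  homOfLinear (ofSection hM) fun i m => families_ext fun V _ =>
    pullCoord_map (frameAt M V) (landsIn_frameAt M V) i _ _ m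

lemma bijective_ofModuleHom_app (hM : IsVectorBundle M) (a : Frame M) (W : (𝒮.scheme X).Opens)
    (h : W ≤ a.U) : Function.Bijective ((ofModuleHom hM).app W) := by
  let P : SieveObj (ofModule hM).sieve :=
    ⟨(openOver X).obj W, a, (landsIn_openOver W).mono h⟩
  let b := frameAt M P
  have hb : W ≤ b.U := le_of_landsIn (landsIn_frameAt M P)
  refine (Function.Bijective.of_comp_iff' ((ofModule hM).evalEquiv P).bijective _).1 ?_
  have key : ∀ m, (ofModule hM).evalEquiv P ((ofModuleHom hM).app W m) =
      fun i => openRes W (b.coord hb m i) := fun m =>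
    pullCoord_apply b (landsIn_frameAt M P) ((landsIn_openOver W).of_hom (𝟙 _)) hb m
  refine (congrArg Function.Bijective (funext key)).mpr ?_
  exact (Function.Bijective.piMap fun _ => openRes_bijective W).comp (b.coord hb).bijective

open ZeroObject in
/-- The comparison is bijective on sections over all open subsets of the domains of frames. -/
instance isIso_ofModuleHom (hM : IsVectorBundle M) : IsIso (ofModuleHom hM) := by
  have h : (ShortComplex.mk (ofModuleHom hM) (0 : _ ⟶ (0 : (𝒮.scheme X).Modules))
      comp_zero).ShortExact := by
    refine shortExact_of_locally _ fun x => ?_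
    obtain ⟨U, hx, n, e, he⟩ := hM x
    refine ⟨U, hx, fun V hV => ?_⟩
    have hb := bijective_ofModuleHom_app hM ⟨U, n, e, he⟩ V hV
    refine ⟨hb.1, fun n _ => hb.2 n, fun k => ⟨0, ?_⟩⟩
    have h0 : (𝟙 (0 : (𝒮.scheme X).Modules)) = 0 := (isZero_zero _).eq_of_src _ _
    exact (map_zero _).trans (congr(($h0).app V k)).symm
  exact h.isIso_f_iff.2 (isZero_zero _)

lemma essImage_toModules_of_isVectorBundle (hM : IsVectorBundle M) :
    (toModules X).essImage M :=
  ⟨ofModule hM, ⟨(asIso (ofModuleHom hM)).symm⟩⟩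

end OfModule

/-- Over an open subset in the sieve of `E`, the standard basis of the sections is a frame. -/
theorem isVectorBundle_toModules (E : StdVB X) : IsVectorBundle ((toModules X).obj E) := by
  intro x
  obtain ⟨U, hx, hU⟩ := exists_open_mem E.covers x
  let P : SieveObj E.sieve := ⟨(openOver X).obj U, hU⟩
  refine ⟨U, hx, E.rank P, E.stdBasis P, fun V hV => ?_⟩
  exact (E.bijective_stdBasis P ((openOver X).map (homOfLE hV))).comp
    (Function.Bijective.piMap fun _ => openRes_bijective V)

lemma isVectorBundle_of_iso {S : Scheme.{u}} {M N : S.Modules} (i : M ≅ N)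
    (hM : IsVectorBundle M) : IsVectorBundle N := by
  intro x
  obtain ⟨U, hx, n, e, he⟩ := hM x
  refine ⟨U, hx, n, fun k => i.hom.app U (e k), fun V hV => ?_⟩
  let f : Γ(M, V) →ₗ[Γ(S, V)] Γ(N, V) :=
    { toFun := i.hom.app V, map_add' := map_add _, map_smul' := i.hom.app_smul }
  have hf : Function.Bijective f :=
    Function.bijective_iff_has_inverse.2 ⟨i.inv.app V, fun m => congr(($i.hom_inv_id).app V m),
      fun m => congr(($i.inv_hom_id).app V m)⟩
  refine (congrArg Function.Bijective (funext fun c => ?_)).mpr (hf.comp (he V hV))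
  refine Eq.trans ?_ (map_sum f _ _).symm
  refine Finset.sum_congr rfl fun k _ => ?_
  exact (congrArg (c k • ·) (app_naturality i.hom (homOfLE hV) (e k)).symm).trans
    (map_smul f _ _).symm

end StdVB

end StandardVB

namespace StandardVB

variable {𝒮 : SmallSchemes.{u}}

namespace StdVB

variable {X : 𝒮.Cat}

/-! ### The equivalence with vector bundles -/

lemma isVectorBundle_of_essImage {M : (𝒮.scheme X).Modules} (h : (toModules X).essImage M) :
    IsVectorBundle M := by
  obtain ⟨E, ⟨i⟩⟩ := h
  exact isVectorBundle_of_iso i (isVectorBundle_toModules E)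

variable (X) in
/-- The essential image of `Φ`, the vector bundles, is closed under extensions. -/
theorem isExactCategory_stdExact : IsExactCategory (stdExact X) :=
  isExactCategory_of_fullyFaithful (toModules X) isZero_zeroBundle fun _ _ _ h hX hZ =>
    essImage_toModules_of_isVectorBundle (isVectorBundle_of_shortExact h
      (isVectorBundle_of_essImage hX) (isVectorBundle_of_essImage hZ))

variable (X) in
/-- The functor `Φ`, with values in the category of vector bundles. -/
noncomputable abbrev toVB : StdVB X ⥤ VB (𝒮.scheme X) :=
  ObjectProperty.lift _ (toModules X) isVectorBundle_toModules

instance : (toVB X).Additive where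
  map_add := rfl

instance : (toVB X).EssSurj where
  mem_essImage M :=
    ⟨ofModule M.property, ⟨ObjectProperty.isoMk _ (asIso (ofModuleHom M.property)).symm⟩⟩

instance : (toVB X).IsEquivalence where

lemma isExactFunctor_toVB : IsExactFunctor (stdExact X) (vbExact (𝒮.scheme X)) (toVB X) where
  additive := inferInstance
  map T hT := ⟨(T.map (toVB X)).zero, hT⟩

instance : (toVB X).inv.Additive :=
  have : (toVB X).asEquivalence.functor.Additive := inferInstanceAs (toVB X).Additive
  (toVB X).asEquivalence.inverse_additive

/-- The composition of the quasi-inverse with `Φ` is isomorphic to the inclusion of vector bundles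
in modules, and exactness is tested by `Φ`. -/
lemma isExactFunctor_inv : IsExactFunctor (vbExact (𝒮.scheme X)) (stdExact X) (toVB X).inv where
  additive := inferInstance
  map T hT := by
    refine ⟨(T.map (toVB X).inv).zero, ?_⟩
    let i := ObjectProperty.ι (C := (𝒮.scheme X).Modules) IsVectorBundle
    let c := Functor.isoWhiskerRight (toVB X).asEquivalence.counitIso i
    exact shortExact_congr hT (c.app _).symm (c.app _).symm (c.app _).symm _
      (c.inv.naturality T.f).symm (c.inv.naturality T.g).symm

end StdVB

end StandardVB
theorem theorem3p8 (𝒮 : SmallSchemes.{u}) :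
    (∀ X : 𝒮.Cat, Small.{u} (StdVB X) ∧ LocallySmall.{u} (StdVB X) ∧
      IsExactCategory (stdExact X)) ∧
    (∀ X : 𝒮.Cat, ∃ h : ∀ E : StdVB X, IsVectorBundle ((toModules X).obj E),
      ∃ e : StdVB X ≌ VB (𝒮.scheme X),
        e.functor = ObjectProperty.lift _ (toModules X) h ∧
        IsExactFunctor (stdExact X) (vbExact (𝒮.scheme X)) e.functor ∧
        IsExactFunctor (vbExact (𝒮.scheme X)) (stdExact X) e.inverse) ∧
    ((∀ {X Y : 𝒮.Cat} (f : Y ⟶ X), IsExactFunctor (stdExact X) (stdExact Y) (inverseImage f)) ∧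
      ∀ {X Y Z : 𝒮.Cat} (f : Y ⟶ X) (g : Z ⟶ Y),
        inverseImage (g ≫ f) = inverseImage f ⋙ inverseImage g) ∧
    (∀ (X : 𝒮.Cat) (E : StdVB X),
      (tensor X).obj (zeroBundle X, E) = (zeroBundle X).restrict E.sieve E.covers le_top ∧
      (tensor X).obj (E, zeroBundle X) = (zeroBundle X).restrict E.sieve E.covers le_top ∧
      IsZero (zeroBundle X) ∧ IsZero ((zeroBundle X).restrict E.sieve E.covers le_top) ∧
      IsExactFunctor (stdExact X) (stdExact X) (Prod.sectL (StdVB X) E ⋙ tensor X) ∧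
      IsExactFunctor (stdExact X) (stdExact X) (Prod.sectR E (StdVB X) ⋙ tensor X)) :=
  ⟨fun X => ⟨inferInstance, inferInstance, isExactCategory_stdExact X⟩,
    fun X => ⟨isVectorBundle_toModules, (toVB X).asEquivalence, rfl, isExactFunctor_toVB,
      isExactFunctor_inv⟩,
    ⟨isExactFunctor_inverseImage, inverseImage_comp⟩,
    fun _ E => ⟨zeroBundle_tensor E, tensor_zeroBundle E, isZero_zeroBundle,
      isZero_restrict_zeroBundle _ _, isExactFunctor_tensorRight E,
      isExactFunctor_tensorLeft E⟩⟩
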